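/- **Setting.** Let $\Gamma=\bigcup_{E\in\mathbf E}\bar E\subset\mathbb R^d$ be a finite connected network: $\mathbf V=\{\mathrm v_1,\dots,\mathrm v_n\}$ is a finite set of distinct points (vertices); each $E\in\mathbf E$ is an open line segment joining two vertices $\mathrm v_i,\mathrm v_j$, $i<j$, with $\bar E\cap\mathbf V=\{\mathrm v_i,\mathrm v_j\}$; distinct edges are disjoint; every vertex is an end point of at least one edge. Write $\ell_E=|\mathrm v_i-\mathrm v_j|$, $\gamma_E(t)=\mathrm v_i+t(\mathrm v_j-\mathrm v_i)/\ell_E$ for $t\in[0,\ell_E]$, $u_E=u\circ\gamma_E$ for $u:\Gamma\to\mathbb R$, and $\mathrm{Inc}(\mathrm v)$ for the set of edges having $\mathrm v$ as an end point. A vertex is interior ($\mathrm v\in\mathbf V_{\mathbf i}$) if $N_{\mathrm v}:=\#\mathrm{Inc}(\mathrm v)>1$, and a boundary vertex ($\mathrm v\in\mathbf V_{\mathbf b}$) if $N_{\mathrm v}=1$. Let $C^2(\Gamma)$ be the set of continuous $\varphi:\Gamma\to\mathbb R$ with $\varphi_E\in C^2([0,\ell_E])$ for all $E$; $\varphi_x,\varphi_{xx}$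 are the derivatives of $\varphi_E$ (one-sided at the end points, denoted $\varphi_{x_E}(\mathrm v),\varphi_{x_Ex_E}(\mathrm v)$), and $\partial_E\varphi(\mathrm v)=\lim_{x\to\mathrm v,\,x\in E}\frac{\varphi(x)-\varphi(\mathrm v)}{|x-\mathrm v|}$ for $E\in\mathrm{Inc}(\mathrm v)$ is the inward derivative, $\boldsymbol{\partial\varphi}(\mathrm v)=(\partial_E\varphi(\mathrm v))_{E\in\mathrm{Inc}(\mathrm v)}$. **Problem.** Given $\lambda\in\mathbb R$, $a_E:\bar E\to\mathbb R$, $H_E:\bar E\times\mathbb R\to\mathbb R$ ($E\in\mathbf E$), $F^{\mathrm v}:\mathbb R\times\mathbb R^{N_{\mathrm v}}\to\mathbb R$ ($\mathrm v\in\mathbf V_{\mathbf i}$) and $h_{\mathrm v}\in\mathbb R$ ($\mathrm v\in\mathbf V_{\mathbf b}$), consider $$\lambda u-a_E(x)u_{xx}+H_E(x,u_x)=0\ \text{ on each } E\in\mathbf E,\qquad F^{\mathrm v}(u(\mathrm v),\boldsymbol{\partial u}(\mathrm v))=0\ \ (\mathrm v\in\mathbf V_{\mathbf i}),\qquad u(\mathrm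 v)=h_{\mathrm v}\ \ (\mathrm v\in\mathbf V_{\mathbf b}).\tag{1}$$ Put $G_E(r,p,X,x)=\lambda r-a_E(x)X+H_E(x,p)$. An upper semicontinuous $u:\Gamma\to\mathbb R$ is a viscosity subsolution of (1) if, whenever $\varphi\in C^2(\Gamma)$ and $u-\varphi$ has a local maximum (on $\Gamma$) at $x\in\Gamma$, * $G_E(u(x),\varphi_x(x),\varphi_{xx}(x),x)\le 0$ if $x\in E$; * $\min\{\min_{E\in\mathrm{Inc}(\mathrm v)}G_E(u(\mathrm v),\varphi_{x_E}(\mathrm v),\varphi_{x_Ex_E}(\mathrm v),\mathrm v),\ F^{\mathrm v}(u(\mathrm v),\boldsymbol{\partial\varphi}(\mathrm v))\}\le 0$ if $x=\mathrm v\in\mathbf V_{\mathbf i}$; * $\min\{G_E(u(\mathrm v),\varphi_{x_E}(\mathrm v),\varphi_{x_Ex_E}(\mathrm v),\mathrm v),\ u(\mathrm v)-h_{\mathrm v}\}\le 0$ if $x=\mathrm v\in\mathbf V_{\mathbf b}$ and $\mathrm{Inc}(\mathrm v)=\{E\}$. Lower semicontinuous viscosity supersolutions are defined by replacing maximum, $\min$,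 $\le$ with minimum, $\max$, $\ge$. A viscosity solution is a locally bounded $u:\Gamma\to\mathbb R$ whose upper (resp. lower) semicontinuous envelope is a viscosity subsolution (resp. supersolution). **Assumptions.** 1. $\lambda>0$. 2. For each $E$ there is $C>0$ with $|H_E(x,p)-H_E(y,p)|\le C(1+|p|)|x-y|$ and $|H_E(x,p)-H_E(x,q)|\le C|p-q|$ for all $x,y\in\bar E$, $p,q\in\mathbb R$. 3. For each $E$, $a_E=\sigma_E^2$ on $\bar E$ with $\sigma_E$ Lipschitz continuous on $\bar E$. 4. For each $\mathrm v\in\mathbf V_{\mathbf i}$, $F^{\mathrm v}$ is continuous; if $r\ge s$ and $p_i\le q_i$ for all $i$, then $F^{\mathrm v}(r,p)\ge F^{\mathrm v}(s,q)$, with strict inequality if moreover $p_j<q_j$ for some $j$; and for every $i$, $r$ and $(p_j)_{j\ne i}$, $\lim_{p_i\to-\infty}F^{\mathrm v}(r,p_1,\dots,p_{N_{\mathrm v}})=+\infty$. 5. For each $\mathrm v\in\mathbf V$ and $E\in\mathrm{Inc}(\mathrm v)$, either $a_E(\mathrm v)>0$, or there is $C>0$ such that $H_E(x,p)\ge C^{-1}|p|-C$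 for all $p\in\mathbb R$ and all $x$ in some neighborhood of $\mathrm v$ in $\bar E$. 6. For each $\mathrm v\in\mathbf V_{\mathbf i}$ and every $i$, $r$ and $(p_j)_{j\ne i}$, $\lim_{p_i\to+\infty}F^{\mathrm v}(r,p_1,\dots,p_{N_{\mathrm v}})=-\infty$. **Theorem 5.5.** Under assumptions 1–6 there exists a unique viscosity solution $u\in C(\Gamma)$ of (1). If, in addition, for each $E\in\mathbf E$ either there is $C>0$ such that $H_E(x,p)\ge C^{-1}|p|-C$ for all $x\in\bar E$ and $p\in\mathbb R$, or there is $\alpha>0$ such that $a_E\ge\alpha$ on $\bar E$, then this solution is locally Lipschitz continuous on $\Gamma\setminus\mathbf V_{\mathbf b}$. -/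

import Mathlib

open Set Filter Topology

noncomputable section

/-- A finite network in `ℝ^d`: labelled distinct vertices, and edges which are line segments joining
two vertices. An edge is stored as the pair `(i, j)`, `i < j`, of the labels of its end points. -/
structure Network (d : ℕ) where
  /-- number of vertices -/
  n : ℕ
  /-- position of the vertices -/
  vert : Fin n → EuclideanSpace ℝ (Fin d)
  vert_injective : Function.Injective vert
  /-- the edges -/
  edges : Finset (Fin n × Fin n)
  edges_lt : ∀ e ∈ edges, e.1 < e.2
  /-- the only vertices on a closed edge are its end points -/
  vert_mem_segment : ∀ e ∈ edges, ∀ k,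
    vert k ∈ segment ℝ (vert e.1) (vert e.2) → k = e.1 ∨ k = e.2
  /-- distinct open edges do not meet -/
  edges_disjoint : ∀ e ∈ edges, ∀ e' ∈ edges, e ≠ e' →
    Disjoint (openSegment ℝ (vert e.1) (vert e.2)) (openSegment ℝ (vert e'.1) (vert e'.2))
  /-- every vertex is an end point of some edge -/
  exists_incident : ∀ k, ∃ e ∈ edges, k = e.1 ∨ k = e.2
  /-- the network is connected -/
  connected : IsConnected (⋃ e ∈ edges, segment ℝ (vert e.1) (vert e.2))

namespace Network

variable {d : ℕ} (N : Network d)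

/-- The type of edges. -/
abbrev Edge : Type := {e : Fin N.n × Fin N.n // e ∈ N.edges}

/-- Label of the first end point of an edge (parameter `0`). -/
abbrev src (E : N.Edge) : Fin N.n := E.1.1

/-- Label of the second end point of an edge (parameter `N.len E`). -/
abbrev tgt (E : N.Edge) : Fin N.n := E.1.2

/-- The closed edge, as a subset of `ℝ^d`. -/
def closedEdge (E : N.Edge) : Set (EuclideanSpace ℝ (Fin d)) :=
  segment ℝ (N.vert (N.src E)) (N.vert (N.tgt E))

/-- The length of an edge. -/
def len (E : N.Edge) : ℝ := dist (N.vert (N.src E)) (N.vert (N.tgt E))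

/-- The edges incident to a vertex. -/
abbrev Inc (v : Fin N.n) : Type := {E : N.Edge // v = N.src E ∨ v = N.tgt E}

/-- Interior vertices: more than one incident edge. -/
def IsInterior (v : Fin N.n) : Prop := 1 < Nat.card (N.Inc v)

/-- Boundary vertices: exactly one incident edge. -/
def IsBoundary (v : Fin N.n) : Prop := Nat.card (N.Inc v) = 1

/-- The network as a subset of `ℝ^d`: the union of its closed edges. It carries the topology and the
distance induced by the Euclidean norm, which is equivalent to the geodesic distance. -/
def carrier : Set (EuclideanSpace ℝ (Fin d)) := ⋃ E : N.Edge, N.closedEdge E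

theorem len_pos (E : N.Edge) : 0 < N.len E :=
  dist_pos.2 fun h => (N.edges_lt E.1 E.2).ne (N.vert_injective h)

/-- The arc length parametrization `t ↦ v_i + t (v_j - v_i) / ℓ` of the line through an edge. -/
def edgePoint (E : N.Edge) (t : ℝ) : EuclideanSpace ℝ (Fin d) :=
  N.vert (N.src E) + (t / N.len E) • (N.vert (N.tgt E) - N.vert (N.src E))

theorem edgePoint_mem (E : N.Edge) {t : ℝ} (ht : t ∈ Icc 0 (N.len E)) :
    N.edgePoint E t ∈ N.closedEdge E := by
  unfold closedEdge
  rw [segment_eq_image']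
  exact ⟨t / N.len E, ⟨div_nonneg ht.1 (N.len_pos E).le, (div_le_one (N.len_pos E)).2 ht.2⟩, rfl⟩

/-- The arc length parametrization of a closed edge by `[0, ℓ]`, with values in the network (and
extended by constants outside of `[0, ℓ]`). -/
def param (E : N.Edge) (t : ℝ) : N.carrier :=
  ⟨N.edgePoint E (projIcc 0 (N.len E) (N.len_pos E).le t),
    mem_iUnion.2 ⟨E, N.edgePoint_mem E (projIcc 0 (N.len E) (N.len_pos E).le t).2⟩⟩

theorem vert_mem_carrier (v : Fin N.n) : N.vert v ∈ N.carrier := by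
  obtain ⟨e, he, h⟩ := N.exists_incident v
  refine mem_iUnion.2 ⟨⟨e, he⟩, ?_⟩
  rcases h with rfl | rfl
  · exact left_mem_segment ℝ _ _
  · exact right_mem_segment ℝ _ _

/-- A vertex, as a point of the network. -/
def vertex (v : Fin N.n) : N.carrier := ⟨N.vert v, N.vert_mem_carrier v⟩

/-- The function `u_E` on `[0, ℓ]` associated with a function `u` on the network. -/
def onEdge (u : N.carrier → ℝ) (E : N.Edge) (t : ℝ) : ℝ := u (N.param E t)

/-- `C^2` functions on the network: continuous, and `C^2` up to the end points on each edge. -/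
def IsC2 (φ : N.carrier → ℝ) : Prop :=
  Continuous φ ∧ ∀ E, ContDiffOn ℝ 2 (N.onEdge φ E) (Icc 0 (N.len E))

/-- The first derivative `φ_x` along `E` at the parameter `t ∈ [0, ℓ]` (one-sided at the ends). -/
def dx (φ : N.carrier → ℝ) (E : N.Edge) (t : ℝ) : ℝ :=
  derivWithin (N.onEdge φ E) (Icc 0 (N.len E)) t

/-- The second derivative `φ_xx` along `E` at the parameter `t ∈ [0, ℓ]`. -/
def dxx (φ : N.carrier → ℝ) (E : N.Edge) (t : ℝ) : ℝ :=
  iteratedDerivWithin 2 (N.onEdge φ E) (Icc 0 (N.len E)) t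

/-- The parameter of an end point `v` of the edge `E`. -/
def coord (v : Fin N.n) (E : N.Edge) : ℝ := if v = N.src E then 0 else N.len E

/-- The inward derivative at an end point `v` of `E`, that is the limit of
`(φ x - φ v) / |x - v|` as `x → v` in `E`: the derivative along the parametrization, with the sign
changed if `v` is the second end point. -/
def inwardDeriv (φ : N.carrier → ℝ) (v : Fin N.n) (E : N.Edge) : ℝ :=
  if v = N.src E then N.dx φ E 0 else -N.dx φ E (N.len E)

end Network

/-- Regularity of a Hamiltonian on the set `S`: Lipschitz continuity in `x` with a constant which
grows at most linearly in `p`, and in `p` uniformly in `x`. -/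
def HamiltonianRegular {X : Type*} [MetricSpace X] (S : Set X) (H : X → ℝ → ℝ) : Prop :=
  ∃ C > 0, (∀ x ∈ S, ∀ y ∈ S, ∀ p, |H x p - H y p| ≤ C * (1 + |p|) * dist x y) ∧
    ∀ x ∈ S, ∀ p q, |H x p - H x q| ≤ C * |p - q|

/-- Coercivity of a Hamiltonian on the set `S`. -/
def HamiltonianCoercive {X : Type*} (S : Set X) (H : X → ℝ → ℝ) : Prop :=
  ∃ C > 0, ∀ x ∈ S, ∀ p, C⁻¹ * |p| - C ≤ H x p

/-- The diffusion coefficient is the square of a Lipschitz continuous function on `S`. -/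
def DiffusionRegular {X : Type*} [MetricSpace X] (S : Set X) (a : X → ℝ) : Prop :=
  ∃ σ : X → ℝ, ∃ C > 0, (∀ x ∈ S, a x = σ x ^ 2) ∧ ∀ x ∈ S, ∀ y ∈ S, |σ x - σ y| ≤ C * dist x y

/-- A nonlinear Kirchhoff function: continuous, monotone, and tending to `+∞` as one of the
slopes tends to `-∞`. -/
structure KirchhoffFunction {ι : Type*} [DecidableEq ι] (F : ℝ → (ι → ℝ) → ℝ) : Prop where
  continuous : Continuous fun z : ℝ × (ι → ℝ) => F z.1 z.2
  mono : ∀ r s p q, s ≤ r → (∀ i, p i ≤ q i) → F s q ≤ F r p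
  strictMono : ∀ r s p q, s ≤ r → (∀ i, p i ≤ q i) → (∃ j, p j < q j) → F s q < F r p
  tendsto_atTop : ∀ i r (p : ι → ℝ),
    Tendsto (fun t => F r (Function.update p i t)) atBot atTop

/-- `F` tends to `-∞` as one of the slopes tends to `+∞`. -/
def KirchhoffCoercive {ι : Type*} [DecidableEq ι] (F : ℝ → (ι → ℝ) → ℝ) : Prop :=
  ∀ i r (p : ι → ℝ), Tendsto (fun t => F r (Function.update p i t)) atTop atBot

/-- The data of the problem on a network: `lam u - a_E u_xx + H_E(x, u_x) = 0` on each edge `E`,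
`F^v(u(v), ∂u(v)) = 0` at the interior vertices, `u(v) = h_v` at the boundary vertices.
Only the values of `a E` and `H E` on the closed edge `E`, of `F v` at interior vertices, and of
`h v` at boundary vertices are used. -/
structure NetworkProblem {d : ℕ} (N : Network d) where
  lam : ℝ
  a : N.Edge → EuclideanSpace ℝ (Fin d) → ℝ
  H : N.Edge → EuclideanSpace ℝ (Fin d) → ℝ → ℝ
  F : (v : Fin N.n) → ℝ → (N.Inc v → ℝ) → ℝ
  h : Fin N.n → ℝ

namespace NetworkProblem

variable {d : ℕ} {N : Network d} (P : NetworkProblem N)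

/-- `G_E(r, p, X, x) = lam r - a_E(x) X + H_E(x, p)`. -/
def G (E : N.Edge) (r p X : ℝ) (x : EuclideanSpace ℝ (Fin d)) : ℝ :=
  P.lam * r - P.a E x * X + P.H E x p

/-- `G_E(r, φ_x, φ_xx, x)` at the point `x` of parameter `t` on the closed edge `E`. -/
def GAt (E : N.Edge) (r : ℝ) (φ : N.carrier → ℝ) (t : ℝ) : ℝ :=
  P.G E r (N.dx φ E t) (N.dxx φ E t) (N.param E t : EuclideanSpace ℝ (Fin d))

/-- Viscosity subsolutions. The vertex conditions `min {…} ≤ 0` are written as disjunctions. -/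
structure IsSubsolution (u : N.carrier → ℝ) : Prop where
  usc : UpperSemicontinuous u
  edge : ∀ φ, N.IsC2 φ → ∀ E, ∀ t ∈ Ioo 0 (N.len E),
    IsLocalMax (fun x => u x - φ x) (N.param E t) → P.GAt E (u (N.param E t)) φ t ≤ 0
  interior : ∀ φ, N.IsC2 φ → ∀ v, N.IsInterior v →
    IsLocalMax (fun x => u x - φ x) (N.vertex v) →
      (∃ E : N.Inc v, P.GAt E (u (N.vertex v)) φ (N.coord v E) ≤ 0) ∨
        P.F v (u (N.vertex v)) (fun E => N.inwardDeriv φ v E) ≤ 0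
  boundary : ∀ φ, N.IsC2 φ → ∀ v, N.IsBoundary v →
    IsLocalMax (fun x => u x - φ x) (N.vertex v) →
      (∃ E : N.Inc v, P.GAt E (u (N.vertex v)) φ (N.coord v E) ≤ 0) ∨ u (N.vertex v) - P.h v ≤ 0

/-- Viscosity supersolutions. The vertex conditions `max {…} ≥ 0` are written as disjunctions. -/
structure IsSupersolution (u : N.carrier → ℝ) : Prop where
  lsc : LowerSemicontinuous u
  edge : ∀ φ, N.IsC2 φ → ∀ E, ∀ t ∈ Ioo 0 (N.len E),
    IsLocalMin (fun x => u x - φ x) (N.param E t) → 0 ≤ P.GAt E (u (N.param E t)) φ t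
  interior : ∀ φ, N.IsC2 φ → ∀ v, N.IsInterior v →
    IsLocalMin (fun x => u x - φ x) (N.vertex v) →
      (∃ E : N.Inc v, 0 ≤ P.GAt E (u (N.vertex v)) φ (N.coord v E)) ∨
        0 ≤ P.F v (u (N.vertex v)) (fun E => N.inwardDeriv φ v E)
  boundary : ∀ φ, N.IsC2 φ → ∀ v, N.IsBoundary v →
    IsLocalMin (fun x => u x - φ x) (N.vertex v) →
      (∃ E : N.Inc v, 0 ≤ P.GAt E (u (N.vertex v)) φ (N.coord v E)) ∨ 0 ≤ u (N.vertex v) - P.h v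

/-- Viscosity solutions: locally bounded functions whose upper (resp. lower) semicontinuous envelope
is a viscosity subsolution (resp. supersolution). -/
structure IsSolution (u : N.carrier → ℝ) : Prop where
  locallyBounded : ∀ x, ∃ M : ℝ, ∀ᶠ y in 𝓝 x, |u y| ≤ M
  sub : P.IsSubsolution fun x => limsup u (𝓝 x)
  super : P.IsSupersolution fun x => liminf u (𝓝 x)

end NetworkProblem

end

/-! ### Barriers for subsolutions on a single edge -/

noncomputable section

/-! Uniqueness follows from a comparison principle, `Standing.comparison`: a bounded subsolution `u`
lies below a bounded supersolution `w`. Otherwise, for small `η`, the function `u + η * bump - w`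
has a maximum point where `u > w`; here `bump` is concave on the edges, vanishes at the vertices and
has inward slope 1 there. Three positions are excluded.

Inside an edge this is classical second order theory: doubling of variables, sup-convolutions, a
one-dimensional Alexandrov theorem and Jensen's lemma, leading to `doubling_comparison` and
`edge_comparison`.

At an interior vertex, coercivity of the Hamiltonian or positivity of the diffusion makes steep
concave parabolas strict supersolutions. With the blow-up of the Kirchhoff function as a slope tends
to `-∞`, this makes `u` Lipschitz at the vertex (`IsSubsolution.vertex_lipschitz`). Because of the
bump, `w` leaves the vertex more steeply than `u`, and `exists_separating_slopes` finds on each edge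
slopes `s₁ < s₂` between them for which the equation is strictly violated, at `s₁` by `u` and at
`s₂` by `w`. Only the Kirchhoff alternatives remain, so `F (u v) s₁ ≤ 0 ≤ F (w v) s₂`, against
strict monotonicity.

At a boundary vertex, barriers give `u v ≤ h v` in the usual sense. If the diffusion is positive
there, duality gives `h v ≤ w v`; if it vanishes, separating slopes are used again. The latter needs
`u v` to be approached by values of `u` inside the edge.

Existence is Perron's method. The largest subsolution `U` has a supersolution as lower envelope.
Lowering `U` at boundary vertices to the limsup of its neighbouring values gives a subsolution `V`
to which comparison applies, and `V` coincides with the lower envelope of `U`, hence is continuous.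
Local Lipschitz continuity comes from the same barriers and uses only the subsolution property. -/

theorem UpperSemicontinuousOn.exists_forall_le {X : Type*} [TopologicalSpace X] {f : X → ℝ}
    {s : Set X} (hf : UpperSemicontinuousOn f s) (hs : IsCompact s) (hne : s.Nonempty) :
    ∃ t ∈ s, ∀ y ∈ s, f y ≤ f t := by
  obtain ⟨t, ht, hmax⟩ := hf.exists_isMaxOn hne hs
  exact ⟨t, ht, isMaxOn_iff.1 hmax⟩

/-- The quadratic polynomial with slope `p` and second derivative `X` at `t` touches `u` from above
at `t`. -/
def HasUpperJet (u : ℝ → ℝ) (t p X : ℝ) : Prop :=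
  ∀ᶠ y in 𝓝 t, u y ≤ u t + p * (y - t) + X / 2 * (y - t) ^ 2

/-- Viscosity subsolutions of `L u - a u'' + H(x, u') = 0` on the set `s`, in terms of quadratic
test functions. -/
def IsEdgeSub (L : ℝ) (a : ℝ → ℝ) (H : ℝ → ℝ → ℝ) (s : Set ℝ) (u : ℝ → ℝ) : Prop :=
  ∀ t ∈ s, ∀ p X, HasUpperJet u t p X → L * u t - a t * X + H t p ≤ 0

/-- The Hamiltonian of the equation solved by `-u`. -/
def dualHam (H : ℝ → ℝ → ℝ) : ℝ → ℝ → ℝ := fun x p => -H x (-p)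

theorem IsEdgeSub.mono {L : ℝ} {a : ℝ → ℝ} {H : ℝ → ℝ → ℝ} {s s' : Set ℝ} {u : ℝ → ℝ}
    (h : IsEdgeSub L a H s u) (hs : s' ⊆ s) : IsEdgeSub L a H s' u :=
  fun t ht => h t (hs ht)

/-- A point where `u - ψ` has a local maximum gives an upper jet, for quadratic `ψ`. -/
theorem hasUpperJet_of_isLocalMax {u : ℝ → ℝ} {t c x₀ p k : ℝ}
    (h : ∀ᶠ y in 𝓝 t, u y - (c + p * (y - x₀) + k * (y - x₀) ^ 2) ≤
      u t - (c + p * (t - x₀) + k * (t - x₀) ^ 2)) :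
    HasUpperJet u t (p + 2 * k * (t - x₀)) (2 * k) := by
  filter_upwards [h] with y hy
  nlinarith

/-- A positive maximum of `u` minus the quadratic cannot sit at an end point, so the quadratic is an
admissible test function there. Strictness is needed only where `u` is above it. -/
theorem IsEdgeSub.le_quadratic {L : ℝ} {a : ℝ → ℝ} {H : ℝ → ℝ → ℝ} {α β : ℝ} {u : ℝ → ℝ}
    (h : IsEdgeSub L a H (Ioo α β) u) (hu : UpperSemicontinuous u) (c x₀ p k : ℝ)
    (h1 : u α ≤ c + p * (α - x₀) + k * (α - x₀) ^ 2)
    (h2 : u β ≤ c + p * (β - x₀) + k * (β - x₀) ^ 2)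
    (h3 : ∀ t ∈ Ioo α β, c + p * (t - x₀) + k * (t - x₀) ^ 2 < u t →
      0 < L * u t - a t * (2 * k) + H t (p + 2 * k * (t - x₀))) :
    ∀ t ∈ Icc α β, u t ≤ c + p * (t - x₀) + k * (t - x₀) ^ 2 := by
  by_contra! hcon
  obtain ⟨t₁, ht₁, hlt⟩ := hcon
  have husc : UpperSemicontinuous fun y => u y + -(c + p * (y - x₀) + k * (y - x₀) ^ 2) :=
    hu.add (Continuous.upperSemicontinuous (by fun_prop))
  obtain ⟨t, ht, hmax⟩ := (husc.upperSemicontinuousOn (Icc α β)).exists_forall_le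
    isCompact_Icc ⟨t₁, ht₁⟩
  have hpos := hmax _ ht₁
  have hα : t ≠ α := by rintro rfl; linarith
  have hβ : t ≠ β := by rintro rfl; linarith
  have htI : t ∈ Ioo α β := ⟨lt_of_le_of_ne ht.1 hα.symm, lt_of_le_of_ne ht.2 hβ⟩
  have hj : HasUpperJet u t (p + 2 * k * (t - x₀)) (2 * k) := by
    refine hasUpperJet_of_isLocalMax (c := c) ?_
    filter_upwards [Icc_mem_nhds htI.1 htI.2] with y hy
    have := hmax y hy
    linarith
  have := h t htI _ _ hj
  have := h3 t htI (by linarith)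
  linarith

/-- Concave quadratics with steep slopes are strict supersolutions, up to the constant `m`. -/
def HasBarrierWith (a : ℝ → ℝ) (H : ℝ → ℝ → ℝ) (s : Set ℝ) (m k C₁ : ℝ) : Prop :=
  0 < k ∧ 1 ≤ C₁ ∧ ∀ C ≥ C₁, ∀ t ∈ s, ∀ q, C / 2 ≤ |q| → |q| ≤ C → m < a t * (2 * k * C) + H t q

theorem HasBarrierWith.mono {a : ℝ → ℝ} {H : ℝ → ℝ → ℝ} {s s' : Set ℝ} {m k C₁ : ℝ}
    (h : HasBarrierWith a H s m k C₁) (hs : s' ⊆ s) : HasBarrierWith a H s' m k C₁ :=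
  ⟨h.1, h.2.1, fun C hC t ht => h.2.2 C hC t (hs ht)⟩

/-- For large slopes the Hamiltonian alone exceeds `m`; the curvature term only has to be
nonnegative, so `k = 1` is an arbitrary choice. -/
theorem hasBarrierWith_of_coercive {a : ℝ → ℝ} {H : ℝ → ℝ → ℝ} {s : Set ℝ} (m : ℝ) {C : ℝ}
    (hC : 0 < C) (ha : ∀ t ∈ s, 0 ≤ a t) (hH : ∀ t ∈ s, ∀ p, C⁻¹ * |p| - C ≤ H t p) :
    ∃ k C₁, HasBarrierWith a H s m k C₁ := by
  refine ⟨1, max 1 (2 * C * (C + m) + 1), one_pos, le_max_left _ _, fun D hD t ht q h1 _ => ?_⟩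
  have hD1 : 1 ≤ D := le_trans (le_max_left _ _) hD
  have hD2 : 2 * C * (C + m) + 1 ≤ D := le_trans (le_max_right _ _) hD
  have h2 := hH t ht q
  have h3 : 0 ≤ a t * (2 * 1 * D) := mul_nonneg (ha t ht) (by linarith)
  have h4 : C + m < C⁻¹ * |q| := by
    rw [inv_mul_eq_div, lt_div_iff₀ hC]; nlinarith
  linarith

/-- The Hamiltonian may be negative, but at most linearly in the slope. Taking the curvature
proportional to the slope scale `C` lets the diffusion dominate it at every scale. -/
theorem hasBarrierWith_of_elliptic {a : ℝ → ℝ} {H : ℝ → ℝ → ℝ} {s : Set ℝ} (m : ℝ) {α B : ℝ}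
    (hα : 0 < α) (hB : 0 ≤ B) (ha : ∀ t ∈ s, α ≤ a t)
    (hH : ∀ t ∈ s, ∀ p, -(B * (1 + |p|)) ≤ H t p) :
    ∃ k C₁, HasBarrierWith a H s m k C₁ := by
  have hk : 0 < (|m| + 1 + 2 * B) / (2 * α) := by positivity
  refine ⟨(|m| + 1 + 2 * B) / (2 * α), 1, hk, le_rfl, fun D hD t ht q _ h1 => ?_⟩
  have h2 := hH t ht q
  have h3 : α * (2 * ((|m| + 1 + 2 * B) / (2 * α)) * D) ≤
      a t * (2 * ((|m| + 1 + 2 * B) / (2 * α)) * D) :=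
    mul_le_mul_of_nonneg_right (ha t ht) (by positivity)
  have h4 : α * (2 * ((|m| + 1 + 2 * B) / (2 * α)) * D) = (|m| + 1 + 2 * B) * D := by
    field_simp
  have h5 : B * (1 + |q|) ≤ B * (2 * D) := mul_le_mul_of_nonneg_left (by linarith) hB
  nlinarith [le_abs_self m, abs_nonneg m]

section Barrier

variable {L M : ℝ} {a : ℝ → ℝ} {H : ℝ → ℝ → ℝ} {α β k C₁ C : ℝ} {u : ℝ → ℝ}

/-- The choice `m = L * M` in the barrier absorbs the zero order term, since `|u| ≤ M`. -/
theorem IsEdgeSub.le_barrier (hL : 0 ≤ L)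
    (h : IsEdgeSub L a H (Ioo α β) u) (hu : UpperSemicontinuous u) (hM : ∀ t, |u t| ≤ M)
    (hb : HasBarrierWith a H (Ioo α β) (L * M) k C₁) (hC : C₁ ≤ C) (x₀ p : ℝ)
    (h1 : u α ≤ u x₀ + p * (α - x₀) - k * C * (α - x₀) ^ 2)
    (h2 : u β ≤ u x₀ + p * (β - x₀) - k * C * (β - x₀) ^ 2)
    (h3 : ∀ t ∈ Ioo α β, C / 2 ≤ |p - 2 * k * C * (t - x₀)| ∧ |p - 2 * k * C * (t - x₀)| ≤ C) :
    ∀ t ∈ Icc α β, u t ≤ u x₀ + p * (t - x₀) - k * C * (t - x₀) ^ 2 := by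
  intro t ht
  have := h.le_quadratic hu (u x₀) x₀ p (-(k * C)) (by linarith) (by linarith)
    (fun t ht _ => by
      have e : p + 2 * -(k * C) * (t - x₀) = p - 2 * k * C * (t - x₀) := by ring
      rw [e]
      have h4 := hb.2.2 C hC t ht _ (h3 t ht).1 (h3 t ht).2
      have h5 : L * (-M) ≤ L * u t :=
        mul_le_mul_of_nonneg_left (abs_le.1 (hM t)).1 hL
      nlinarith) t ht
  linarith

/-- The condition `4 * k * (β - α) ≤ 1` does two things: along the parabola the slope stays between
`C / 2` and `C` in modulus, and the quadratic term costs at most a quarter of `C * (β - α)` at the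
far end. Hence the factor `3 / 4`. -/
theorem IsEdgeSub.le_left (hL : 0 ≤ L)
    (h : IsEdgeSub L a H (Ioo α β) u) (hu : UpperSemicontinuous u) (hM : ∀ t, |u t| ≤ M)
    (hb : HasBarrierWith a H (Ioo α β) (L * M) k C₁) (hC : C₁ ≤ C) (hαβ : α ≤ β)
    (hr : 4 * k * (β - α) ≤ 1) (h1 : u α ≤ u β + 3 / 4 * C * (β - α)) :
    ∀ t ∈ Icc α β, u t ≤ u β + C * (β - t) := by
  intro t ht
  have hk := hb.1
  have hC0 : 1 ≤ C := hb.2.1.trans hC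
  have h2 : k * C * (α - β) ^ 2 ≤ 1 / 4 * C * (β - α) := by
    have : k * C * (α - β) ^ 2 = (4 * k * (β - α)) * (C * (β - α)) / 4 := by ring
    have h0 : 0 ≤ C * (β - α) := mul_nonneg (by linarith) (by linarith)
    nlinarith
  have := h.le_barrier hL hu hM hb hC β (-C) (by nlinarith) (by simp) (fun s hs => by
    have h4 : 0 ≤ 2 * k * C * (β - s) := by
      have := hs.2; exact mul_nonneg (by positivity) (by linarith)
    have h5 : 2 * k * C * (β - s) ≤ C / 2 := by
      have h6 : C * (4 * k * (β - s)) ≤ C * 1 :=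
        mul_le_mul_of_nonneg_left (by have := hs.1; nlinarith) (by linarith)
      linarith
    have e : -C - 2 * k * C * (s - β) = -(C - 2 * k * C * (β - s)) := by ring
    rw [e, abs_neg, abs_of_nonneg (by linarith)]
    constructor <;> linarith) t ht
  have : 0 ≤ k * C * (t - β) ^ 2 := by positivity
  linarith

theorem IsEdgeSub.le_right (hL : 0 ≤ L)
    (h : IsEdgeSub L a H (Ioo α β) u) (hu : UpperSemicontinuous u) (hM : ∀ t, |u t| ≤ M)
    (hb : HasBarrierWith a H (Ioo α β) (L * M) k C₁) (hC : C₁ ≤ C) (hαβ : α ≤ β)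
    (hr : 4 * k * (β - α) ≤ 1) (h1 : u β ≤ u α + 3 / 4 * C * (β - α)) :
    ∀ t ∈ Icc α β, u t ≤ u α + C * (t - α) := by
  intro t ht
  have hk := hb.1
  have hC0 : 1 ≤ C := hb.2.1.trans hC
  have h2 : k * C * (β - α) ^ 2 ≤ 1 / 4 * C * (β - α) := by
    have : k * C * (α - β) ^ 2 = (4 * k * (β - α)) * (C * (β - α)) / 4 := by ring
    have h0 : 0 ≤ C * (β - α) := mul_nonneg (by linarith) (by linarith)
    nlinarith
  have := h.le_barrier hL hu hM hb hC α C (by simp) (by nlinarith) (fun s hs => by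
    have h4 : 0 ≤ 2 * k * C * (s - α) := by
      have := hs.1; exact mul_nonneg (by positivity) (by linarith)
    have h5 : 2 * k * C * (s - α) ≤ C / 2 := by
      have h6 : C * (4 * k * (s - α)) ≤ C * 1 :=
        mul_le_mul_of_nonneg_left (by have := hs.2; nlinarith) (by linarith)
      linarith
    rw [abs_of_nonneg (by linarith)]
    constructor <;> linarith) t ht
  have : 0 ≤ k * C * (t - α) ^ 2 := by positivity
  linarith

/-- The parabola starts with slope `-C / 2` and steepens to at most `-C`. A large average drop over
the interval is thereby turned into a linear drop starting right at `α`; applied at a vertex, this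
provides a test slope there. -/
theorem IsEdgeSub.le_right_neg (hL : 0 ≤ L)
    (h : IsEdgeSub L a H (Ioo α β) u) (hu : UpperSemicontinuous u) (hM : ∀ t, |u t| ≤ M)
    (hb : HasBarrierWith a H (Ioo α β) (L * M) k C₁) (hC : C₁ ≤ C) (hαβ : α ≤ β)
    (hr : 4 * k * (β - α) ≤ 1) (h1 : u β ≤ u α - 3 / 4 * C * (β - α)) :
    ∀ t ∈ Icc α β, u t ≤ u α - C / 2 * (t - α) := by
  intro t ht
  have hk := hb.1
  have hC0 : 1 ≤ C := hb.2.1.trans hC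
  have h2 : k * C * (β - α) ^ 2 ≤ 1 / 4 * C * (β - α) := by
    have : k * C * (α - β) ^ 2 = (4 * k * (β - α)) * (C * (β - α)) / 4 := by ring
    have h0 : 0 ≤ C * (β - α) := mul_nonneg (by linarith) (by linarith)
    nlinarith
  have := h.le_barrier hL hu hM hb hC α (-(C / 2)) (by simp) (by nlinarith) (fun s hs => by
    have h4 : 0 ≤ 2 * k * C * (s - α) := by
      have := hs.1; exact mul_nonneg (by positivity) (by linarith)
    have h5 : 2 * k * C * (s - α) ≤ C / 2 := by
      have h6 : C * (4 * k * (s - α)) ≤ C * 1 :=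
        mul_le_mul_of_nonneg_left (by have := hs.2; nlinarith) (by linarith)
      linarith
    have e : -(C / 2) - 2 * k * C * (s - α) = -(C / 2 + 2 * k * C * (s - α)) := by ring
    rw [e, abs_neg, abs_of_nonneg (by linarith)]
    constructor <;> linarith) t ht
  have : 0 ≤ k * C * (t - α) ^ 2 := by positivity
  linarith

/-- Upper Lipschitz bound at the left end of an interval. -/
theorem IsEdgeSub.le_right_of_bounded (hL : 0 ≤ L)
    (h : IsEdgeSub L a H (Ioo α β) u) (hu : UpperSemicontinuous u) (hM : ∀ t, |u t| ≤ M)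
    (hb : HasBarrierWith a H (Ioo α β) (L * M) k C₁) (hαβ : α < β) (hC : C₁ ≤ C)
    (hr : 4 * k * (β - α) ≤ 1) (hCM : 2 * M ≤ 3 / 4 * C * (β - α)) :
    ∀ t ∈ Icc α β, u t ≤ u α + C * (t - α) := by
  refine h.le_right hL hu hM hb hC hαβ.le hr ?_
  have := abs_le.1 (hM α); have := abs_le.1 (hM β); linarith

/-- Upper Lipschitz bound at the right end of an interval. -/
theorem IsEdgeSub.le_left_of_bounded (hL : 0 ≤ L)
    (h : IsEdgeSub L a H (Ioo α β) u) (hu : UpperSemicontinuous u) (hM : ∀ t, |u t| ≤ M)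
    (hb : HasBarrierWith a H (Ioo α β) (L * M) k C₁) (hαβ : α < β) (hC : C₁ ≤ C)
    (hr : 4 * k * (β - α) ≤ 1) (hCM : 2 * M ≤ 3 / 4 * C * (β - α)) :
    ∀ t ∈ Icc α β, u t ≤ u β + C * (β - t) := by
  refine h.le_left hL hu hM hb hC hαβ.le hr ?_
  have := abs_le.1 (hM α); have := abs_le.1 (hM β); linarith

end Barrier

end

/-! ### One-sided slopes at an end point -/

noncomputable section

section Endpoint

variable {L M A δ : ℝ} {a : ℝ → ℝ} {H : ℝ → ℝ → ℝ} {u : ℝ → ℝ}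

theorem frequently_nhdsGT_zero_iff {p : ℝ → Prop} :
    (∃ᶠ x in 𝓝[>] (0 : ℝ), p x) ↔ ∀ δ > 0, ∃ x ∈ Ioo 0 δ, p x := by
  rw [(nhdsGT_basis (0 : ℝ)).frequently_iff]

theorem eventually_nhdsGT_zero_iff {p : ℝ → Prop} :
    (∀ᶠ x in 𝓝[>] (0 : ℝ), p x) ↔ ∃ δ > 0, ∀ x ∈ Ioo 0 δ, p x := by
  rw [(nhdsGT_basis (0 : ℝ)).eventually_iff]

/-- The exact Taylor remainder of `θ / s` at `z` is `θ (s - z)² / (z² s)`, and `s > z / 2` bounds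
it. -/
theorem div_le_quadratic {θ z s : ℝ} (hθ : 0 ≤ θ) (hz : 0 < z) (hs : z / 2 < s) :
    θ / s ≤ θ / z - θ / z ^ 2 * (s - z) + 4 * θ / z ^ 3 / 2 * (s - z) ^ 2 := by
  have hs0 : 0 < s := by linarith
  have h2 : θ / s = θ / z - θ / z ^ 2 * (s - z) + θ * (s - z) ^ 2 / (z ^ 2 * s) := by
    field_simp; ring
  have h3 : θ * (s - z) ^ 2 / (z ^ 2 * s) ≤ 4 * θ / z ^ 3 / 2 * (s - z) ^ 2 := by
    rw [div_le_iff₀ (by positivity)]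
    have : 4 * θ / z ^ 3 / 2 * (s - z) ^ 2 * (z ^ 2 * s) = θ * (s - z) ^ 2 * (2 * s / z) := by
      field_simp; ring
    rw [this]
    have h5 : 1 ≤ 2 * s / z := by rw [le_div_iff₀ hz]; linarith
    exact le_mul_of_one_le_right (by positivity) h5
  linarith

/-- Lower Lipschitz bound at an end point where the equation degenerates and is coercive. -/
theorem IsEdgeSub.exists_lower_bound_of_degenerate (hL : 0 ≤ L) (hδ : 0 < δ)
    (h : IsEdgeSub L a H (Ioo 0 δ) u) (hu : UpperSemicontinuous u) (hM : ∀ t, |u t| ≤ M)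
    (ha : ∀ t ∈ Ioo 0 δ, a t ≤ A * t ^ 2) (hA : 0 ≤ A) {c : ℝ} (hc : 0 < c)
    (hH : ∀ t ∈ Ioo 0 δ, ∀ p, c⁻¹ * |p| - c ≤ H t p)
    (hlim : ∀ ε > 0, ∃ᶠ x in 𝓝[>] (0 : ℝ), u 0 - ε < u x) :
    ∃ C, ∀ᶠ x in 𝓝[>] (0 : ℝ), u 0 - C * x ≤ u x := by
  have hM0 : 0 ≤ M := (abs_nonneg _).trans (hM 0)
  obtain ⟨C, hCdef⟩ : ∃ b, b = c * (c + L * M) + 1 := ⟨_, rfl⟩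
  have hC0 : 0 < C := by rw [hCdef]; positivity
  obtain ⟨ρ, hρ, hρδ, hρA⟩ : ∃ ρ > 0, ρ ≤ δ ∧ 4 * A * ρ ≤ c⁻¹ := by
    refine ⟨min δ (c⁻¹ / (4 * A + 1)), by positivity, min_le_left _ _, ?_⟩
    have h1 : min δ (c⁻¹ / (4 * A + 1)) ≤ c⁻¹ / (4 * A + 1) := min_le_right _ _
    rw [le_div_iff₀ (by positivity)] at h1
    have : 0 < min δ (c⁻¹ / (4 * A + 1)) := by positivity
    nlinarith
  refine ⟨C, eventually_nhdsGT_zero_iff.2 ⟨ρ, hρ, fun x hx => ?_⟩⟩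
  by_contra! hlt
  obtain ⟨g, hg⟩ : ∃ b, b = u 0 - C * x - u x := ⟨_, rfl⟩
  have hg0 : 0 < g := by linarith
  obtain ⟨y, hy, hyu⟩ := frequently_nhdsGT_zero_iff.1 (hlim (g / 2) (by linarith)) x hx.1
  -- The test function is `-C z + θ / z` up to a constant. Its singularity keeps the maximum point
  -- away from 0, while `θ / y = g / 4` is small enough for `y` to beat the end point `x`.
  obtain ⟨θ, hθ⟩ : ∃ b, b = y * g / 4 := ⟨_, rfl⟩
  have hθ0 : 0 < θ := by have := hy.1; rw [hθ]; positivity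
  have hθy : θ / y = g / 4 := by rw [hθ]; have := hy.1.ne'; field_simp
  obtain ⟨D, hD⟩ : ∃ b, b = M + C * x - u 0 + g + 1 := ⟨_, rfl⟩
  have hD0 : 0 < D := by
    have := (abs_le.1 (hM 0)).2
    have : 0 < C * x := mul_pos hC0 hx.1
    linarith
  -- `D` is so large that `θ / y' ≥ D` prevents a maximum at `y'`.
  obtain ⟨y', hy'⟩ : ∃ b, b = min (y / 2) (θ / D) := ⟨_, rfl⟩
  have hy'0 : 0 < y' := by rw [hy']; exact lt_min (half_pos hy.1) (div_pos hθ0 hD0)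
  have hy'y : y' < y := (hy'.le.trans (min_le_left _ _)).trans_lt (by linarith [hy.1])
  have hy'D : D ≤ θ / y' := by
    rw [le_div_iff₀ hy'0]
    have : y' ≤ θ / D := hy'.le.trans (min_le_right _ _)
    rw [le_div_iff₀ hD0] at this
    linarith
  have husc : UpperSemicontinuousOn (fun z => u z + (C * z - θ / z)) (Icc y' x) := by
    refine (hu.upperSemicontinuousOn _).add (ContinuousOn.upperSemicontinuousOn ?_)
    refine ContinuousOn.sub (by fun_prop) (continuousOn_const.div continuousOn_id ?_)
    intro z hz
    exact (hy'0.trans_le hz.1).ne'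
  obtain ⟨z, hz, hmax⟩ := husc.exists_forall_le isCompact_Icc ⟨y, hy'y.le, hy.2.le⟩
  have hzy : u y + (C * y - θ / y) ≤ u z + (C * z - θ / z) := hmax _ ⟨hy'y.le, hy.2.le⟩
  have hbig : u 0 - 3 * g / 4 < u z + (C * z - θ / z) := by
    have : 0 < C * y := mul_pos hC0 hy.1
    rw [hθy] at hzy; linarith
  have hz1 : z ≠ y' := by
    intro e
    have h1 : u z ≤ M := (abs_le.1 (hM z)).2
    have h2 : C * z ≤ C * x := mul_le_mul_of_nonneg_left hz.2 hC0.le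
    rw [e] at h1 h2 hbig
    linarith
  have hz2 : z ≠ x := by
    intro e
    rw [e] at hbig
    have : 0 < θ / x := div_pos hθ0 hx.1
    linarith
  have hz0 : 0 < z := hy'0.trans_le hz.1
  have hzx : z < x := lt_of_le_of_ne hz.2 hz2
  have hj : HasUpperJet u z (-C - θ / z ^ 2) (4 * θ / z ^ 3) := by
    have hn : Ioo (max y' (z / 2)) x ∈ 𝓝 z :=
      Ioo_mem_nhds (max_lt (lt_of_le_of_ne hz.1 hz1.symm) (by linarith)) hzx
    filter_upwards [hn] with s hs
    have hs1 : y' < s := (le_max_left _ _).trans_lt hs.1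
    have hs2 : z / 2 < s := (le_max_right _ _).trans_lt hs.1
    have hs0 : 0 < s := by linarith
    have h1 : u s + (C * s - θ / s) ≤ u z + (C * z - θ / z) := hmax _ ⟨hs1.le, hs.2.le⟩
    have h2 := div_le_quadratic hθ0.le hz0 hs2
    linarith
  have hzδ : z ∈ Ioo 0 δ := ⟨hz0, by linarith [hx.2]⟩
  have h1 := h z hzδ _ _ hj
  have h2 := hH z hzδ (-C - θ / z ^ 2)
  have h3 : |(-C - θ / z ^ 2)| = C + θ / z ^ 2 := by
    rw [show -C - θ / z ^ 2 = -(C + θ / z ^ 2) by ring, abs_neg, abs_of_pos (by positivity)]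
  rw [h3] at h2
  -- Quadratic vanishing of the diffusion makes the second order term of size `θ / z`; on `(0, ρ)`
  -- it is absorbed by the part `c⁻¹ θ / z²` of the coercive bound.
  have h4 : a z * (4 * θ / z ^ 3) ≤ c⁻¹ * (θ / z ^ 2) := by
    calc a z * (4 * θ / z ^ 3) ≤ A * z ^ 2 * (4 * θ / z ^ 3) :=
          mul_le_mul_of_nonneg_right (ha z hzδ) (by positivity)
      _ = 4 * A * z * (θ / z ^ 2) := by field_simp
      _ ≤ c⁻¹ * (θ / z ^ 2) := by
          refine mul_le_mul_of_nonneg_right ?_ (by positivity)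
          have : 4 * A * z ≤ 4 * A * ρ :=
            mul_le_mul_of_nonneg_left (by linarith [hx.2]) (by positivity)
          linarith
  have h5 : c⁻¹ * C = c + L * M + c⁻¹ := by rw [hCdef]; field_simp
  have h6 : L * (-M) ≤ L * u z := mul_le_mul_of_nonneg_left (abs_le.1 (hM z)).1 hL
  have h7 : 0 < c⁻¹ := by positivity
  rw [mul_add, h5] at h2
  linarith

/-- A function whose slope oscillates around `q` at `0` can be touched from above by quadratics
with slope close to `q` and arbitrary second derivative. -/
theorem exists_hasUpperJet_of_oscillation (hu : UpperSemicontinuous u) {q ε : ℝ} (k : ℝ)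
    (hε : 0 < ε) (hp : ∃ᶠ x in 𝓝[>] (0 : ℝ), u 0 + (q + ε) * x ≤ u x)
    (hm : ∃ᶠ x in 𝓝[>] (0 : ℝ), u x ≤ u 0 + (q - ε) * x) (hδ : 0 < δ) :
    ∃ t ∈ Ioo 0 δ, HasUpperJet u t (q + 2 * k * t) (2 * k) ∧ u 0 + q * t + k * t ^ 2 ≤ u t := by
  rw [frequently_nhdsGT_zero_iff] at hp hm
  have hr : 0 < min δ (ε / (|k| + 1)) := by positivity
  -- Three points `y₀ < z < y₁` are chosen from right to left, with `u` below the quadratic at the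
  -- outer ones and above it at `z`. The maximum of the difference on `[y₀, y₁]` is then interior.
  obtain ⟨y₁, hy₁, hu₁⟩ := hm _ hr
  obtain ⟨z, hz, huz⟩ := hp y₁ hy₁.1
  obtain ⟨y₀, hy₀, hu₀⟩ := hm z hz.1
  have hk : ∀ x ∈ Ioc 0 y₁, |k * x| < ε := fun x hx => by
    have h1 : x < ε / (|k| + 1) := hx.2.trans_lt (hy₁.2.trans_le (min_le_right _ _))
    rw [lt_div_iff₀ (by positivity)] at h1
    rw [abs_mul, abs_of_pos hx.1]
    nlinarith [hx.1]
  have husc : UpperSemicontinuous fun y => u y + -(u 0 + q * (y - 0) + k * (y - 0) ^ 2) :=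
    hu.add (Continuous.upperSemicontinuous (by fun_prop))
  obtain ⟨t, ht, hmax⟩ := (husc.upperSemicontinuousOn (Icc y₀ y₁)).exists_forall_le
    isCompact_Icc ⟨z, hy₀.2.le, hz.2.le⟩
  have hzt : u z + -(u 0 + q * (z - 0) + k * (z - 0) ^ 2) ≤
      u t + -(u 0 + q * (t - 0) + k * (t - 0) ^ 2) := hmax _ ⟨hy₀.2.le, hz.2.le⟩
  have hpos : 0 < u z + -(u 0 + q * (z - 0) + k * (z - 0) ^ 2) := by
    have := (abs_lt.1 (hk z ⟨hz.1, hz.2.le⟩)).2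
    nlinarith [hz.1]
  have hend : ∀ x ∈ Ioc 0 y₁, u x ≤ u 0 + (q - ε) * x → x ≠ t := by
    rintro x hx hx' rfl
    have := (abs_lt.1 (hk x hx)).1
    nlinarith [hx.1]
  have h0 : y₀ ≠ t := hend y₀ ⟨hy₀.1, (hy₀.2.trans hz.2).le⟩ hu₀
  have h1 : y₁ ≠ t := hend y₁ ⟨hy₁.1, le_rfl⟩ hu₁
  have ht1 : y₀ < t := lt_of_le_of_ne ht.1 h0
  have ht2 : t < y₁ := lt_of_le_of_ne ht.2 h1.symm
  refine ⟨t, ⟨hy₀.1.trans ht1, ht2.trans (hy₁.2.trans_le (min_le_left _ _))⟩, ?_, by linarith⟩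
  have := hasUpperJet_of_isLocalMax (u := u) (t := t) (c := u 0) (x₀ := 0) (p := q) (k := k) (by
    filter_upwards [Icc_mem_nhds ht1 ht2] with y hy
    have := hmax y hy
    linarith)
  simpa using this

/-- At an end point where the diffusion vanishes quadratically, any number between the lower and the
upper slope of `u` is the slope of a limit of upper jets with negligible second order term. -/
theorem exists_hasUpperJet_of_slope (hδ : 0 < δ) (hu : UpperSemicontinuous u)
    (ha : ∀ t ∈ Ioo 0 δ, 0 ≤ a t ∧ a t ≤ A * t ^ 2) {p : ℝ}
    (hp : ∀ ε > 0, ∃ᶠ x in 𝓝[>] (0 : ℝ), u 0 + (p - ε) * x ≤ u x)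
    (hm : ∀ ε > 0, ∃ᶠ x in 𝓝[>] (0 : ℝ), u x ≤ u 0 + (p + ε) * x) {ε : ℝ} (hε : 0 < ε) :
    ∃ t ∈ Ioo 0 δ, t < ε ∧ ∃ q X, |q - p| ≤ ε ∧ HasUpperJet u t q X ∧ a t * X ≤ ε ∧
      u 0 - ε ≤ u t := by
  set η := ε / 14 with hη
  have hη0 : 0 < η := by positivity
  have key : ∀ q, |q - p| ≤ 2 * η → (∃ᶠ x in 𝓝[>] (0 : ℝ), u 0 + (q + η / 2) * x ≤ u x) →
      (∃ᶠ x in 𝓝[>] (0 : ℝ), u x ≤ u 0 + (q - η / 2) * x) →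
      ∃ t ∈ Ioo 0 δ, t < ε ∧ ∃ q X, |q - p| ≤ ε ∧ HasUpperJet u t q X ∧ a t * X ≤ ε ∧
        u 0 - ε ≤ u t := by
    intro q hq h1 h2
    obtain ⟨t, ht, hj, hle⟩ := exists_hasUpperJet_of_oscillation hu 0 (by positivity) h1 h2
      (δ := min (min δ ε) (ε / (|q| + 1))) (by positivity)
    have ht1 : t < min δ ε := ht.2.trans_le (min_le_left _ _)
    have ht2 : t < ε / (|q| + 1) := ht.2.trans_le (min_le_right _ _)
    rw [lt_div_iff₀ (by positivity)] at ht2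
    refine ⟨t, ⟨ht.1, ht1.trans_le (min_le_left _ _)⟩, ht1.trans_le (min_le_right _ _), q, 0,
      by linarith, by simpa using hj, by simpa using hε.le, ?_⟩
    have := neg_abs_le (q * t)
    rw [abs_mul, abs_of_pos ht.1] at this
    have ht0 := ht.1
    nlinarith
  -- If `u` leaves the cone of slopes `p ± 2 η` arbitrarily close to 0, it oscillates around a
  -- nearby slope and affine functions touch it. Otherwise it stays in the cone near 0 and a convex
  -- parabola centred at `r` is used.
  by_cases c1 : ∃ᶠ x in 𝓝[>] (0 : ℝ), u x ≤ u 0 + (p - 2 * η) * x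
  · refine key (p - 3 / 2 * η) ?_ ?_ ?_
    · rw [abs_le]; constructor <;> linarith
    · exact (hp η hη0).mono fun x hx => by convert hx using 3; ring
    · exact c1.mono fun x hx => by convert hx using 3; ring
  by_cases c2 : ∃ᶠ x in 𝓝[>] (0 : ℝ), u 0 + (p + 2 * η) * x ≤ u x
  · refine key (p + 3 / 2 * η) ?_ ?_ ?_
    · rw [abs_le]; constructor <;> linarith
    · exact c2.mono fun x hx => by convert hx using 3; ring
    · exact (hm η hη0).mono fun x hx => by convert hx using 3; ring
  rw [not_frequently, eventually_nhdsGT_zero_iff] at c1 c2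
  obtain ⟨r₁, hr₁, c1⟩ := c1
  obtain ⟨r₂, hr₂, c2⟩ := c2
  simp only [not_le] at c1 c2
  have hA : 0 ≤ A := by
    have := ha (δ / 2) ⟨by linarith, by linarith⟩
    by_contra! hA
    have h3 : A * (δ / 2) ^ 2 < 0 := mul_neg_of_neg_of_pos hA (by positivity)
    linarith
  obtain ⟨r, hr, hrδ, hr1, hr2, hrε, hrp, hrA⟩ : ∃ r > 0, 2 * r < δ ∧ 2 * r < r₁ ∧ 2 * r < r₂ ∧
      2 * r < ε ∧ r * (2 * |p| + 2 * η) ≤ ε ∧ 56 * A * η * r ≤ ε := by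
    have e : ∀ᶠ r in 𝓝[>] (0 : ℝ), 0 < r ∧ 2 * r < δ ∧ 2 * r < r₁ ∧ 2 * r < r₂ ∧
      2 * r < ε ∧ r * (2 * |p| + 2 * η) < ε ∧ 56 * A * η * r < ε := by
      have lin : ∀ b c : ℝ, 0 < c → ∀ᶠ r in 𝓝[>] (0 : ℝ), b * r < c := fun b c hc => by
        have : Tendsto (fun r : ℝ => b * r) (𝓝[>] 0) (𝓝 (b * 0)) :=
          ((continuous_const.mul continuous_id).tendsto 0).mono_left nhdsWithin_le_nhds
        rw [mul_zero] at this
        exact this.eventually_lt_const hc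
      filter_upwards [self_mem_nhdsWithin, lin 2 δ hδ, lin 2 r₁ hr₁, lin 2 r₂ hr₂, lin 2 ε hε,
        lin (2 * |p| + 2 * η) ε hε, lin (56 * A * η) ε hε] with r h0 h1 h2 h3 h4 h5 h6
      exact ⟨h0, h1, h2, h3, h4, by linarith, h6⟩
    obtain ⟨r, h0, h1, h2, h3, h4, h5, h6⟩ := e.exists
    exact ⟨r, h0, h1, h2, h3, h4, h5.le, h6.le⟩
  -- At 0 and `2 r` the parabola costs `k r² = 7 η r`, more than the gain of at most `6 η r` over
  -- the value at `r` allowed by the cone. The slope moves by at most `2 k r = 14 η = ε`, whence `η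
  -- = ε / 14`.
  set k := 7 * η / r with hk
  have hk0 : 0 < k := by positivity
  have hkr : k * r = 7 * η := by rw [hk]; field_simp
  have husc : UpperSemicontinuous fun y => u y + -((-p * -r) + p * (y - r) + k * (y - r) ^ 2) :=
    hu.add (Continuous.upperSemicontinuous (by fun_prop))
  obtain ⟨t, ht, hmax⟩ := (husc.upperSemicontinuousOn (Icc 0 (2 * r))).exists_forall_le
    isCompact_Icc ⟨r, hr.le, by linarith⟩
  have hrt : u r + -((-p * -r) + p * (r - r) + k * (r - r) ^ 2) ≤
      u t + -((-p * -r) + p * (t - r) + k * (t - r) ^ 2) := hmax _ ⟨hr.le, by linarith⟩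
  have hur := c1 r ⟨hr, by linarith⟩
  have hu2r := c2 (2 * r) ⟨by linarith, by linarith⟩
  have hηr : 0 < η * r := by positivity
  have ht0 : t ≠ 0 := by
    intro e
    rw [e] at hrt
    have : k * (0 - r) ^ 2 = 7 * η * r := by rw [← hkr]; ring
    rw [this] at hrt
    nlinarith
  have ht2 : t ≠ 2 * r := by
    intro e
    rw [e] at hrt
    have : k * (2 * r - r) ^ 2 = 7 * η * r := by rw [← hkr]; ring
    rw [this] at hrt
    nlinarith
  have ht0' : 0 < t := lt_of_le_of_ne ht.1 ht0.symm
  have ht2' : t < 2 * r := lt_of_le_of_ne ht.2 ht2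
  have htδ : t ∈ Ioo 0 δ := ⟨ht0', by linarith⟩
  refine ⟨t, htδ, by linarith, p + 2 * k * (t - r), 2 * k, ?_, ?_, ?_, ?_⟩
  · rw [add_sub_cancel_left, abs_mul, abs_of_pos (by positivity : 0 < 2 * k)]
    have : |t - r| ≤ r := abs_le.2 ⟨by linarith, by linarith⟩
    nlinarith
  · refine hasUpperJet_of_isLocalMax (c := -p * -r) ?_
    filter_upwards [Icc_mem_nhds ht0' ht2'] with y hy
    have := hmax y hy
    linarith
  · calc a t * (2 * k) ≤ A * t ^ 2 * (2 * k) :=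
          mul_le_mul_of_nonneg_right (ha t htδ).2 (by positivity)
      _ ≤ A * (2 * r) ^ 2 * (2 * k) := by gcongr
      _ = 8 * A * r * (k * r) := by ring
      _ = 56 * A * η * r := by rw [hkr]; ring
      _ ≤ ε := hrA
  · have h1 : 0 ≤ k * (t - r) ^ 2 := by positivity
    have h2 := neg_abs_le (p * t)
    rw [abs_mul, abs_of_pos ht0'] at h2
    have h3 : |p| * t ≤ |p| * (2 * r) := mul_le_mul_of_nonneg_left ht2'.le (abs_nonneg _)
    nlinarith

/-- A passage to the limit along the jets of `exists_hasUpperJet_of_slope`: their second order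
contribution vanishes, so the first order equation holds at the end point itself. -/
theorem IsEdgeSub.le_of_slope (hδ : 0 < δ) (hL : 0 ≤ L) (h : IsEdgeSub L a H (Ioo 0 δ) u)
    (hu : UpperSemicontinuous u) (hH : Continuous fun z : ℝ × ℝ => H z.1 z.2)
    (ha : ∀ t ∈ Ioo 0 δ, 0 ≤ a t ∧ a t ≤ A * t ^ 2) {p : ℝ}
    (hp : ∀ ε > 0, ∃ᶠ x in 𝓝[>] (0 : ℝ), u 0 + (p - ε) * x ≤ u x)
    (hm : ∀ ε > 0, ∃ᶠ x in 𝓝[>] (0 : ℝ), u x ≤ u 0 + (p + ε) * x) :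
    L * u 0 + H 0 p ≤ 0 := by
  by_contra! hpos
  have hc : Continuous fun z : ℝ × ℝ × ℝ => L * (u 0 - z.1) - z.1 + H z.2.1 z.2.2 := by
    have := hH.comp (continuous_snd (X := ℝ) (Y := ℝ × ℝ))
    fun_prop
  have h1 : ∀ᶠ z in 𝓝 ((0, 0, p) : ℝ × ℝ × ℝ), 0 < L * (u 0 - z.1) - z.1 + H z.2.1 z.2.2 :=
    (hc.tendsto _).eventually_const_lt (by simpa using hpos)
  obtain ⟨ε, hε, hball⟩ := Metric.eventually_nhds_iff.1 h1
  obtain ⟨t, ht, htε, q, X, hq, hj, haX, hut⟩ :=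
    exists_hasUpperJet_of_slope hδ hu ha hp hm (half_pos hε)
  have h2 := @hball (ε / 2, t, q) (by
    simp only [Prod.dist_eq, Real.dist_eq, sub_zero]
    refine max_lt ?_ (max_lt ?_ (by linarith))
    · rw [abs_of_pos (half_pos hε)]; linarith
    · rw [abs_of_pos ht.1]; linarith)
  have h3 := h t ht q X hj
  simp only at h2
  have : L * (u 0 - ε / 2) ≤ L * u t := mul_le_mul_of_nonneg_left hut hL
  linarith

/-- Where the diffusion is positive, a subsolution which is Lipschitz at an end point has a
derivative there: the lower slope is not less than the upper slope. -/
theorem IsEdgeSub.not_oscillation (hδ : 0 < δ) (hL : 0 ≤ L) (h : IsEdgeSub L a H (Ioo 0 δ) u)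
    (hu : UpperSemicontinuous u) (hH : Continuous fun z : ℝ × ℝ => H z.1 z.2) (ha : Continuous a)
    (ha0 : 0 < a 0) {q ε : ℝ} (hε : 0 < ε)
    (hp : ∃ᶠ x in 𝓝[>] (0 : ℝ), u 0 + (q + ε) * x ≤ u x)
    (hm : ∃ᶠ x in 𝓝[>] (0 : ℝ), u x ≤ u 0 + (q - ε) * x) : False := by
  -- Positive diffusion lets a very negative `k` violate the equation, while oscillation allows
  -- touching with any `k`.
  obtain ⟨k, hk⟩ : ∃ k, 0 < L * u 0 - a 0 * (2 * k) + H 0 q := by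
    refine ⟨-(|L * u 0 + H 0 q| + 1) / (2 * a 0), ?_⟩
    have : a 0 * (2 * (-(|L * u 0 + H 0 q| + 1) / (2 * a 0))) = -(|L * u 0 + H 0 q| + 1) := by
      field_simp
    rw [this]
    linarith [neg_abs_le (L * u 0 + H 0 q)]
  have hc : Continuous fun t : ℝ => L * (u 0 + q * t + k * t ^ 2) - a t * (2 * k) +
      H t (q + 2 * k * t) := by
    have : Continuous fun t : ℝ => H t (q + 2 * k * t) :=
      hH.comp (by fun_prop : Continuous fun t : ℝ => (t, q + 2 * k * t))
    fun_prop
  have h1 : ∀ᶠ t in 𝓝 (0 : ℝ), 0 < L * (u 0 + q * t + k * t ^ 2) - a t * (2 * k) +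
      H t (q + 2 * k * t) := (hc.tendsto _).eventually_const_lt (by simpa using hk)
  obtain ⟨r, hr, hball⟩ := Metric.eventually_nhds_iff.1 h1
  obtain ⟨t, ht, hj, hle⟩ := exists_hasUpperJet_of_oscillation hu k hε hp hm
    (δ := min r δ) (by positivity)
  have h2 := @hball t (by
    rw [Real.dist_eq, sub_zero, abs_of_pos ht.1]; exact ht.2.trans_le (min_le_left _ _))
  have h3 := h t ⟨ht.1, ht.2.trans_le (min_le_right _ _)⟩ _ _ hj
  have := mul_le_mul_of_nonneg_left hle hL
  linarith

/-- Upper slope of a function which is Lipschitz at `0`. -/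
theorem exists_upper_slope {C : ℝ} (hC : ∀ᶠ x in 𝓝[>] (0 : ℝ), |u x - u 0| ≤ C * x) :
    ∃ p, (∀ ε > 0, ∃ᶠ x in 𝓝[>] (0 : ℝ), u 0 + (p - ε) * x ≤ u x) ∧
      ∀ ε > 0, ∀ᶠ x in 𝓝[>] (0 : ℝ), u x ≤ u 0 + (p + ε) * x := by
  set S := {s | ∀ᶠ x in 𝓝[>] (0 : ℝ), u x ≤ u 0 + s * x} with hS
  have hne : S.Nonempty := ⟨C, by
    filter_upwards [hC] with x hx
    linarith [(abs_le.1 hx).2]⟩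
  have hbdd : BddBelow S := ⟨-C, fun s hs => by
    by_contra! hlt
    have hs : ∀ᶠ x in 𝓝[>] (0 : ℝ), u x ≤ u 0 + s * x := hs
    obtain ⟨x, hx1, hx2, hx0⟩ := (hC.and (hs.and self_mem_nhdsWithin)).exists
    have hx0 : 0 < x := hx0
    have := (abs_le.1 hx1).1
    nlinarith⟩
  refine ⟨sInf S, fun ε hε => ?_, fun ε hε => ?_⟩
  · have : sInf S - ε ∉ S := fun hmem => by linarith [csInf_le hbdd hmem]
    have : ¬ ∀ᶠ x in 𝓝[>] (0 : ℝ), u x ≤ u 0 + (sInf S - ε) * x := this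
    exact (not_eventually.1 this).mono fun x hx => (not_le.1 hx).le
  · obtain ⟨s, hs, hlt⟩ := exists_lt_of_csInf_lt hne (lt_add_of_pos_right (sInf S) hε)
    have hs : ∀ᶠ x in 𝓝[>] (0 : ℝ), u x ≤ u 0 + s * x := hs
    filter_upwards [hs, self_mem_nhdsWithin] with x hx hx0
    have hx0 : 0 < x := hx0
    nlinarith

end Endpoint

end

/-! ### Separating the slopes of a subsolution and a supersolution -/

noncomputable section

/-- At an end point, there are slopes separating a subsolution `u` from a supersolution `w` lying
above it which, together with suitable second derivatives, are strict for both equations. -/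
theorem exists_separating_slopes {L δ η C : ℝ} {a : ℝ → ℝ} {H : ℝ → ℝ → ℝ} {u w : ℝ → ℝ}
    (hδ : 0 < δ) (hL : 0 < L) (hη : 0 < η)
    (hu : IsEdgeSub L a H (Ioo 0 δ) u) (huc : UpperSemicontinuous u)
    (hw : IsEdgeSub L a (dualHam H) (Ioo 0 δ) fun x => -w x)
    (hwc : UpperSemicontinuous fun x => -w x)
    (hH : Continuous fun z : ℝ × ℝ => H z.1 z.2) (ha : Continuous a)
    (hlt : w 0 < u 0) (hcomp : ∀ᶠ x in 𝓝[>] (0 : ℝ), u x - u 0 + η * x ≤ w x - w 0)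
    (hC : ∀ᶠ x in 𝓝[>] (0 : ℝ), |u x - u 0| ≤ C * x)
    (hdeg : (a 0 = 0 ∧ (∃ A, ∀ t ∈ Ioo 0 δ, 0 ≤ a t ∧ a t ≤ A * t ^ 2) ∧
      ∃ Q, ∀ q ≥ Q, 0 < L * u 0 + H 0 q) ∨ 0 < a 0) :
    ∃ p s₁ s₂ q k₁ k₂, p < s₁ ∧ s₁ < s₂ ∧ s₂ < q ∧
      (∀ᶠ x in 𝓝[>] (0 : ℝ), u x ≤ u 0 + p * x) ∧
      (∀ᶠ x in 𝓝[>] (0 : ℝ), w 0 + q * x ≤ w x) ∧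
      0 < L * u 0 - a 0 * k₁ + H 0 s₁ ∧ L * w 0 - a 0 * k₂ + H 0 s₂ < 0 := by
  obtain ⟨p, hp1, hp2⟩ := exists_upper_slope hC
  rcases hdeg with ⟨ha0, ⟨A, hA⟩, Q, hQ⟩ | ha0
  · have hHd : Continuous fun z : ℝ × ℝ => dualHam H z.1 z.2 := by
      unfold dualHam
      exact (hH.comp (by fun_prop : Continuous fun z : ℝ × ℝ => (z.1, -z.2))).neg
    have hgp : L * u 0 + H 0 p ≤ 0 := hu.le_of_slope hδ hL.le huc hH hA hp1
      fun ε hε => (hp2 ε hε).frequently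
    have hwslope : ∀ r, (∀ ε > 0, ∃ᶠ x in 𝓝[>] (0 : ℝ), w x ≤ w 0 + (r + ε) * x) →
        (∀ ε > 0, ∃ᶠ x in 𝓝[>] (0 : ℝ), w 0 + (r - ε) * x ≤ w x) → 0 ≤ L * w 0 + H 0 r := by
      intro r h1 h2
      have := hw.le_of_slope hδ hL.le hwc hHd hA (p := -r)
        (fun ε hε => (h1 ε hε).mono fun x hx => by linarith)
        (fun ε hε => (h2 ε hε).mono fun x hx => by linarith)
      simp only [dualHam, neg_neg] at this
      linarith
    have hLuw : 0 < L * (u 0 - w 0) := mul_pos hL (by linarith)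
    -- Otherwise `p` would also be a slope of `w`, so that `0 ≤ L * w 0 + H 0 p`, which contradicts
    -- `hgp` because `w 0 < u 0`.
    obtain ⟨ε₀, hε₀, hT⟩ : ∃ ε > 0, ∀ᶠ x in 𝓝[>] (0 : ℝ), w 0 + (p + ε) * x ≤ w x := by
      by_contra! hcon
      have := hwslope p (fun ε hε => (hcon ε hε).mono fun x hx => (hx.le))
        (fun ε hε => (((hp1 ε hε).and_eventually hcomp).and_eventually self_mem_nhdsWithin).mono
          fun x hx => by
            have h1 := hx.1.1; have h2 := hx.1.2; have h3 : 0 < x := hx.2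
            nlinarith)
      linarith
    -- The lower slope of `w` may be infinite; the cap at `max Q (p + ε₀)` keeps the supremum
    -- finite.
    set T := {s | p ≤ s ∧ s ≤ max Q (p + ε₀) ∧ ∀ᶠ x in 𝓝[>] (0 : ℝ), w 0 + s * x ≤ w x} with hTdef
    have hmem : p + ε₀ ∈ T := ⟨by linarith, le_max_right _ _, hT⟩
    have hbdd : BddAbove T := ⟨max Q (p + ε₀), fun s hs => hs.2.1⟩
    set r := sSup T with hr
    have hpr : p < r := (lt_add_of_pos_right p hε₀).trans_le (le_csSup hbdd hmem)
    have hbelow : ∀ s < r, ∀ᶠ x in 𝓝[>] (0 : ℝ), w 0 + s * x ≤ w x := by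
      intro s hs
      obtain ⟨s', hs', hlt'⟩ := exists_lt_of_lt_csSup ⟨_, hmem⟩ hs
      filter_upwards [hs'.2.2, self_mem_nhdsWithin] with x hx hx0
      have hx0 : 0 < x := hx0
      nlinarith
    -- If `r` reaches the cap, coercivity gives the sign. Otherwise `r` is a genuine slope of `w`,
    -- and the supersolution inequality at `r` is improved by `w 0 < u 0`.
    have hgr : 0 < L * u 0 + H 0 r := by
      by_cases hrQ : r = max Q (p + ε₀)
      · exact hQ r (hrQ ▸ le_max_left _ _)
      · have hrlt : r < max Q (p + ε₀) :=
          lt_of_le_of_ne (csSup_le ⟨_, hmem⟩ fun s hs => hs.2.1) hrQ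
        have := hwslope r (fun ε hε => by
            have hnot : ¬ ∀ᶠ x in 𝓝[>] (0 : ℝ),
                w 0 + min (r + ε) (max Q (p + ε₀)) * x ≤ w x := by
              intro hev
              have : min (r + ε) (max Q (p + ε₀)) ∈ T :=
                ⟨le_min (by linarith) (by linarith), min_le_right _ _, hev⟩
              have h2 := le_csSup hbdd this
              have h3 : r < min (r + ε) (max Q (p + ε₀)) := lt_min (by linarith) hrlt
              linarith
            refine ((not_eventually.1 hnot).and_eventually self_mem_nhdsWithin).mono fun x hx => ?_
            have h1 := not_le.1 hx.1
            have h3 : 0 < x := hx.2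
            have h2 : min (r + ε) (max Q (p + ε₀)) * x ≤ (r + ε) * x :=
              mul_le_mul_of_nonneg_right (min_le_left _ _) h3.le
            linarith)
          (fun ε hε => (hbelow (r - ε) (by linarith)).frequently)
        linarith
    -- A level strictly between 0 and `L * (u 0 - w 0)`: where `L * u 0 + H 0 s` equals `m`,
    -- replacing `u 0` by `w 0` makes the expression negative. The intermediate value theorem
    -- reaches this level in `(p, r)`.
    set m := min (L * (u 0 - w 0)) (L * u 0 + H 0 r) / 2 with hm
    have hmpos : 0 < min (L * (u 0 - w 0)) (L * u 0 + H 0 r) := lt_min hLuw hgr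
    have hm1 : m < L * (u 0 - w 0) :=
      (half_lt_self hmpos).trans_le (min_le_left _ _)
    have hm2 : m < L * u 0 + H 0 r :=
      (half_lt_self hmpos).trans_le (min_le_right _ _)
    have hm0 : 0 < m := half_pos hmpos
    have hH0 : Continuous fun s => H 0 s :=
      hH.comp (by fun_prop : Continuous fun s : ℝ => ((0 : ℝ), s))
    have hgc : Continuous fun s => L * u 0 + H 0 s := continuous_const.add hH0
    obtain ⟨s, hs, hsm⟩ := intermediate_value_Icc hpr.le hgc.continuousOn
      (⟨by linarith, hm2.le⟩ : m ∈ Icc (L * u 0 + H 0 p) (L * u 0 + H 0 r))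
    have hsm : L * u 0 + H 0 s = m := hsm
    have hsp : p < s := lt_of_le_of_ne hs.1 (by rintro rfl; linarith)
    have hsr : s < r := lt_of_le_of_ne hs.2 (by rintro rfl; linarith)
    have hfc : Continuous fun s => L * w 0 + H 0 s := continuous_const.add hH0
    have hfs : ∀ᶠ s' in 𝓝 s, L * w 0 + H 0 s' < 0 :=
      (hfc.tendsto s).eventually_lt_const (by linarith)
    obtain ⟨e, he, hball⟩ := Metric.eventually_nhds_iff.1 hfs
    set s₂ := s + min (e / 2) ((r - s) / 2) with hs₂
    have hmin : 0 < min (e / 2) ((r - s) / 2) := lt_min (by linarith) (by linarith)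
    have hmin1 : min (e / 2) ((r - s) / 2) ≤ e / 2 := min_le_left _ _
    have hmin2 : min (e / 2) ((r - s) / 2) ≤ (r - s) / 2 := min_le_right _ _
    refine ⟨(p + s) / 2, s, s₂, (s₂ + r) / 2, 0, 0, by linarith, by linarith, by linarith, ?_,
      hbelow _ (by linarith), by linarith, ?_⟩
    · have := hp2 ((s - p) / 2) (by linarith)
      rwa [show p + (s - p) / 2 = (p + s) / 2 by ring] at this
    · have := @hball s₂ (by
        rw [Real.dist_eq, hs₂, add_sub_cancel_left, abs_of_pos hmin]; linarith)
      linarith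
  -- With positive diffusion the second derivatives can be chosen to make both expressions strict,
  -- so only the order of the slopes matters. Absence of oscillation bounds the lower slope of `u`,
  -- and the gap `η` in `hcomp` then puts `w` above slope `p + η / 2`.
  · have hlow : ∀ᶠ x in 𝓝[>] (0 : ℝ), u 0 + (p - η / 2) * x ≤ u x := by
      by_contra hcon
      refine hu.not_oscillation hδ hL.le huc hH ha ha0 (q := p - 3 / 8 * η) (ε := η / 8)
        (by linarith) ?_ ?_
      · exact (hp1 (η / 4) (by linarith)).mono fun x hx => by
          rwa [show p - 3 / 8 * η + η / 8 = p - η / 4 by ring]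
      · refine (not_eventually.1 hcon).mono fun x hx => ?_
        rw [show p - 3 / 8 * η - η / 8 = p - η / 2 by ring]
        exact (not_le.1 hx).le
    refine ⟨p + η / 8, p + η / 4, p + 3 / 8 * η, p + η / 2,
      -(|L * u 0 + H 0 (p + η / 4)| + 1) / a 0, (|L * w 0 + H 0 (p + 3 / 8 * η)| + 1) / a 0,
      by linarith, by linarith, by linarith, hp2 _ (by linarith), ?_, ?_, ?_⟩
    · filter_upwards [hlow, hcomp] with x h1 h2
      linarith
    · rw [mul_div_cancel₀ _ ha0.ne']
      linarith [neg_abs_le (L * u 0 + H 0 (p + η / 4))]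
    · rw [mul_div_cancel₀ _ ha0.ne']
      linarith [le_abs_self (L * w 0 + H 0 (p + 3 / 8 * η))]

end

/-! ### Sup-convolutions and their second order expansions -/

noncomputable section

/-- If the increments of `h` are bounded by `c |s - s'| + C |s - s'|²` on an interval, then `h` is
`c`-Lipschitz there. -/
theorem abs_sub_le_of_quadratic_error {h : ℝ → ℝ} {α β c C : ℝ}
    (hh : ∀ s ∈ Icc α β, ∀ s' ∈ Icc α β, |h s' - h s| ≤ c * |s' - s| + C * |s' - s| ^ 2) :
    ∀ s ∈ Icc α β, ∀ s' ∈ Icc α β, |h s' - h s| ≤ c * |s' - s| := by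
  have key : ∀ n : ℕ, ∀ s ∈ Icc α β, ∀ s' ∈ Icc α β,
      |h s' - h s| ≤ c * |s' - s| + C * |s' - s| ^ 2 * (1 / 2) ^ n := by
    intro n
    -- Splitting the increment at the midpoint preserves the linear term and halves the quadratic
    -- error.
    induction n with
    | zero => simpa using hh
    | succ n ih =>
      intro s hs s' hs'
      have hm : (s + s') / 2 ∈ Icc α β := ⟨by linarith [hs.1, hs'.1], by linarith [hs.2, hs'.2]⟩
      have h1 := ih s hs _ hm
      have h2 := ih _ hm s' hs'
      have e1 : |(s + s') / 2 - s| = |s' - s| / 2 := by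
        rw [show (s + s') / 2 - s = (s' - s) / 2 by ring, abs_div, abs_two]
      have e2 : |s' - (s + s') / 2| = |s' - s| / 2 := by
        rw [show s' - (s + s') / 2 = (s' - s) / 2 by ring, abs_div, abs_two]
      rw [e1] at h1
      rw [e2] at h2
      have h3 := abs_sub_le (h s') (h ((s + s') / 2)) (h s)
      calc |h s' - h s| ≤ _ := h3
        _ ≤ _ := add_le_add h2 h1
        _ = _ := by rw [pow_succ]; ring
  intro s hs s' hs'
  have ht : Tendsto (fun n : ℕ => c * |s' - s| + C * |s' - s| ^ 2 * (1 / 2 : ℝ) ^ n) atTop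
      (𝓝 (c * |s' - s| + C * |s' - s| ^ 2 * 0)) :=
    ((tendsto_pow_atTop_nhds_zero_of_lt_one (by norm_num) (by norm_num)).const_mul _).const_add _
  rw [mul_zero, add_zero] at ht
  exact ge_of_tendsto' ht fun n => key n s hs s' hs'

/-- `g` has a second order Taylor expansion at `x`, with coefficients `p` and `X`. -/
def HasSecondOrder (g : ℝ → ℝ) (x p X : ℝ) : Prop :=
  ∀ ε > 0, ∀ᶠ y in 𝓝 x, |g y - g x - p * (y - x) - X / 2 * (y - x) ^ 2| ≤ ε * (y - x) ^ 2

/-- A convex function has a second order expansion at each point where a selection of its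
subdifferential is differentiable. -/
theorem hasSecondOrder_of_subgradient {G n : ℝ → ℝ} (hG : ∀ x y, G x + n x * (y - x) ≤ G y)
    {x X : ℝ} (hn : HasDerivAt n X x) : HasSecondOrder G x (n x) X := by
  intro ε hε
  have h1 := hn.isLittleO.def hε
  obtain ⟨r, hr, hball⟩ := Metric.eventually_nhds_iff.1 h1
  refine Metric.eventually_nhds_iff.2 ⟨r, hr, fun y hy => ?_⟩
  set h : ℝ → ℝ := fun s => G s - G x - n x * (s - x) - X / 2 * (s - x) ^ 2 with hh
  set d := |y - x| with hd
  have hn' : ∀ s ∈ Icc (x - d) (x + d), |n s - n x - X * (s - x)| ≤ ε * d := by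
    intro s hs
    have hsd : |s - x| ≤ d := abs_le.2 ⟨by linarith [hs.1], by linarith [hs.2]⟩
    have := @hball s (by rw [Real.dist_eq]; exact hsd.trans_lt (by rwa [Real.dist_eq] at hy))
    simp only [smul_eq_mul, Real.norm_eq_abs] at this
    rw [mul_comm X]
    exact this.trans (mul_le_mul_of_nonneg_left hsd hε.le)
  -- The subgradient at `s'` bounds the increment of the remainder from above, with an extra
  -- quadratic error; exchanging `s` and `s'` gives the lower bound, and
  -- `abs_sub_le_of_quadratic_error` removes the error.
  have hone : ∀ s ∈ Icc (x - d) (x + d), ∀ s' ∈ Icc (x - d) (x + d),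
      h s' - h s ≤ ε * d * |s' - s| + |X| / 2 * |s' - s| ^ 2 := by
    intro s hs s' hs'
    have e1 : h s' - h s ≤ (n s' - n x - X * (s' - x)) * (s' - s) + X / 2 * (s' - s) ^ 2 := by
      have := hG s' s
      simp only [hh]
      nlinarith
    have e2 : (n s' - n x - X * (s' - x)) * (s' - s) ≤ ε * d * |s' - s| := by
      refine (le_abs_self _).trans ?_
      rw [abs_mul]
      exact mul_le_mul_of_nonneg_right (hn' s' hs') (abs_nonneg _)
    have e3 : X / 2 * (s' - s) ^ 2 ≤ |X| / 2 * |s' - s| ^ 2 := by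
      rw [sq_abs]
      exact mul_le_mul_of_nonneg_right (by linarith [le_abs_self X]) (sq_nonneg _)
    linarith
  have hd0 : 0 ≤ d := abs_nonneg _
  have := abs_sub_le_of_quadratic_error (h := h) (α := x - d) (β := x + d) (c := ε * d)
    (C := |X| / 2) (fun s hs s' hs' => abs_le.2 ⟨by
      have := hone s' hs' s hs
      rw [abs_sub_comm s s'] at this
      linarith, hone s hs s' hs'⟩) x ⟨by linarith, by linarith⟩ y
      ⟨by linarith [neg_abs_le (y - x)], by linarith [le_abs_self (y - x)]⟩
  have e0 : h x = 0 := by simp [hh]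
  rw [e0, sub_zero, ← hd, mul_assoc, ← sq, hd, sq_abs] at this
  exact this

section SupConvolution

variable {A : ℝ → ℝ} {ℓ γ : ℝ} {m : ℝ → ℝ}

/-- `m x` is a maximum point of `ξ ↦ A ξ - (x - ξ)² / (2 γ)` on `[0, ℓ]`. -/
def IsArgmax (A : ℝ → ℝ) (ℓ γ : ℝ) (m : ℝ → ℝ) : Prop :=
  (∀ x, m x ∈ Icc 0 ℓ) ∧ ∀ x, ∀ ξ ∈ Icc 0 ℓ,
    A ξ - (x - ξ) ^ 2 / (2 * γ) ≤ A (m x) - (x - m x) ^ 2 / (2 * γ)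

/-- The sup-convolution, in terms of a selection of maximum points. -/
def supConv (A : ℝ → ℝ) (γ : ℝ) (m : ℝ → ℝ) (x : ℝ) : ℝ := A (m x) - (x - m x) ^ 2 / (2 * γ)

theorem exists_isArgmax (hA : UpperSemicontinuous A) (hℓ : 0 ≤ ℓ) : ∃ m, IsArgmax A ℓ γ m := by
  have : ∀ x, ∃ t ∈ Icc 0 ℓ, ∀ ξ ∈ Icc 0 ℓ,
      A ξ - (x - ξ) ^ 2 / (2 * γ) ≤ A t - (x - t) ^ 2 / (2 * γ) := by
    intro x
    have husc : UpperSemicontinuous fun ξ => A ξ + -((x - ξ) ^ 2 / (2 * γ)) :=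
      hA.add (Continuous.upperSemicontinuous (by fun_prop))
    obtain ⟨t, ht, hmax⟩ := (husc.upperSemicontinuousOn (Icc 0 ℓ)).exists_forall_le isCompact_Icc
      ⟨0, le_rfl, hℓ⟩
    exact ⟨t, ht, fun ξ hξ => by have := hmax ξ hξ; linarith⟩
  choose m hm using this
  exact ⟨m, fun x => (hm x).1, fun x => (hm x).2⟩

/-- After expansion of the square, `supConv A γ m x + x² / (2 γ)` is a supremum of affine functions
of `x` with slopes `ξ / γ`; the one that is active at `x` supports it there. -/
theorem IsArgmax.subgradient (hm : IsArgmax A ℓ γ m) (hγ : 0 < γ) (x y : ℝ) :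
    supConv A γ m x + x ^ 2 / (2 * γ) + m x / γ * (y - x) ≤
      supConv A γ m y + y ^ 2 / (2 * γ) := by
  have := hm.2 y (m x) (hm.1 x)
  have e : A (m x) - (y - m x) ^ 2 / (2 * γ) =
      supConv A γ m x + x ^ 2 / (2 * γ) + m x / γ * (y - x) - y ^ 2 / (2 * γ) := by
    unfold supConv; field_simp; ring
  unfold supConv at *
  linarith

theorem IsArgmax.monotone (hm : IsArgmax A ℓ γ m) (hγ : 0 < γ) : Monotone m := by
  intro x y hxy
  rcases hxy.eq_or_lt with rfl | hlt
  · exact le_rfl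
  have h1 := hm.subgradient hγ x y
  have h2 := hm.subgradient hγ y x
  have h3 : 0 ≤ (m y - m x) * ((y - x) / γ) := by
    have : (m y - m x) * ((y - x) / γ) = -(m y / γ * (x - y)) - m x / γ * (y - x) := by ring
    rw [this]; linarith
  have := nonneg_of_mul_nonneg_left h3 (div_pos (sub_pos.2 hlt) hγ)
  linarith

/-- Alexandrov's theorem in dimension one: the subgradient selection `m / γ` is monotone, hence
differentiable almost everywhere. The term `1 / γ` undoes the convexifying parabola. -/
theorem IsArgmax.ae_hasSecondOrder (hm : IsArgmax A ℓ γ m) (hγ : 0 < γ) :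
    ∀ᵐ x : ℝ, ∃ X, HasSecondOrder (supConv A γ m) x ((m x - x) / γ) X := by
  filter_upwards [(hm.monotone hγ).ae_differentiableAt] with x hx
  have hd : HasDerivAt (fun x => m x / γ) (deriv m x / γ) x := hx.hasDerivAt.div_const γ
  have := hasSecondOrder_of_subgradient
    (G := fun x => supConv A γ m x + x ^ 2 / (2 * γ)) (fun x y => hm.subgradient hγ x y) hd
  refine ⟨deriv m x / γ - 1 / γ, fun ε hε => ?_⟩
  filter_upwards [this ε hε] with y hy
  convert hy using 2
  field_simp
  ring

/-- Moving `ξ` and the centre `x` by the same amount leaves the penalty unchanged, so the expansion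
of the sup-convolution at `x` bounds `A` from above at the maximum point `m x`. -/
theorem HasSecondOrder.hasUpperJet (hm : IsArgmax A ℓ γ m) {x p X ε : ℝ}
    (h : HasSecondOrder (supConv A γ m) x p X) (hx : m x ∈ Ioo 0 ℓ) (hε : 0 < ε) :
    HasUpperJet A (m x) p (X + 2 * ε) := by
  have ht : Tendsto (fun ξ => x + (ξ - m x)) (𝓝 (m x)) (𝓝 x) := by
    have : Continuous fun ξ => x + (ξ - m x) := by fun_prop
    simpa using this.tendsto (m x)
  filter_upwards [ht.eventually (h ε hε), Icc_mem_nhds hx.1 hx.2] with ξ h1 h2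
  have h3 := hm.2 (x + (ξ - m x)) ξ h2
  have h4 := (abs_le.1 h1).2
  have e1 : x + (ξ - m x) - x = ξ - m x := by ring
  have e2 : x + (ξ - m x) - ξ = x - m x := by ring
  rw [e1] at h4
  rw [e2] at h3
  unfold supConv at h4
  linarith

end SupConvolution

end

/-! ### Doubling of variables -/

noncomputable section

/-- The function of the doubling of variables combined with sup-convolution. -/
def doubled (A B : ℝ → ℝ) (γ : ℝ) (ξ ζ x y : ℝ) : ℝ :=
  A ξ + B ζ - ((x - ξ) ^ 2 + (y - ζ) ^ 2 + (x - y) ^ 2) / (2 * γ)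

theorem exists_forall_le_on_Icc {A : ℝ → ℝ} (hA : UpperSemicontinuous A) {ℓ : ℝ} (hℓ : 0 ≤ ℓ) :
    ∃ K, ∀ t ∈ Icc 0 ℓ, A t ≤ K := by
  obtain ⟨t, _, ht⟩ := (hA.upperSemicontinuousOn (Icc 0 ℓ)).exists_forall_le isCompact_Icc
    ⟨0, le_rfl, hℓ⟩
  exact ⟨A t, ht⟩

/-- Almost maximum points of the doubled function concentrate at the strict maximum of `A + B`. -/
theorem doubled_concentration {A B : ℝ → ℝ} {ℓ t₀ : ℝ} (hA : UpperSemicontinuous A)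
    (hB : UpperSemicontinuous B) (ht₀ : t₀ ∈ Icc 0 ℓ)
    (hmax : ∀ t ∈ Icc 0 ℓ, t ≠ t₀ → A t + B t < A t₀ + B t₀) {ν : ℝ} (hν : 0 < ν) :
    ∃ γ > 0, γ < ν ∧ ∀ ξ ∈ Icc 0 ℓ, ∀ ζ ∈ Icc 0 ℓ, ∀ x ∈ Icc 0 ℓ, ∀ y ∈ Icc 0 ℓ,
      A t₀ + B t₀ - 2 * ℓ * γ ≤ doubled A B γ ξ ζ x y →
      (|ξ - t₀| < ν ∧ |ζ - t₀| < ν ∧ |x - t₀| < ν ∧ |y - t₀| < ν) ∧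
      A t₀ + B t₀ - ν < A ξ + B ζ ∧
      ((x - ξ) ^ 2 + (y - ζ) ^ 2 + (x - y) ^ 2) / (2 * γ) < ν := by
  by_contra! hcon
  have hℓ : 0 ≤ ℓ := ht₀.1.trans ht₀.2
  set g : ℕ → ℝ := fun n => ν / (n + 2) with hg
  have hg0 : ∀ n, 0 < g n := fun n => by positivity
  have hgν : ∀ n, g n < ν := fun n => by
    rw [hg]; simp only
    rw [div_lt_iff₀ (by positivity)]
    have : (0 : ℝ) ≤ n := n.cast_nonneg
    nlinarith
  have hglim : Tendsto g atTop (𝓝 0) := by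
    have : Tendsto (fun n : ℕ => (n : ℝ) + 2) atTop atTop :=
      tendsto_atTop_add_const_right _ _ tendsto_natCast_atTop_atTop
    exact this.const_div_atTop ν
  choose ξ hξ ζ hζ x hx y hy hd hbad using fun n => hcon (g n) (hg0 n) (hgν n)
  obtain ⟨KA, hKA⟩ := exists_forall_le_on_Icc hA hℓ
  obtain ⟨KB, hKB⟩ := exists_forall_le_on_Icc hB hℓ
  have hcomp : IsCompact (Icc 0 ℓ ×ˢ Icc 0 ℓ ×ˢ Icc 0 ℓ ×ˢ Icc (0 : ℝ) ℓ) :=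
    isCompact_Icc.prod (isCompact_Icc.prod (isCompact_Icc.prod isCompact_Icc))
  obtain ⟨⟨ξ', ζ', x', y'⟩, hz', φ, hφ, hlim⟩ := hcomp.tendsto_subseq
    (x := fun n => (ξ n, ζ n, x n, y n)) fun n => ⟨hξ n, hζ n, hx n, hy n⟩
  have hξl : Tendsto (fun n => ξ (φ n)) atTop (𝓝 ξ') := (continuous_fst.tendsto _).comp hlim
  have hl2 := (continuous_snd.tendsto _).comp hlim
  have hζl : Tendsto (fun n => ζ (φ n)) atTop (𝓝 ζ') := (continuous_fst.tendsto _).comp hl2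
  have hl3 := (continuous_snd.tendsto _).comp hl2
  have hxl : Tendsto (fun n => x (φ n)) atTop (𝓝 x') := (continuous_fst.tendsto _).comp hl3
  have hyl : Tendsto (fun n => y (φ n)) atTop (𝓝 y') := (continuous_snd.tendsto _).comp hl3
  have hgl : Tendsto (fun n => g (φ n)) atTop (𝓝 0) := hglim.comp hφ.tendsto_atTop
  set m := A t₀ + B t₀ with hm
  set Q : ℕ → ℝ := fun n => (x n - ξ n) ^ 2 + (y n - ζ n) ^ 2 + (x n - y n) ^ 2 with hQ
  have hQg : ∀ n, Q n / (2 * g n) ≤ A (ξ n) + B (ζ n) - m + 2 * ℓ * g n := fun n => by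
    have := hd n
    unfold doubled at this
    simp only [hQ]
    linarith
  have hQle : ∀ n, Q n ≤ (KA + KB - m + 2 * ℓ * ν) * (2 * g n) := fun n => by
    rw [← div_le_iff₀ (by have := hg0 n; positivity)]
    have := hQg n
    have h1 := hKA _ (hξ n)
    have h2 := hKB _ (hζ n)
    have h3 : 2 * ℓ * g n ≤ 2 * ℓ * ν := mul_le_mul_of_nonneg_left (hgν n).le (by positivity)
    linarith
  have hQl : Tendsto (fun n => Q (φ n)) atTop
      (𝓝 ((x' - ξ') ^ 2 + (y' - ζ') ^ 2 + (x' - y') ^ 2)) :=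
    (((hxl.sub hξl).pow 2).add ((hyl.sub hζl).pow 2)).add ((hxl.sub hyl).pow 2)
  -- Boundedness from above of `A` and `B` makes the numerators of the penalties `O(γ)`, so the four
  -- limits coincide.
  have hQ0 : (x' - ξ') ^ 2 + (y' - ζ') ^ 2 + (x' - y') ^ 2 ≤ 0 := by
    have h1 : Tendsto (fun n => (KA + KB - m + 2 * ℓ * ν) * (2 * g (φ n))) atTop (𝓝 0) := by
      have := (hgl.const_mul 2).const_mul (KA + KB - m + 2 * ℓ * ν)
      simpa using this
    exact le_of_tendsto_of_tendsto' hQl h1 fun n => hQle _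
  have e1 : x' = ξ' := by nlinarith [sq_nonneg (x' - ξ'), sq_nonneg (y' - ζ'), sq_nonneg (x' - y')]
  have e2 : y' = ζ' := by nlinarith [sq_nonneg (x' - ξ'), sq_nonneg (y' - ζ'), sq_nonneg (x' - y')]
  have e3 : x' = y' := by nlinarith [sq_nonneg (x' - ξ'), sq_nonneg (y' - ζ'), sq_nonneg (x' - y')]
  have hup : ∀ e > 0, ∀ᶠ n in atTop, A (ξ (φ n)) + B (ζ (φ n)) < A ξ' + B ξ' + e := by
    intro e he
    have h1 := hξl.eventually (hA ξ' (A ξ' + e / 2) (by linarith))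
    have h2 := hζl.eventually (hB ζ' (B ζ' + e / 2) (by linarith))
    filter_upwards [h1, h2] with n h1 h2
    rw [← e2, ← e3, e1] at h2
    linarith
  have hsmall : ∀ e > 0, ∀ᶠ n in atTop, 2 * ℓ * g (φ n) < e := by
    intro e he
    have : Tendsto (fun n => 2 * ℓ * g (φ n)) atTop (𝓝 (2 * ℓ * 0)) := hgl.const_mul _
    rw [mul_zero] at this
    exact this.eventually_lt_const he
  have hQpos : ∀ n, 0 ≤ Q n / (2 * g n) := fun n => by
    have := hg0 n
    simp only [hQ]; positivity
  -- By semicontinuity the common limit almost maximizes `A + B` to any precision, and the maximum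
  -- is strict.
  have ht : ξ' = t₀ := by
    by_contra hne
    have h1 := hmax ξ' hz'.1 hne
    obtain ⟨n, h2, h3⟩ := ((hup ((m - (A ξ' + B ξ')) / 2) (by linarith)).and
      (hsmall ((m - (A ξ' + B ξ')) / 2) (by linarith))).exists
    have := hQg (φ n)
    have := hQpos (φ n)
    linarith
  have near : ∀ {s : ℕ → ℝ} {s' : ℝ}, Tendsto s atTop (𝓝 s') → s' = t₀ →
      ∀ᶠ n in atTop, |s n - t₀| < ν := by
    intro s s' hs hs'
    rw [hs'] at hs
    exact (Metric.tendsto_nhds.1 hs ν hν)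
  obtain ⟨n, h1, h2, h3, h4, h5, h6⟩ := ((near hξl ht).and ((near hζl (by rw [← e2, ← e3, e1, ht])).and
    ((near hxl (by rw [e1, ht])).and ((near hyl (by rw [← e3, e1, ht])).and
      ((hup (ν / 2) (by linarith)).and (hsmall (ν / 2) (by linarith))))))).exists
  have h7 := hQg (φ n)
  have h8 := hQpos (φ n)
  have h9 := hbad (φ n) ⟨h1, h2, h3, h4⟩ (by linarith)
  rw [ht] at h5
  simp only [hQ] at h7
  linarith

theorem exists_doubled_max {A B : ℝ → ℝ} {ℓ γ : ℝ} (hA : UpperSemicontinuous A)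
    (hB : UpperSemicontinuous B) (hℓ : 0 ≤ ℓ) (p q : ℝ) :
    ∃ ξ ∈ Icc 0 ℓ, ∃ ζ ∈ Icc 0 ℓ, ∃ x ∈ Icc 0 ℓ, ∃ y ∈ Icc 0 ℓ,
      ∀ ξ' ∈ Icc 0 ℓ, ∀ ζ' ∈ Icc 0 ℓ, ∀ x' ∈ Icc 0 ℓ, ∀ y' ∈ Icc 0 ℓ,
        doubled A B γ ξ' ζ' x' y' - p * x' - q * y' ≤ doubled A B γ ξ ζ x y - p * x - q * y := by
  have hcomp : IsCompact (Icc 0 ℓ ×ˢ Icc 0 ℓ ×ˢ Icc 0 ℓ ×ˢ Icc (0 : ℝ) ℓ) :=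
    isCompact_Icc.prod (isCompact_Icc.prod (isCompact_Icc.prod isCompact_Icc))
  have husc : UpperSemicontinuous fun z : ℝ × ℝ × ℝ × ℝ => A z.1 + B z.2.1 +
      (-(((z.2.2.1 - z.1) ^ 2 + (z.2.2.2 - z.2.1) ^ 2 + (z.2.2.1 - z.2.2.2) ^ 2) / (2 * γ))
        - p * z.2.2.1 - q * z.2.2.2) :=
    ((hA.comp continuous_fst).add (hB.comp (continuous_fst.comp continuous_snd))).add
      (Continuous.upperSemicontinuous (by fun_prop))
  have h0 : (0 : ℝ) ∈ Icc 0 ℓ := ⟨le_rfl, hℓ⟩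
  obtain ⟨⟨ξ, ζ, x, y⟩, hz, hmax⟩ := (husc.upperSemicontinuousOn _).exists_forall_le hcomp
    ⟨(0, 0, 0, 0), h0, h0, h0, h0⟩
  refine ⟨ξ, hz.1, ζ, hz.2.1, x, hz.2.2.1, y, hz.2.2.2, fun ξ' h1 ζ' h2 x' h3 y' h4 => ?_⟩
  have := hmax (ξ', ζ', x', y') ⟨h1, h2, h3, h4⟩
  simp only at this
  unfold doubled
  linarith

end

/-! ### Jensen's lemma and the theorem on sums -/

noncomputable section

section Jensen

variable {A B mA mB : ℝ → ℝ} {ℓ γ : ℝ}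

/-- `(x, y)` maximizes the doubled function perturbed by a linear function of slope `(p, q)`. -/
def IsDoubledMax (A B mA mB : ℝ → ℝ) (ℓ γ p q x y : ℝ) : Prop :=
  ∀ ξ ∈ Icc 0 ℓ, ∀ ζ ∈ Icc 0 ℓ, ∀ x' ∈ Icc 0 ℓ, ∀ y' ∈ Icc 0 ℓ,
    doubled A B γ ξ ζ x' y' - p * x' - q * y' ≤
      doubled A B γ (mA x) (mB y) x y - p * x - q * y

theorem exists_isDoubledMax (hA : UpperSemicontinuous A) (hB : UpperSemicontinuous B)
    (hmA : IsArgmax A ℓ γ mA) (hmB : IsArgmax B ℓ γ mB) (hℓ : 0 ≤ ℓ) (p q : ℝ) :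
    ∃ x ∈ Icc 0 ℓ, ∃ y ∈ Icc 0 ℓ, IsDoubledMax A B mA mB ℓ γ p q x y := by
  obtain ⟨ξ, hξ, ζ, hζ, x, hx, y, hy, h⟩ := exists_doubled_max (γ := γ) hA hB hℓ p q
  refine ⟨x, hx, y, hy, fun ξ' h1 ζ' h2 x' h3 y' h4 => (h ξ' h1 ζ' h2 x' h3 y' h4).trans ?_⟩
  have h5 := hmA.2 x ξ hξ
  have h6 := hmB.2 y ζ hζ
  have e : ∀ ξ ζ : ℝ, doubled A B γ ξ ζ x y = (A ξ - (x - ξ) ^ 2 / (2 * γ)) +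
      (B ζ - (y - ζ) ^ 2 / (2 * γ)) - (x - y) ^ 2 / (2 * γ) := fun ξ ζ => by
    unfold doubled; ring
  rw [e, e]
  linarith

theorem slope_eq_of_isMax {ξ y p x γ : ℝ} (hγ : 0 < γ)
    (h : ∀ᶠ x' in 𝓝 x, -((x' - ξ) ^ 2 + (x' - y) ^ 2) / (2 * γ) - p * x' ≤
      -((x - ξ) ^ 2 + (x - y) ^ 2) / (2 * γ) - p * x) :
    p = (ξ - x) / γ - (x - y) / γ := by
  have hd : HasDerivAt (fun x' => -((x' - ξ) ^ 2 + (x' - y) ^ 2) / (2 * γ) - p * x')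
      (-(2 * (x - ξ) + 2 * (x - y)) / (2 * γ) - p) x := by
    have h1 := ((hasDerivAt_id x).sub_const ξ).pow 2
    have h2 := ((hasDerivAt_id x).sub_const y).pow 2
    have := ((h1.add h2).neg.div_const (2 * γ)).sub ((hasDerivAt_id x).const_mul p)
    exact this.congr_deriv (by simp [id])
  have := IsLocalMax.hasDerivAt_eq_zero h hd
  have e : (ξ - x) / γ - (x - y) / γ = -(2 * (x - ξ) + 2 * (x - y)) / (2 * γ) := by
    field_simp; ring
  linarith

/-- The slope of the linear perturbation, in terms of the maximum point. -/
def perturbationSlope (mA mB : ℝ → ℝ) (γ : ℝ) (z : ℝ × ℝ) : ℝ × ℝ :=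
  ((mA z.1 - z.1) / γ - (z.1 - z.2) / γ, (mB z.2 - z.2) / γ - (z.2 - z.1) / γ)

theorem IsDoubledMax.slope_eq {p q x y : ℝ} (h : IsDoubledMax A B mA mB ℓ γ p q x y) (hγ : 0 < γ)
    (hmA : IsArgmax A ℓ γ mA) (hmB : IsArgmax B ℓ γ mB)
    (hx : x ∈ Ioo 0 ℓ) (hy : y ∈ Ioo 0 ℓ) : perturbationSlope mA mB γ (x, y) = (p, q) := by
  have e1 : p = (mA x - x) / γ - (x - y) / γ := by
    refine slope_eq_of_isMax hγ ?_
    filter_upwards [Icc_mem_nhds hx.1 hx.2] with x' hx'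
    have := h _ (hmA.1 x) _ (hmB.1 y) x' hx' y ⟨hy.1.le, hy.2.le⟩
    unfold doubled at this
    rw [← sub_nonneg] at this ⊢
    convert this using 1
    field_simp
    ring
  have e2 : q = (mB y - y) / γ - (y - x) / γ := by
    refine slope_eq_of_isMax hγ ?_
    filter_upwards [Icc_mem_nhds hy.1 hy.2] with y' hy'
    have := h _ (hmA.1 x) _ (hmB.1 y) x ⟨hx.1.le, hx.2.le⟩ y' hy'
    unfold doubled at this
    rw [← sub_nonneg] at this ⊢
    convert this using 1
    field_simp
    ring
  unfold perturbationSlope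
  rw [e1, e2]

/-- For fixed `ξ, ζ` the doubled function is exactly quadratic in `(x, y)`, and `slope_eq` gives its
gradient at `(x₁, y₁)`. Two maximality inequalities are added: the first maximum against the point
`(x₂, y₂)`, the second against `(x, y)` with the selections of the first. -/
theorem IsDoubledMax.cross_inequality {p₁ q₁ x₁ y₁ p₂ q₂ x₂ y₂ : ℝ}
    (h₁ : IsDoubledMax A B mA mB ℓ γ p₁ q₁ x₁ y₁) (h₂ : IsDoubledMax A B mA mB ℓ γ p₂ q₂ x₂ y₂)
    (hγ : 0 < γ) (hmA : IsArgmax A ℓ γ mA) (hmB : IsArgmax B ℓ γ mB)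
    (hx₁ : x₁ ∈ Ioo 0 ℓ) (hy₁ : y₁ ∈ Ioo 0 ℓ) (hx₂ : x₂ ∈ Icc 0 ℓ) (hy₂ : y₂ ∈ Icc 0 ℓ)
    {x y : ℝ} (hx : x ∈ Icc 0 ℓ) (hy : y ∈ Icc 0 ℓ) :
    -(((x - x₁) ^ 2 + (y - y₁) ^ 2 + ((x - x₁) - (y - y₁)) ^ 2) / (2 * γ)) ≤
      (p₂ - p₁) * (x - x₂) + (q₂ - q₁) * (y - y₂) := by
  have e := h₁.slope_eq hγ hmA hmB hx₁ hy₁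
  have a1 := h₁ _ (hmA.1 x₂) _ (hmB.1 y₂) x₂ hx₂ y₂ hy₂
  have a2 := h₂ _ (hmA.1 x₁) _ (hmB.1 y₁) x hx y hy
  simp only [perturbationSlope, Prod.mk.injEq] at e
  have e3 : doubled A B γ (mA x₁) (mB y₁) x y = doubled A B γ (mA x₁) (mB y₁) x₁ y₁ +
      p₁ * (x - x₁) + q₁ * (y - y₁) -
      ((x - x₁) ^ 2 + (y - y₁) ^ 2 + ((x - x₁) - (y - y₁)) ^ 2) / (2 * γ) := by
    rw [← e.1, ← e.2]
    unfold doubled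
    field_simp
    ring
  rw [e3] at a2
  linarith

/-- The cross inequality at the four points `x₂ ± D`, `y₂ ± D` isolates the components of the slope
difference. The increments are at most `2 D`, so the quadratic form is at most `24 D²`, which yields
`12 / γ`. Thus the slope map is Lipschitz on the set of maximum points without any regularity of the
sup-convolutions elsewhere. -/
theorem IsDoubledMax.dist_slope_le {p₁ q₁ x₁ y₁ p₂ q₂ x₂ y₂ D : ℝ}
    (h₁ : IsDoubledMax A B mA mB ℓ γ p₁ q₁ x₁ y₁) (h₂ : IsDoubledMax A B mA mB ℓ γ p₂ q₂ x₂ y₂)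
    (hγ : 0 < γ) (hmA : IsArgmax A ℓ γ mA) (hmB : IsArgmax B ℓ γ mB)
    (hx₁ : x₁ ∈ Ioo 0 ℓ) (hy₁ : y₁ ∈ Ioo 0 ℓ) (hx₂ : x₂ ∈ Icc 0 ℓ) (hy₂ : y₂ ∈ Icc 0 ℓ)
    (hD : 0 < D) (hDx : |x₂ - x₁| ≤ D) (hDy : |y₂ - y₁| ≤ D)
    (hx₃ : x₂ - D ∈ Icc 0 ℓ) (hx₄ : x₂ + D ∈ Icc 0 ℓ)
    (hy₃ : y₂ - D ∈ Icc 0 ℓ) (hy₄ : y₂ + D ∈ Icc 0 ℓ) :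
    |p₂ - p₁| ≤ 12 / γ * D ∧ |q₂ - q₁| ≤ 12 / γ * D := by
  have cross := fun (x y : ℝ) (hx : x ∈ Icc 0 ℓ) (hy : y ∈ Icc 0 ℓ) =>
    h₁.cross_inequality h₂ hγ hmA hmB hx₁ hy₁ hx₂ hy₂ hx hy
  have quad : ∀ h k : ℝ, |h| ≤ 2 * D → |k| ≤ 2 * D →
      (h ^ 2 + k ^ 2 + (h - k) ^ 2) / (2 * γ) ≤ 12 / γ * D * D := by
    intro h k hh hk
    rw [div_le_iff₀ (by positivity)]
    have : 12 / γ * D * D * (2 * γ) = 24 * D ^ 2 := by field_simp; ring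
    rw [this]
    have h1 : h ^ 2 ≤ (2 * D) ^ 2 := sq_le_sq' (abs_le.1 hh).1 (abs_le.1 hh).2
    have h2 : k ^ 2 ≤ (2 * D) ^ 2 := sq_le_sq' (abs_le.1 hk).1 (abs_le.1 hk).2
    nlinarith [sq_nonneg (h + k)]
  have hDx' := abs_le.1 hDx
  have hDy' := abs_le.1 hDy
  have bx : |x₂ - x₁| ≤ 2 * D := by linarith
  have bxp : |x₂ + D - x₁| ≤ 2 * D := abs_le.2 ⟨by linarith, by linarith⟩
  have bxm : |x₂ - D - x₁| ≤ 2 * D := abs_le.2 ⟨by linarith, by linarith⟩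
  have byy : |y₂ - y₁| ≤ 2 * D := by linarith
  have byp : |y₂ + D - y₁| ≤ 2 * D := abs_le.2 ⟨by linarith, by linarith⟩
  have bym : |y₂ - D - y₁| ≤ 2 * D := abs_le.2 ⟨by linarith, by linarith⟩
  have c1 := cross _ _ hx₃ hy₂
  have c2 := cross _ _ hx₄ hy₂
  have c3 := cross _ _ hx₂ hy₃
  have c4 := cross _ _ hx₂ hy₄
  have d1 := quad _ _ bxm byy
  have d2 := quad _ _ bxp byy
  have d3 := quad _ _ bx bym
  have d4 := quad _ _ bx byp
  refine ⟨abs_le.2 ⟨?_, ?_⟩, abs_le.2 ⟨?_, ?_⟩⟩ <;>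
    refine le_of_mul_le_mul_right ?_ hD <;> linarith

open MeasureTheory in
/-- One-dimensional version of Jensen's lemma: some linear perturbation has a maximum point where
both sup-convolutions are twice differentiable. -/
theorem exists_isDoubledMax_hasSecondOrder (hA : UpperSemicontinuous A)
    (hB : UpperSemicontinuous B) (hmA : IsArgmax A ℓ γ mA) (hmB : IsArgmax B ℓ γ mB) (hγ : 0 < γ)
    {t₀ ν ρ : ℝ} (hρ : 0 < ρ) (hν₁ : 3 * ν ≤ t₀) (hν₂ : t₀ + 3 * ν ≤ ℓ)
    (hloc : ∀ p q x y, |p| < ρ → |q| < ρ → x ∈ Icc 0 ℓ → y ∈ Icc 0 ℓ →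
      IsDoubledMax A B mA mB ℓ γ p q x y → |x - t₀| < ν ∧ |y - t₀| < ν) :
    ∃ p q x y X Y, |p| < ρ ∧ |q| < ρ ∧ x ∈ Icc 0 ℓ ∧ y ∈ Icc 0 ℓ ∧
      IsDoubledMax A B mA mB ℓ γ p q x y ∧
      HasSecondOrder (supConv A γ mA) x ((mA x - x) / γ) X ∧
      HasSecondOrder (supConv B γ mB) y ((mB y - y) / γ) Y := by
  by_contra! hcon
  set Z : Set (ℝ × ℝ) := {z | ∃ p q, |p| < ρ ∧ |q| < ρ ∧ z.1 ∈ Icc 0 ℓ ∧ z.2 ∈ Icc 0 ℓ ∧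
    IsDoubledMax A B mA mB ℓ γ p q z.1 z.2} with hZ
  have hℓ : 0 ≤ ℓ := (hmA.1 0).1.trans (hmA.1 0).2
  -- By contradiction, each maximum point lies in the null set where one of the two expansions
  -- fails.
  have hnull : volume Z = 0 := by
    have hA' : ∀ᵐ z : ℝ × ℝ, ∃ X, HasSecondOrder (supConv A γ mA) z.1 ((mA z.1 - z.1) / γ) X :=
      Measure.quasiMeasurePreserving_fst.ae (hmA.ae_hasSecondOrder hγ)
    have hB' : ∀ᵐ z : ℝ × ℝ, ∃ Y, HasSecondOrder (supConv B γ mB) z.2 ((mB z.2 - z.2) / γ) Y :=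
      Measure.quasiMeasurePreserving_snd.ae (hmB.ae_hasSecondOrder hγ)
    refine measure_mono_null (fun z hz => ?_) (ae_iff.1 (hA'.and hB'))
    rintro ⟨⟨X, hX⟩, Y, hY⟩
    obtain ⟨p, q, hp, hq, hx, hy, h⟩ := hz
    exact hcon p q z.1 z.2 X Y hp hq hx hy h hX hY
  have hlip : LipschitzOnWith ⟨12 / γ, by positivity⟩ (perturbationSlope mA mB γ) Z := by
    refine LipschitzOnWith.of_dist_le_mul fun z₁ hz₁ z₂ hz₂ => ?_
    rcases eq_or_ne z₁ z₂ with rfl | hne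
    · simp
    obtain ⟨p₁, q₁, hp₁, hq₁, hx₁, hy₁, h₁⟩ := hz₁
    obtain ⟨p₂, q₂, hp₂, hq₂, hx₂, hy₂, h₂⟩ := hz₂
    obtain ⟨l1, l2⟩ := hloc _ _ _ _ hp₁ hq₁ hx₁ hy₁ h₁
    obtain ⟨l3, l4⟩ := hloc _ _ _ _ hp₂ hq₂ hx₂ hy₂ h₂
    rw [abs_lt] at l1 l2 l3 l4
    have ix₁ : z₁.1 ∈ Ioo 0 ℓ := ⟨by linarith, by linarith⟩
    have iy₁ : z₁.2 ∈ Ioo 0 ℓ := ⟨by linarith, by linarith⟩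
    have ix₂ : z₂.1 ∈ Ioo 0 ℓ := ⟨by linarith, by linarith⟩
    have iy₂ : z₂.2 ∈ Ioo 0 ℓ := ⟨by linarith, by linarith⟩
    have e₁ := h₁.slope_eq hγ hmA hmB ix₁ iy₁
    have e₂ := h₂.slope_eq hγ hmA hmB ix₂ iy₂
    have hD : 0 < dist z₁ z₂ := dist_pos.2 hne
    have hDx : |z₂.1 - z₁.1| ≤ dist z₁ z₂ := by
      rw [abs_sub_comm, ← Real.dist_eq]; exact le_max_left _ _
    have hDy : |z₂.2 - z₁.2| ≤ dist z₁ z₂ := by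
      rw [abs_sub_comm, ← Real.dist_eq]; exact le_max_right _ _
    -- Maximum points are within `ν` of `t₀`; the margin `3 ν` leaves room for shifts by up to `2
    -- ν`.
    have hDν : dist z₁ z₂ ≤ 2 * ν := by
      refine max_le ?_ ?_ <;> rw [Real.dist_eq] <;> exact abs_le.2 ⟨by linarith, by linarith⟩
    have key := h₁.dist_slope_le h₂ hγ hmA hmB ix₁ iy₁ hx₂ hy₂ hD hDx hDy
      ⟨by linarith, by linarith⟩ ⟨by linarith, by linarith⟩ ⟨by linarith, by linarith⟩
      ⟨by linarith, by linarith⟩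
    rw [show z₁ = (z₁.1, z₁.2) from rfl, show z₂ = (z₂.1, z₂.2) from rfl, e₁, e₂]
    refine max_le ?_ ?_
    · rw [dist_comm, Real.dist_eq]; exact key.1
    · rw [dist_comm, Real.dist_eq]; exact key.2
  -- Two-dimensional Hausdorff measure is Lebesgue measure on `ℝ × ℝ`, so Lipschitz images of null
  -- sets are null. But every small slope has a maximum point, so this image contains a ball.
  have himage : volume (perturbationSlope mA mB γ '' Z) = 0 := by
    have := hlip.hausdorffMeasure_image_le (d := 2) (by norm_num)
    rw [hausdorffMeasure_prod_real, hnull, mul_zero] at this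
    exact le_antisymm this zero_le
  have hsub : Metric.ball (0 : ℝ × ℝ) ρ ⊆ perturbationSlope mA mB γ '' Z := by
    rintro ⟨p, q⟩ hpq
    rw [mem_ball_zero_iff, Prod.norm_def, max_lt_iff] at hpq
    have hp : |p| < ρ := hpq.1
    have hq : |q| < ρ := hpq.2
    obtain ⟨x, hx, y, hy, h⟩ := exists_isDoubledMax hA hB hmA hmB hℓ p q
    obtain ⟨l1, l2⟩ := hloc _ _ _ _ hp hq hx hy h
    rw [abs_lt] at l1 l2
    exact ⟨(x, y), ⟨p, q, hp, hq, hx, hy, h⟩,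
      h.slope_eq hγ hmA hmB ⟨by linarith, by linarith⟩ ⟨by linarith, by linarith⟩⟩
  have := Metric.measure_ball_pos volume (0 : ℝ × ℝ) hρ
  exact absurd (measure_mono_null hsub himage) this.ne'

/-- The matrix inequality of the theorem on sums. -/
theorem IsDoubledMax.second_order_le {p q x y X Y : ℝ} (h : IsDoubledMax A B mA mB ℓ γ p q x y)
    (hγ : 0 < γ) (hmA : IsArgmax A ℓ γ mA) (hmB : IsArgmax B ℓ γ mB)
    (hx : x ∈ Ioo 0 ℓ) (hy : y ∈ Ioo 0 ℓ)
    (hX : HasSecondOrder (supConv A γ mA) x ((mA x - x) / γ) X)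
    (hY : HasSecondOrder (supConv B γ mB) y ((mB y - y) / γ) Y) (r s : ℝ) {ε : ℝ} (hε : 0 < ε) :
    (X / 2 - ε) * r ^ 2 + (Y / 2 - ε) * s ^ 2 ≤ (r - s) ^ 2 / (2 * γ) := by
  have e := h.slope_eq hγ hmA hmB hx hy
  simp only [perturbationSlope, Prod.mk.injEq] at e
  have t1 : Tendsto (fun τ : ℝ => x + τ * r) (𝓝[>] 0) (𝓝 x) := by
    have : Continuous fun τ : ℝ => x + τ * r := by fun_prop
    simpa using (this.tendsto 0).mono_left nhdsWithin_le_nhds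
  have t2 : Tendsto (fun τ : ℝ => y + τ * s) (𝓝[>] 0) (𝓝 y) := by
    have : Continuous fun τ : ℝ => y + τ * s := by fun_prop
    simpa using (this.tendsto 0).mono_left nhdsWithin_le_nhds
  -- Maximality is tested at `(x + τ r, y + τ s)`. The first order terms cancel by `slope_eq`, and
  -- `τ²` is divided out.
  obtain ⟨τ, hτ, h1, h2, h3, h4⟩ := ((eventually_mem_nhdsWithin (a := (0 : ℝ)) (s := Ioi 0)).and ((t1.eventually (hX ε hε)).and
    ((t2.eventually (hY ε hε)).and ((t1.eventually (Icc_mem_nhds hx.1 hx.2)).and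
      (t2.eventually (Icc_mem_nhds hy.1 hy.2)))))).exists
  have hτ : 0 < τ := hτ
  have h5 := h _ (hmA.1 (x + τ * r)) _ (hmB.1 (y + τ * s)) _ h3 _ h4
  have e3 : ∀ x y : ℝ, doubled A B γ (mA x) (mB y) x y =
      supConv A γ mA x + supConv B γ mB y - (x - y) ^ 2 / (2 * γ) := fun x y => by
    unfold doubled supConv; ring
  rw [e3, e3] at h5
  have h6 := (abs_le.1 h1).1
  have h7 := (abs_le.1 h2).1
  rw [← e.1, ← e.2] at h5
  have e4 : (x + τ * r - (y + τ * s)) ^ 2 / (2 * γ) = (x - y) ^ 2 / (2 * γ) +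
      (x - y) / γ * (τ * (r - s)) + τ ^ 2 * ((r - s) ^ 2 / (2 * γ)) := by
    field_simp; ring
  rw [e4] at h5
  rw [add_sub_cancel_left] at h6 h7
  have h8 : (y - x) / γ = -((x - y) / γ) := by ring
  rw [h8] at h5
  have : 0 ≤ τ ^ 2 * ((r - s) ^ 2 / (2 * γ) - ((X / 2 - ε) * r ^ 2 + (Y / 2 - ε) * s ^ 2)) := by
    linarith
  have := nonneg_of_mul_nonneg_right this (by positivity)
  linarith

end Jensen

end

/-! ### Comparison in the interior of an edge -/

noncomputable section

theorem sq_sub_le_three_mul (ξ ζ x y : ℝ) :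
    (ξ - ζ) ^ 2 ≤ 3 * ((x - ξ) ^ 2 + (y - ζ) ^ 2 + (x - y) ^ 2) := by
  nlinarith [sq_nonneg ((x - ξ) + (y - ζ)), sq_nonneg ((x - ξ) + (x - y)),
    sq_nonneg ((y - ζ) - (x - y))]

theorem abs_mul_abs_le (a b : ℝ) : |a| * |b| ≤ (a ^ 2 + b ^ 2) / 2 := by
  nlinarith [sq_nonneg (|a| - |b|), sq_abs a, sq_abs b]

/-- One-dimensional comparison at a strict interior maximum: if `A` is a subsolution, `-B` is a
supersolution and `A + B` has a strict maximum at `t₀`, then `L (A + B)(t₀) ≤ κ`. -/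
theorem doubling_comparison {L κ ℓ t₀ C : ℝ} {a σ : ℝ → ℝ} {H : ℝ → ℝ → ℝ} {A B : ℝ → ℝ}
    (hL : 0 ≤ L) (hC : 0 ≤ C) (ht₀ : t₀ ∈ Ioo 0 ℓ) (hA : UpperSemicontinuous A)
    (hB : UpperSemicontinuous B)
    (hmax : ∀ t ∈ Icc 0 ℓ, t ≠ t₀ → A t + B t < A t₀ + B t₀)
    (hAs : IsEdgeSub L a (fun x p => H x p - κ) (Ioo 0 ℓ) A)
    (hBs : IsEdgeSub L a (dualHam H) (Ioo 0 ℓ) B)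
    (ha : ∀ x ∈ Icc 0 ℓ, a x = σ x ^ 2)
    (hσ : ∀ x ∈ Icc 0 ℓ, ∀ y ∈ Icc 0 ℓ, |σ x - σ y| ≤ C * |x - y|)
    (hH₁ : ∀ x ∈ Icc 0 ℓ, ∀ y ∈ Icc 0 ℓ, ∀ p, |H x p - H y p| ≤ C * (1 + |p|) * |x - y|)
    (hH₂ : ∀ x ∈ Icc 0 ℓ, ∀ p q, |H x p - H x q| ≤ C * |p - q|) :
    L * (A t₀ + B t₀) ≤ κ := by
  have hℓ : 0 < ℓ := ht₀.1.trans ht₀.2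
  have ht₀' : t₀ ∈ Icc 0 ℓ := ⟨ht₀.1.le, ht₀.2.le⟩
  suffices key : ∀ ν > 0, ν ≤ 1 → 3 * ν ≤ t₀ → t₀ + 3 * ν ≤ ℓ →
      L * (A t₀ + B t₀) ≤ κ + (L + 6 * C ^ 2 + 10 * C + 1) * ν by
    have ht : Tendsto (fun ν => κ + (L + 6 * C ^ 2 + 10 * C + 1) * ν) (𝓝[>] 0)
        (𝓝 (κ + (L + 6 * C ^ 2 + 10 * C + 1) * 0)) :=
      ((by fun_prop : Continuous fun ν => κ + (L + 6 * C ^ 2 + 10 * C + 1) * ν).tendsto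
        0).mono_left nhdsWithin_le_nhds
    rw [mul_zero, add_zero] at ht
    refine ge_of_tendsto ht ?_
    have hr : 0 < min 1 (min (t₀ / 3) ((ℓ - t₀) / 3)) :=
      lt_min one_pos (lt_min (by linarith [ht₀.1]) (by linarith [ht₀.2]))
    filter_upwards [Ioo_mem_nhdsGT hr] with ν hν
    have h1 : ν < 1 := hν.2.trans_le (min_le_left _ _)
    have h2 : ν < t₀ / 3 := hν.2.trans_le ((min_le_right _ _).trans (min_le_left _ _))
    have h3 : ν < (ℓ - t₀) / 3 := hν.2.trans_le ((min_le_right _ _).trans (min_le_right _ _))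
    exact key ν hν.1 h1.le (by linarith) (by linarith)
  intro ν hν hν1 hν₁ hν₂
  obtain ⟨γ, hγ, hγν, hconc⟩ := doubled_concentration hA hB ht₀' hmax hν
  obtain ⟨mA, hmA⟩ := exists_isArgmax (γ := γ) hA hℓ.le
  obtain ⟨mB, hmB⟩ := exists_isArgmax (γ := γ) hB hℓ.le
  -- Slopes below `γ` change values by at most `γ ℓ` each, which is the tolerance `2 ℓ γ` in
  -- `doubled_concentration`.
  have hloc : ∀ p q x y, |p| < γ → |q| < γ → x ∈ Icc 0 ℓ → y ∈ Icc 0 ℓ →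
      IsDoubledMax A B mA mB ℓ γ p q x y → A t₀ + B t₀ - 2 * ℓ * γ ≤
        doubled A B γ (mA x) (mB y) x y := by
    intro p q x y hp hq hx hy h
    have h1 := h t₀ ht₀' t₀ ht₀' t₀ ht₀' t₀ ht₀'
    have h2 : doubled A B γ t₀ t₀ t₀ t₀ = A t₀ + B t₀ := by unfold doubled; simp
    rw [h2] at h1
    have b : ∀ p x : ℝ, |p| < γ → x ∈ Icc 0 ℓ → p * (t₀ - x) ≤ γ * ℓ := by
      intro p x hp hx
      refine (le_abs_self _).trans ?_
      rw [abs_mul]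
      exact mul_le_mul hp.le (abs_le.2 ⟨by linarith [hx.2, ht₀.1], by linarith [hx.1, ht₀.2]⟩)
        (abs_nonneg _) hγ.le
    have := b p x hp hx
    have := b q y hq hy
    linarith
  obtain ⟨p, q, x, y, X, Y, hp, hq, hx, hy, h, hX, hY⟩ :=
    exists_isDoubledMax_hasSecondOrder hA hB hmA hmB hγ hγ hν₁ hν₂
      fun p q x y hp hq hx hy h =>
        ⟨(hconc _ (hmA.1 x) _ (hmB.1 y) x hx y hy (hloc p q x y hp hq hx hy h)).1.2.2.1,
          (hconc _ (hmA.1 x) _ (hmB.1 y) x hx y hy (hloc p q x y hp hq hx hy h)).1.2.2.2⟩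
  obtain ⟨⟨lξ, lζ, lx, ly⟩, hval, hpen⟩ :=
    hconc _ (hmA.1 x) _ (hmB.1 y) x hx y hy (hloc p q x y hp hq hx hy h)
  obtain ⟨ξ, hξ⟩ : ∃ ξ, ξ = mA x := ⟨_, rfl⟩
  obtain ⟨ζ, hζ⟩ : ∃ ζ, ζ = mB y := ⟨_, rfl⟩
  obtain ⟨PA, hPA⟩ : ∃ P, P = (mA x - x) / γ := ⟨_, rfl⟩
  obtain ⟨PB, hPB⟩ : ∃ P, P = (mB y - y) / γ := ⟨_, rfl⟩
  rw [abs_lt] at lξ lζ lx ly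
  have ix : x ∈ Ioo 0 ℓ := ⟨by linarith, by linarith⟩
  have iy : y ∈ Ioo 0 ℓ := ⟨by linarith, by linarith⟩
  have iξ : mA x ∈ Ioo 0 ℓ := ⟨by linarith, by linarith⟩
  have iζ : mB y ∈ Ioo 0 ℓ := ⟨by linarith, by linarith⟩
  have hslope := h.slope_eq hγ hmA hmB ix iy
  simp only [perturbationSlope, Prod.mk.injEq] at hslope
  set S := σ (mA x) ^ 2 + σ (mB y) ^ 2 with hS
  have hS0 : 0 ≤ S := by positivity
  obtain ⟨ε, hε, hεS⟩ : ∃ ε > 0, 4 * ε * S ≤ ν :=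
    ⟨ν / (4 * (S + 1)), by positivity, by
      have : 4 * (ν / (4 * (S + 1))) * S = ν * (S / (S + 1)) := by field_simp
      rw [this]
      exact mul_le_of_le_one_right hν.le ((div_le_one (by linarith)).2 (by linarith))⟩
  -- Testing the matrix inequality with the vector of values of `σ` turns the difference of the
  -- diffusion terms into `(σ ξ - σ ζ)² / γ`, which is small since `σ` is Lipschitz and `(ξ - ζ)² =
  -- O(ν γ)`.
  have hmat := h.second_order_le hγ hmA hmB ix iy hX hY (σ (mA x)) (σ (mB y)) hε
  have s1 := hAs _ iξ _ _ (hX.hasUpperJet hmA iξ hε)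
  have s2 := hBs _ iζ _ _ (hY.hasUpperJet hmB iζ hε)
  rw [ha _ (hmA.1 x), ← hPA] at s1
  rw [ha _ (hmB.1 y), ← hPB] at s2
  simp only [dualHam] at s2
  have mξ := hmA.1 x
  have mζ := hmB.1 y
  rw [← hPA, ← hPB] at hslope
  rw [← hξ] at s1 hmat hval hpen mξ lξ hS
  rw [← hζ] at s2 hmat hval hpen mζ lζ hS
  have Hdiff : H ζ (-PB) - H ξ PA ≤ C * (1 + |PA|) * |ξ - ζ| + C * |PA + PB| := by
    have h1 := (abs_le.1 (hH₂ ζ mζ (-PB) PA)).2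
    have h2 := (abs_le.1 (hH₁ ζ mζ ξ mξ PA)).2
    rw [show -PB - PA = -(PA + PB) by ring, abs_neg] at h1
    rw [abs_sub_comm ζ ξ] at h2
    linarith
  have hsum : |PA + PB| ≤ 2 * ν := by
    have : PA + PB = p + q := by rw [← hslope.1, ← hslope.2]; ring
    rw [this]
    exact (abs_add_le _ _).trans (by linarith)
  have hPAle : |PA| ≤ γ + |x - y| / γ := by
    have : PA = p + (x - y) / γ := by rw [← hslope.1]; ring
    rw [this]
    refine (abs_add_le _ _).trans ?_
    rw [abs_div, abs_of_pos hγ]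
    linarith
  have hξζ : |ξ - ζ| ≤ 2 * ν := abs_le.2 ⟨by linarith, by linarith⟩
  rw [div_lt_iff₀ (by positivity)] at hpen
  have hsq : (ξ - ζ) ^ 2 ≤ 6 * (ν * γ) := by
    have := sq_sub_le_three_mul ξ ζ x y
    linarith
  -- The slope `PA` may be as large as `|x - y| / γ`, but its product with `|ξ - ζ|` is controlled
  -- by the penalty.
  have hprod : |x - y| / γ * |ξ - ζ| ≤ 4 * ν := by
    rw [div_mul_eq_mul_div, div_le_iff₀ hγ]
    have := abs_mul_abs_le (x - y) (ξ - ζ)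
    have := sq_nonneg (x - ξ)
    have := sq_nonneg (y - ζ)
    linarith
  have hH1 : (1 + |PA|) * |ξ - ζ| ≤ 8 * ν := by
    calc (1 + |PA|) * |ξ - ζ| ≤ (1 + (γ + |x - y| / γ)) * |ξ - ζ| :=
          mul_le_mul_of_nonneg_right (by linarith) (abs_nonneg _)
      _ = (1 + γ) * |ξ - ζ| + |x - y| / γ * |ξ - ζ| := by ring
      _ ≤ 2 * (2 * ν) + 4 * ν := by
          refine add_le_add (mul_le_mul (by linarith) hξζ (abs_nonneg _) (by norm_num)) hprod
      _ = 8 * ν := by ring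
  have hσ2 : (σ ξ - σ ζ) ^ 2 / γ ≤ 6 * C ^ 2 * ν := by
    rw [div_le_iff₀ hγ]
    have h1 := hσ ξ mξ ζ mζ
    have h2 : (σ ξ - σ ζ) ^ 2 ≤ (C * |ξ - ζ|) ^ 2 := by
      rw [← sq_abs]
      exact pow_le_pow_left₀ (abs_nonneg _) h1 2
    rw [mul_pow, sq_abs] at h2
    have h3 : C ^ 2 * (ξ - ζ) ^ 2 ≤ C ^ 2 * (6 * (ν * γ)) :=
      mul_le_mul_of_nonneg_left hsq (sq_nonneg C)
    linarith
  have hmat' : σ ξ ^ 2 * (X + 2 * ε) + σ ζ ^ 2 * (Y + 2 * ε) ≤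
      (σ ξ - σ ζ) ^ 2 / γ + 4 * ε * S := by
    have e : (σ ξ - σ ζ) ^ 2 / (2 * γ) = (σ ξ - σ ζ) ^ 2 / γ / 2 := by ring
    rw [e] at hmat
    rw [hS]
    linarith
  have hLval : L * (A t₀ + B t₀ - ν) ≤ L * (A ξ + B ζ) := mul_le_mul_of_nonneg_left hval.le hL
  have hCH : C * (1 + |PA|) * |ξ - ζ| ≤ C * (8 * ν) := by
    rw [mul_assoc]; exact mul_le_mul_of_nonneg_left hH1 hC
  have hCs : C * |PA + PB| ≤ C * (2 * ν) := mul_le_mul_of_nonneg_left hsum hC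
  linarith

end

noncomputable section

/-- Regularity of the coefficients on an edge parametrized by `[0, ℓ]`. -/
structure IsRegularEdge (ℓ C : ℝ) (a σ : ℝ → ℝ) (H : ℝ → ℝ → ℝ) : Prop where
  nonneg : 0 ≤ C
  diffusion : ∀ x ∈ Icc 0 ℓ, a x = σ x ^ 2
  lipschitz : ∀ x ∈ Icc 0 ℓ, ∀ y ∈ Icc 0 ℓ, |σ x - σ y| ≤ C * |x - y|
  ham_x : ∀ x ∈ Icc 0 ℓ, ∀ y ∈ Icc 0 ℓ, ∀ p, |H x p - H y p| ≤ C * (1 + |p|) * |x - y|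
  ham_p : ∀ x ∈ Icc 0 ℓ, ∀ p q, |H x p - H x q| ≤ C * |p - q|

namespace IsRegularEdge

variable {ℓ C : ℝ} {a σ : ℝ → ℝ} {H : ℝ → ℝ → ℝ}

theorem diffusion_nonneg (h : IsRegularEdge ℓ C a σ H) {x : ℝ} (hx : x ∈ Icc 0 ℓ) : 0 ≤ a x := by
  rw [h.diffusion x hx]; positivity

theorem diffusion_le (h : IsRegularEdge ℓ C a σ H) {x : ℝ} (hx : x ∈ Icc 0 ℓ) :
    a x ≤ (|σ 0| + C * ℓ) ^ 2 := by
  have h1 := h.lipschitz x hx 0 ⟨le_rfl, hx.1.trans hx.2⟩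
  rw [sub_zero, abs_of_nonneg hx.1] at h1
  have h2 : |σ x| ≤ |σ 0| + C * ℓ := by
    have := abs_sub_abs_le_abs_sub (σ x) (σ 0)
    have := mul_le_mul_of_nonneg_left hx.2 h.nonneg
    linarith
  rw [h.diffusion x hx, ← sq_abs]
  exact pow_le_pow_left₀ (abs_nonneg _) h2 2

/-- A Lipschitz square root that vanishes at 0 forces quadratic vanishing of the diffusion, as
required by the slope lemmas. -/
theorem diffusion_le_sq (h : IsRegularEdge ℓ C a σ H) (h0 : a 0 = 0) {x : ℝ} (hx : x ∈ Icc 0 ℓ) :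
    a x ≤ C ^ 2 * x ^ 2 := by
  have h00 : (0 : ℝ) ∈ Icc 0 ℓ := ⟨le_rfl, hx.1.trans hx.2⟩
  have hσ : σ 0 = 0 := by
    rw [h.diffusion 0 h00] at h0
    exact pow_eq_zero_iff (two_ne_zero) |>.1 h0
  have h1 := h.lipschitz x hx 0 h00
  rw [hσ, sub_zero, sub_zero, abs_of_nonneg hx.1] at h1
  rw [h.diffusion x hx, ← sq_abs, ← mul_pow]
  exact pow_le_pow_left₀ (abs_nonneg _) h1 2

theorem abs_ham_le (h : IsRegularEdge ℓ C a σ H) {x : ℝ} (hx : x ∈ Icc 0 ℓ) (p : ℝ) :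
    |H x p| ≤ (|H 0 0| + C * (ℓ + 1)) * (1 + |p|) := by
  have h00 : (0 : ℝ) ∈ Icc 0 ℓ := ⟨le_rfl, hx.1.trans hx.2⟩
  have h1 := h.ham_x x hx 0 h00 0
  have h2 := h.ham_p x hx p 0
  rw [sub_zero, abs_of_nonneg hx.1, abs_zero, add_zero, mul_one] at h1
  rw [sub_zero] at h2
  have h3 := mul_le_mul_of_nonneg_left hx.2 h.nonneg
  have h4 : |H x p| ≤ |H x p - H x 0| + |H x 0 - H 0 0| + |H 0 0| := by
    calc |H x p| = |(H x p - H x 0) + (H x 0 - H 0 0) + H 0 0| := by ring_nf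
      _ ≤ _ := abs_add_three _ _ _
  have h5 : 0 ≤ (|H 0 0| + C * ℓ) * |p| :=
    mul_nonneg (add_nonneg (abs_nonneg _) (mul_nonneg h.nonneg (hx.1.trans hx.2))) (abs_nonneg _)
  have := h.nonneg
  nlinarith

theorem neg_le_ham (h : IsRegularEdge ℓ C a σ H) {x : ℝ} (hx : x ∈ Icc 0 ℓ) (p : ℝ) :
    -((|H 0 0| + C * (ℓ + 1)) * (1 + |p|)) ≤ H x p :=
  (abs_le.1 (h.abs_ham_le hx p)).1

/-- The coefficients of the equation solved by `-u`. -/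
theorem dual (h : IsRegularEdge ℓ C a σ H) : IsRegularEdge ℓ C a σ (dualHam H) where
  nonneg := h.nonneg
  diffusion := h.diffusion
  lipschitz := h.lipschitz
  ham_x x hx y hy p := by
    have := h.ham_x x hx y hy (-p)
    rwa [abs_neg, ← abs_neg, neg_sub, ← neg_sub_neg] at this
  ham_p x hx p q := by
    have := h.ham_p x hx (-p) (-q)
    rw [← abs_neg (-p - -q), ← abs_neg] at this
    unfold dualHam
    convert this using 2
    · ring_nf
    · ring_nf

end IsRegularEdge

theorem HasUpperJet.of_perturbed {u : ℝ → ℝ} {t p X η ℓ θ t₀ : ℝ}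
    (h : HasUpperJet (fun s => u s + η * (s * (ℓ - s) / ℓ) - θ * (s - t₀) ^ 2) t p X) (hℓ : 0 < ℓ) :
    HasUpperJet u t (p - η * ((ℓ - 2 * t) / ℓ) + 2 * θ * (t - t₀)) (X + 2 * η / ℓ + 2 * θ) := by
  filter_upwards [h] with y hy
  rw [← sub_nonneg] at hy ⊢
  convert hy using 1
  field_simp
  ring

/-- Interior comparison on an edge: at an interior maximum point `t₀` of `u - w` plus a small concave
perturbation, `u - w` is small. -/
theorem edge_comparison {L ℓ t₀ C η : ℝ} {a σ : ℝ → ℝ} {H : ℝ → ℝ → ℝ} {u w : ℝ → ℝ}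
    (hL : 0 ≤ L) (hη : 0 ≤ η) (hreg : IsRegularEdge ℓ C a σ H) (ht₀ : t₀ ∈ Ioo 0 ℓ)
    (hu : UpperSemicontinuous u) (hw : UpperSemicontinuous fun x => -w x)
    (hus : IsEdgeSub L a H (Ioo 0 ℓ) u)
    (hws : IsEdgeSub L a (dualHam H) (Ioo 0 ℓ) fun x => -w x)
    (hmax : ∀ t ∈ Icc 0 ℓ, u t + η * (t * (ℓ - t) / ℓ) - w t ≤
      u t₀ + η * (t₀ * (ℓ - t₀) / ℓ) - w t₀) :
    L * (u t₀ - w t₀) ≤ η * (L * ℓ + 2 * (|σ 0| + C * ℓ) ^ 2 / ℓ + C) := by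
  have hℓ : 0 < ℓ := ht₀.1.trans ht₀.2
  set α := (|σ 0| + C * ℓ) ^ 2 with hα
  have hα0 : 0 ≤ α := by positivity
  have hC := hreg.nonneg
  have hψ : ∀ t ∈ Icc 0 ℓ, 0 ≤ t * (ℓ - t) / ℓ ∧ t * (ℓ - t) / ℓ ≤ ℓ := fun t ht =>
    ⟨div_nonneg (mul_nonneg ht.1 (by linarith [ht.2])) hℓ.le, by
      rw [div_le_iff₀ hℓ]
      exact mul_le_mul ht.2 (by linarith [ht.1]) (by linarith [ht.2]) hℓ.le⟩
  -- Subtracting `θ (s - t₀)²` makes the maximum strict; `θ` then tends to 0. The perturbed function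
  -- solves the equation up to the error `κ`, which collects the changes of value, slope and second
  -- derivative.
  suffices key : ∀ θ > 0, L * (u t₀ - w t₀) ≤ η * (L * ℓ + 2 * α / ℓ + C) +
      (2 * α + 2 * C * ℓ) * θ by
    have ht : Tendsto (fun θ => η * (L * ℓ + 2 * α / ℓ + C) + (2 * α + 2 * C * ℓ) * θ) (𝓝[>] 0)
        (𝓝 (η * (L * ℓ + 2 * α / ℓ + C) + (2 * α + 2 * C * ℓ) * 0)) :=
      ((by fun_prop : Continuous fun θ => η * (L * ℓ + 2 * α / ℓ + C) +
        (2 * α + 2 * C * ℓ) * θ).tendsto 0).mono_left nhdsWithin_le_nhds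
    rw [mul_zero, add_zero] at ht
    refine ge_of_tendsto ht ?_
    filter_upwards [self_mem_nhdsWithin] with θ hθ
    exact key θ hθ
  intro θ hθ
  have hA : UpperSemicontinuous fun s => u s + η * (s * (ℓ - s) / ℓ) - θ * (s - t₀) ^ 2 := by
    have : UpperSemicontinuous fun s => u s + (η * (s * (ℓ - s) / ℓ) - θ * (s - t₀) ^ 2) :=
      hu.add (Continuous.upperSemicontinuous (by fun_prop))
    simpa only [add_sub_assoc] using this
  have := doubling_comparison (L := L) (κ := η * (L * ℓ + 2 * α / ℓ + C) +
      (2 * α + 2 * C * ℓ) * θ) (a := a) (H := H) hL hC ht₀ hA hw ?_ ?_ hws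
      hreg.diffusion hreg.lipschitz hreg.ham_x hreg.ham_p
  · simp only [sub_self] at this
    have h1 : 0 ≤ L * (η * (t₀ * (ℓ - t₀) / ℓ)) :=
      mul_nonneg hL (mul_nonneg hη (hψ t₀ ⟨ht₀.1.le, ht₀.2.le⟩).1)
    nlinarith
  · intro t ht hne
    have h1 := hmax t ht
    have h2 : 0 < θ * (t - t₀) ^ 2 := by
      have : t - t₀ ≠ 0 := sub_ne_zero.2 hne
      positivity
    simp only [sub_self]
    linarith
  · intro t ht p X hj
    have ht' : t ∈ Icc 0 ℓ := ⟨ht.1.le, ht.2.le⟩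
    have h1 := hus t ht _ _ (hj.of_perturbed hℓ)
    have h2 := (abs_le.1 (hreg.ham_p t ht' p
      (p - η * ((ℓ - 2 * t) / ℓ) + 2 * θ * (t - t₀)))).2
    have h3 : |p - (p - η * ((ℓ - 2 * t) / ℓ) + 2 * θ * (t - t₀))| ≤ η + 2 * θ * ℓ := by
      have e : p - (p - η * ((ℓ - 2 * t) / ℓ) + 2 * θ * (t - t₀)) =
          η * ((ℓ - 2 * t) / ℓ) + 2 * θ * (t₀ - t) := by ring
      rw [e]
      have b1 : |(ℓ - 2 * t) / ℓ| ≤ 1 := by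
        rw [abs_div, abs_of_pos hℓ, div_le_one hℓ]
        exact abs_le.2 ⟨by linarith [ht.2], by linarith [ht.1]⟩
      have b2 : |t₀ - t| ≤ ℓ := abs_le.2 ⟨by linarith [ht₀.1, ht.2], by linarith [ht₀.2, ht.1]⟩
      refine (abs_add_le _ _).trans (add_le_add ?_ ?_)
      · rw [abs_mul, abs_of_nonneg hη]
        exact mul_le_of_le_one_right hη b1
      · rw [abs_mul, abs_of_pos (by positivity : 0 < 2 * θ)]
        exact mul_le_mul_of_nonneg_left b2 (by positivity)
    have h4 := mul_le_mul_of_nonneg_left h3 hC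
    have h5 : a t * (2 * η / ℓ + 2 * θ) ≤ α * (2 * η / ℓ + 2 * θ) :=
      mul_le_mul_of_nonneg_right (hreg.diffusion_le ht') (by positivity)
    have h6 : L * (η * (t * (ℓ - t) / ℓ)) ≤ L * (η * ℓ) :=
      mul_le_mul_of_nonneg_left (mul_le_mul_of_nonneg_left (hψ t ht').2 hη) hL
    have h7 : 0 ≤ L * (θ * (t - t₀) ^ 2) := by positivity
    have e1 : α * (2 * η / ℓ) = η * (2 * α / ℓ) := by ring
    nlinarith

end

/-! ### Topology and gluing on the network -/

noncomputable section

namespace Network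

variable {d : ℕ} (N : Network d)

theorem continuous_edgePoint (E : N.Edge) : Continuous (N.edgePoint E) := by
  unfold edgePoint
  fun_prop

theorem continuous_param (E : N.Edge) : Continuous (N.param E) := by
  unfold param
  refine Continuous.subtype_mk ((N.continuous_edgePoint E).comp ?_) _
  exact continuous_subtype_val.comp continuous_projIcc

theorem coe_param (E : N.Edge) {t : ℝ} (ht : t ∈ Icc 0 (N.len E)) :
    (N.param E t : EuclideanSpace ℝ (Fin d)) = N.edgePoint E t := by
  simp only [param, projIcc_of_mem _ ht]

theorem coe_param_mem (E : N.Edge) (t : ℝ) :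
    (N.param E t : EuclideanSpace ℝ (Fin d)) ∈ N.closedEdge E :=
  N.edgePoint_mem E (projIcc 0 (N.len E) (N.len_pos E).le t).2

theorem edgePoint_zero (E : N.Edge) : N.edgePoint E 0 = N.vert (N.src E) := by
  simp [edgePoint]

theorem edgePoint_len (E : N.Edge) : N.edgePoint E (N.len E) = N.vert (N.tgt E) := by
  simp [edgePoint, div_self (N.len_pos E).ne']

theorem param_zero (E : N.Edge) : N.param E 0 = N.vertex (N.src E) :=
  Subtype.ext <| by
    rw [N.coe_param E ⟨le_rfl, (N.len_pos E).le⟩, edgePoint_zero]; rfl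

theorem param_len (E : N.Edge) : N.param E (N.len E) = N.vertex (N.tgt E) :=
  Subtype.ext <| by
    rw [N.coe_param E ⟨(N.len_pos E).le, le_rfl⟩, edgePoint_len]; rfl

theorem dist_edgePoint (E : N.Edge) (s t : ℝ) :
    dist (N.edgePoint E s) (N.edgePoint E t) = |s - t| := by
  have hl : ‖N.vert (N.tgt E) - N.vert (N.src E)‖ = N.len E := by
    rw [← dist_eq_norm, dist_comm]; rfl
  rw [dist_eq_norm]
  have : N.edgePoint E s - N.edgePoint E t =
      ((s - t) / N.len E) • (N.vert (N.tgt E) - N.vert (N.src E)) := by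
    unfold edgePoint
    rw [sub_div, sub_smul]; abel
  rw [this, norm_smul, hl, Real.norm_eq_abs, abs_div, abs_of_pos (N.len_pos E),
    div_mul_cancel₀ _ (N.len_pos E).ne']

theorem dist_param (E : N.Edge) {s t : ℝ} (hs : s ∈ Icc 0 (N.len E)) (ht : t ∈ Icc 0 (N.len E)) :
    dist (N.param E s) (N.param E t) = |s - t| := by
  rw [Subtype.dist_eq, N.coe_param E hs, N.coe_param E ht, dist_edgePoint]

theorem param_injOn (E : N.Edge) : InjOn (N.param E) (Icc 0 (N.len E)) := by
  intro s hs t ht h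
  have := N.dist_param E hs ht
  rw [h, dist_self] at this
  exact sub_eq_zero.1 (abs_eq_zero.1 this.symm)

theorem exists_param (x : N.carrier) : ∃ E, ∃ t ∈ Icc 0 (N.len E), N.param E t = x := by
  obtain ⟨x, hx⟩ := x
  obtain ⟨E, hE⟩ := mem_iUnion.1 hx
  unfold closedEdge at hE
  rw [segment_eq_image'] at hE
  obtain ⟨θ, hθ, rfl⟩ := hE
  have hl := N.len_pos E
  have ht : θ * N.len E ∈ Icc 0 (N.len E) :=
    ⟨mul_nonneg hθ.1 hl.le, mul_le_of_le_one_left hl.le hθ.2⟩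
  refine ⟨E, θ * N.len E, ht, Subtype.ext ?_⟩
  rw [N.coe_param E ht, edgePoint, mul_div_cancel_right₀ _ hl.ne']

theorem coe_param_mem_openSegment (E : N.Edge) {t : ℝ} (ht : t ∈ Ioo 0 (N.len E)) :
    (N.param E t : EuclideanSpace ℝ (Fin d)) ∈
      openSegment ℝ (N.vert (N.src E)) (N.vert (N.tgt E)) := by
  rw [N.coe_param E ⟨ht.1.le, ht.2.le⟩, openSegment_eq_image']
  exact ⟨t / N.len E, ⟨div_pos ht.1 (N.len_pos E), (div_lt_one (N.len_pos E)).2 ht.2⟩, rfl⟩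

theorem vertex_injective : Function.Injective N.vertex := fun _ _ h =>
  N.vert_injective (congrArg Subtype.val h)

theorem param_eq_vertex {E : N.Edge} {t : ℝ} (ht : t ∈ Icc 0 (N.len E)) {v : Fin N.n}
    (h : N.param E t = N.vertex v) : (t = 0 ∧ v = N.src E) ∨ (t = N.len E ∧ v = N.tgt E) := by
  have hmem : N.vert v ∈ segment ℝ (N.vert (N.src E)) (N.vert (N.tgt E)) := by
    have := N.coe_param_mem E t
    rw [h] at this
    exact this
  have hl := (N.len_pos E).le
  rcases N.vert_mem_segment E.1 E.2 v hmem with hv | hv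
  · refine Or.inl ⟨N.param_injOn E ht ⟨le_rfl, hl⟩ ?_, hv⟩
    rw [h, param_zero, hv]
  · refine Or.inr ⟨N.param_injOn E ht ⟨hl, le_rfl⟩ ?_, hv⟩
    rw [h, param_len, hv]

theorem param_eq_param {E E' : N.Edge} {t t' : ℝ} (ht : t ∈ Icc 0 (N.len E))
    (ht' : t' ∈ Icc 0 (N.len E')) (h : N.param E t = N.param E' t') :
    (E = E' ∧ t = t') ∨ ∃ v, N.param E t = N.vertex v := by
  rcases ht.1.eq_or_lt with h0 | h0
  · exact Or.inr ⟨_, h0 ▸ N.param_zero E⟩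
  rcases ht.2.eq_or_lt with h1 | h1
  · exact Or.inr ⟨_, h1 ▸ N.param_len E⟩
  rcases ht'.1.eq_or_lt with h2 | h2
  · exact Or.inr ⟨_, h.trans (h2 ▸ N.param_zero E')⟩
  rcases ht'.2.eq_or_lt with h3 | h3
  · exact Or.inr ⟨_, h.trans (h3 ▸ N.param_len E')⟩
  left
  by_cases hE : E = E'
  · subst hE
    exact ⟨rfl, N.param_injOn E ht ht' h⟩
  · exfalso
    have hd := N.edges_disjoint E.1 E.2 E'.1 E'.2 fun he => hE (Subtype.ext he)
    have m := N.coe_param_mem_openSegment E ⟨h0, h1⟩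
    have m' := N.coe_param_mem_openSegment E' ⟨h2, h3⟩
    rw [← h] at m'
    exact Set.disjoint_left.1 hd m m'

theorem param_ne_vertex {E : N.Edge} {t : ℝ} (ht : t ∈ Ioo 0 (N.len E)) (v : Fin N.n) :
    N.param E t ≠ N.vertex v := fun h => by
  rcases N.param_eq_vertex ⟨ht.1.le, ht.2.le⟩ h with h | h
  · exact ht.1.ne' h.1
  · exact ht.2.ne h.1

theorem param_eq_param_of_mem_Ioo {E E' : N.Edge} {t t' : ℝ} (ht : t ∈ Ioo 0 (N.len E))
    (ht' : t' ∈ Icc 0 (N.len E')) (h : N.param E t = N.param E' t') : E = E' ∧ t = t' := by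
  rcases N.param_eq_param ⟨ht.1.le, ht.2.le⟩ ht' h with h | ⟨v, hv⟩
  · exact h
  · exact absurd hv (N.param_ne_vertex ht v)

/-- Neighborhoods in the network are detected on the edges. -/
theorem eventually_nhds_of_param {x : N.carrier} {p : N.carrier → Prop}
    (h : ∀ E, ∀ t ∈ Icc 0 (N.len E), N.param E t = x →
      ∀ᶠ s in 𝓝[Icc 0 (N.len E)] t, p (N.param E s)) : ∀ᶠ y in 𝓝 x, p y := by
  let π : (Σ E : N.Edge, Icc 0 (N.len E)) → N.carrier := fun z => N.param z.1 z.2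
  have hπ : Continuous π :=
    continuous_sigma fun E => (N.continuous_param E).comp continuous_subtype_val
  -- The disjoint union of the closed edges is compact and the network is Hausdorff, so
  -- neighborhoods of a whole fiber descend to a neighborhood of the point.
  have hcl : IsClosedMap π := hπ.isClosedMap
  have key := hcl.eventually_nhds_fiber (p := fun z => p (π z)) x fun z hz => by
    obtain ⟨E, t, ht⟩ := z
    have h1 := h E t ht hz
    rw [Sigma.nhds_mk, eventually_map]
    rw [nhdsWithin_eq_map_subtype_coe ht, eventually_map] at h1
    exact h1
  filter_upwards [key] with y hy
  obtain ⟨E, t, ht, rfl⟩ := N.exists_param y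
  exact hy ⟨E, t, ht⟩ rfl

instance : CompactSpace N.carrier := by
  have hπ : Continuous (fun z : (Σ E : N.Edge, Icc 0 (N.len E)) => N.param z.1 z.2) :=
    continuous_sigma fun E => (N.continuous_param E).comp continuous_subtype_val
  have hs : Function.Surjective (fun z : (Σ E : N.Edge, Icc 0 (N.len E)) => N.param z.1 z.2) :=
    fun x => by
      obtain ⟨E, t, ht, h⟩ := N.exists_param x
      exact ⟨⟨E, t, ht⟩, h⟩
  exact hs.compactSpace hπ

theorem eventually_nhds_param {E : N.Edge} {t : ℝ} (ht : t ∈ Ioo 0 (N.len E))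
    {p : N.carrier → Prop} (h : ∀ᶠ s in 𝓝 t, p (N.param E s)) : ∀ᶠ y in 𝓝 (N.param E t), p y := by
  refine N.eventually_nhds_of_param fun E' t' ht' he => ?_
  obtain ⟨rfl, rfl⟩ := N.param_eq_param_of_mem_Ioo ht ht' he.symm
  exact h.filter_mono nhdsWithin_le_nhds

/-- Function on the network with given values on the edges, which have to be compatible at the
vertices. -/
def glue (f : N.Edge → ℝ → ℝ) (x : N.carrier) : ℝ :=
  f (N.exists_param x).choose (N.exists_param x).choose_spec.choose

variable {N} in
/-- Compatibility of functions on the edges, with values `c` at the vertices. -/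
def Compatible (c : Fin N.n → ℝ) (f : N.Edge → ℝ → ℝ) : Prop :=
  ∀ E, f E 0 = c (N.src E) ∧ f E (N.len E) = c (N.tgt E)

section Glue

variable {N} {c : Fin N.n → ℝ} {f : N.Edge → ℝ → ℝ}

theorem Compatible.eq_of_vertex (h : Compatible c f) {E : N.Edge} {t : ℝ}
    (ht : t ∈ Icc 0 (N.len E)) {v : Fin N.n} (hv : N.param E t = N.vertex v) : f E t = c v := by
  rcases N.param_eq_vertex ht hv with ⟨rfl, rfl⟩ | ⟨rfl, rfl⟩
  · exact (h E).1
  · exact (h E).2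

theorem Compatible.glue_param (h : Compatible c f) (E : N.Edge) {t : ℝ}
    (ht : t ∈ Icc 0 (N.len E)) : N.glue f (N.param E t) = f E t := by
  have hx := N.exists_param (N.param E t)
  have h1 := hx.choose_spec.choose_spec
  rcases N.param_eq_param ht h1.1 h1.2.symm with ⟨e1, e2⟩ | ⟨v, hv⟩
  · change f hx.choose hx.choose_spec.choose = _
    rw [← e2, ← e1]
  · rw [h.eq_of_vertex ht hv]
    exact h.eq_of_vertex h1.1 (h1.2.trans hv)

theorem Compatible.glue_vertex (h : Compatible c f) (v : Fin N.n) :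
    N.glue f (N.vertex v) = c v := by
  obtain ⟨E, t, ht, hE⟩ := N.exists_param (N.vertex v)
  rw [← hE, h.glue_param E ht, h.eq_of_vertex ht hE]

theorem Compatible.onEdge_eqOn (h : Compatible c f) (E : N.Edge) :
    EqOn (N.onEdge (N.glue f) E) (f E) (Icc 0 (N.len E)) := fun _ ht => h.glue_param E ht

theorem continuous_of_onEdge {φ : N.carrier → ℝ}
    (h : ∀ E, ContinuousOn (N.onEdge φ E) (Icc 0 (N.len E))) : Continuous φ := by
  rw [continuous_iff_continuousAt]
  intro x s hs
  refine N.eventually_nhds_of_param fun E t ht he => ?_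
  have : φ x = N.onEdge φ E t := by rw [← he]; rfl
  rw [this] at hs
  exact h E t ht hs

theorem Compatible.isC2_glue (h : Compatible c f) (hf : ∀ E, ContDiff ℝ 2 (f E)) :
    N.IsC2 (N.glue f) := by
  have h2 : ∀ E, ContDiffOn ℝ 2 (N.onEdge (N.glue f) E) (Icc 0 (N.len E)) := fun E =>
    (hf E).contDiffOn.congr (h.onEdge_eqOn E)
  exact ⟨continuous_of_onEdge fun E => (h2 E).continuousOn, h2⟩

end Glue

theorem uniqueDiffOn_edge (E : N.Edge) : UniqueDiffOn ℝ (Icc 0 (N.len E)) :=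
  uniqueDiffOn_Icc (N.len_pos E)

section Derivatives

variable {N} {φ : N.carrier → ℝ} {E : N.Edge} {g : ℝ → ℝ} {t : ℝ}

theorem dx_eq_deriv (h : EqOn (N.onEdge φ E) g (Icc 0 (N.len E))) (hg : ContDiff ℝ 2 g)
    (ht : t ∈ Icc 0 (N.len E)) : N.dx φ E t = deriv g t := by
  unfold dx
  rw [derivWithin_congr h (h ht)]
  exact (hg.differentiable (by norm_num) t).derivWithin (N.uniqueDiffOn_edge E t ht)

theorem dxx_eq_deriv (h : EqOn (N.onEdge φ E) g (Icc 0 (N.len E))) (hg : ContDiff ℝ 2 g)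
    (ht : t ∈ Icc 0 (N.len E)) : N.dxx φ E t = iteratedDeriv 2 g t := by
  unfold dxx
  rw [iteratedDerivWithin_congr h ht]
  exact iteratedDerivWithin_eq_iteratedDeriv (N.uniqueDiffOn_edge E) hg.contDiffAt ht

theorem Compatible.dx_glue {c : Fin N.n → ℝ} {f : N.Edge → ℝ → ℝ} (h : Compatible c f)
    (hf : ∀ E, ContDiff ℝ 2 (f E)) (ht : t ∈ Icc 0 (N.len E)) :
    N.dx (N.glue f) E t = deriv (f E) t :=
  dx_eq_deriv (h.onEdge_eqOn E) (hf E) ht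

theorem Compatible.dxx_glue {c : Fin N.n → ℝ} {f : N.Edge → ℝ → ℝ} (h : Compatible c f)
    (hf : ∀ E, ContDiff ℝ 2 (f E)) (ht : t ∈ Icc 0 (N.len E)) :
    N.dxx (N.glue f) E t = iteratedDeriv 2 (f E) t :=
  dxx_eq_deriv (h.onEdge_eqOn E) (hf E) ht

end Derivatives

end Network

end

/-! ### Test functions at vertices and on edges -/

noncomputable section

/-- A cubic polynomial with prescribed slope and second derivative at `t₀`. -/
def cubic (c t₀ p X b : ℝ) (t : ℝ) : ℝ :=
  c + p * (t - t₀) + X / 2 * (t - t₀) ^ 2 + b * (t - t₀) ^ 3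

theorem contDiff_cubic (c t₀ p X b : ℝ) : ContDiff ℝ 2 (cubic c t₀ p X b) := by
  unfold cubic
  fun_prop

theorem hasDerivAt_cubic (c t₀ p X b t : ℝ) : HasDerivAt (cubic c t₀ p X b)
    (cubic p t₀ X (6 * b) 0 t) t := by
  have h := (hasDerivAt_id t).sub_const t₀
  have := (((h.const_mul p).const_add c).add ((h.pow 2).const_mul (X / 2))).add
    ((h.pow 3).const_mul b)
  exact this.congr_deriv (by simp [cubic]; ring)

theorem deriv_cubic (c t₀ p X b : ℝ) : deriv (cubic c t₀ p X b) = cubic p t₀ X (6 * b) 0 :=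
  funext fun t => (hasDerivAt_cubic c t₀ p X b t).deriv

theorem iteratedDeriv_two_cubic (c t₀ p X b : ℝ) :
    iteratedDeriv 2 (cubic c t₀ p X b) = cubic X t₀ (6 * b) 0 0 := by
  rw [iteratedDeriv_succ, iteratedDeriv_one, deriv_cubic, deriv_cubic]
  simp

@[simp] theorem cubic_self (c t₀ p X b : ℝ) : cubic c t₀ p X b t₀ = c := by simp [cubic]

namespace Network

variable {d : ℕ} (N : Network d)

/-- The parameter of the point of `E` at distance `x` from the end point `v`. -/
def inw (v : Fin N.n) (E : N.Edge) (x : ℝ) : ℝ := if v = N.src E then x else N.len E - x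

/-- The point of `E` at distance `x` from the end point `v`. -/
def ray (v : Fin N.n) (E : N.Edge) (x : ℝ) : N.carrier := N.param E (N.inw v E x)

/-- Orientation of `E` as seen from the end point `v`. -/
def orient (v : Fin N.n) (E : N.Edge) : ℝ := if v = N.src E then 1 else -1

variable {N}

theorem src_ne_tgt (E : N.Edge) : N.src E ≠ N.tgt E := (N.edges_lt E.1 E.2).ne

theorem inw_mem_Icc {v : Fin N.n} {E : N.Edge} {x : ℝ} (hx : x ∈ Icc 0 (N.len E)) :
    N.inw v E x ∈ Icc 0 (N.len E) := by
  unfold inw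
  split_ifs
  · exact hx
  · exact ⟨by linarith [hx.2], by linarith [hx.1]⟩

theorem inw_mem_Ioo {v : Fin N.n} {E : N.Edge} {x : ℝ} (hx : x ∈ Ioo 0 (N.len E)) :
    N.inw v E x ∈ Ioo 0 (N.len E) := by
  unfold inw
  split_ifs
  · exact hx
  · exact ⟨by linarith [hx.2], by linarith [hx.1]⟩

theorem inw_inw (v : Fin N.n) (E : N.Edge) (x : ℝ) : N.inw v E (N.inw v E x) = x := by
  unfold inw
  split_ifs
  · rfl
  · ring

theorem inw_zero (v : Fin N.n) (E : N.Edge) : N.inw v E 0 = N.coord v E := by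
  unfold inw coord
  split_ifs <;> ring

theorem abs_inw_sub (v : Fin N.n) (E : N.Edge) (x y : ℝ) :
    |N.inw v E x - N.inw v E y| = |x - y| := by
  unfold inw
  split_ifs
  · rfl
  · rw [show N.len E - x - (N.len E - y) = -(x - y) by ring, abs_neg]

theorem continuous_inw (v : Fin N.n) (E : N.Edge) : Continuous (N.inw v E) := by
  unfold inw
  split_ifs <;> fun_prop

theorem continuous_ray (v : Fin N.n) (E : N.Edge) : Continuous (N.ray v E) :=
  (N.continuous_param E).comp (continuous_inw v E)

theorem ray_zero (v : Fin N.n) (E : N.Inc v) : N.ray v E 0 = N.vertex v := by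
  obtain ⟨E, h⟩ := E
  unfold ray inw
  split_ifs with h1
  · rw [param_zero, ← h1]
  · rw [sub_zero, param_len, ← h.resolve_left h1]

theorem dist_ray (v : Fin N.n) (E : N.Edge) {x y : ℝ} (hx : x ∈ Icc 0 (N.len E))
    (hy : y ∈ Icc 0 (N.len E)) : dist (N.ray v E x) (N.ray v E y) = |x - y| := by
  unfold ray
  rw [N.dist_param E (inw_mem_Icc hx) (inw_mem_Icc hy), abs_inw_sub]

theorem ray_inw (v : Fin N.n) (E : N.Edge) (t : ℝ) : N.ray v E (N.inw v E t) = N.param E t := by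
  unfold ray
  rw [inw_inw]

/-- Neighborhoods of a vertex are detected on the incident edges. -/
theorem eventually_nhds_vertex {v : Fin N.n} {p : N.carrier → Prop} (h0 : p (N.vertex v))
    (h : ∀ E : N.Inc v, ∀ᶠ x in 𝓝[>] (0 : ℝ), p (N.ray v E x)) : ∀ᶠ y in 𝓝 (N.vertex v), p y := by
  refine N.eventually_nhds_of_param fun E t ht he => ?_
  have hinc := N.param_eq_vertex ht he
  have hv : v = N.src E ∨ v = N.tgt E := hinc.imp And.right And.right
  have ht0 : N.inw v E t = 0 := by
    unfold inw
    rcases hinc with ⟨h1, h2⟩ | ⟨h1, h2⟩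
    · rw [if_pos h2, h1]
    · rw [if_neg (h2 ▸ (src_ne_tgt E).symm), h1, sub_self]
  have h1 : ∀ᶠ x in 𝓝[≥] (0 : ℝ), p (N.ray v E x) := by
    rw [← Ioi_insert, nhdsWithin_insert, eventually_sup]
    refine ⟨?_, h ⟨E, hv⟩⟩
    have := N.ray_zero v ⟨E, hv⟩
    simp only at this
    simpa [this] using h0
  have ht : Tendsto (N.inw v E) (𝓝[Icc 0 (N.len E)] t) (𝓝[≥] 0) := by
    refine tendsto_nhdsWithin_iff.2 ⟨?_, ?_⟩
    · have := (continuous_inw v E).tendsto t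
      rw [ht0] at this
      exact this.mono_left nhdsWithin_le_nhds
    · filter_upwards [self_mem_nhdsWithin] with s hs using (inw_mem_Icc hs).1
  filter_upwards [ht.eventually h1] with s hs
  rwa [ray_inw] at hs

theorem eventually_ray {v : Fin N.n} {p : N.carrier → Prop} (h : ∀ᶠ y in 𝓝 (N.vertex v), p y)
    (E : N.Inc v) : ∀ᶠ x in 𝓝[>] (0 : ℝ), p (N.ray v E x) := by
  have := (continuous_ray v E.1).tendsto 0
  rw [ray_zero] at this
  exact (this.eventually h).filter_mono nhdsWithin_le_nhds

/-- A cubic polynomial with slope `s` and second derivative `k` at `0`, vanishing at `0`, `ℓ`. -/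
def endCubic (ℓ s k : ℝ) : ℝ → ℝ := cubic 0 0 s k (-(s * ℓ + k / 2 * ℓ ^ 2) / ℓ ^ 3)

theorem endCubic_zero (ℓ s k : ℝ) : endCubic ℓ s k 0 = 0 := cubic_self _ _ _ _ _

theorem endCubic_len {ℓ : ℝ} (hℓ : 0 < ℓ) (s k : ℝ) : endCubic ℓ s k ℓ = 0 := by
  unfold endCubic cubic
  field_simp
  ring

/-- Divided by `x`, the cubic is continuous with value `s > p` at 0. This is why the second
derivative `k` is free. -/
theorem eventually_le_endCubic (ℓ : ℝ) {p s : ℝ} (h : p < s) (k : ℝ) :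
    ∀ᶠ x in 𝓝[>] (0 : ℝ), p * x ≤ endCubic ℓ s k x := by
  set b := -(s * ℓ + k / 2 * ℓ ^ 2) / ℓ ^ 3 with hb
  have hc : Continuous fun x : ℝ => s + k / 2 * x + b * x ^ 2 := by fun_prop
  have h1 : ∀ᶠ x in 𝓝 (0 : ℝ), p < s + k / 2 * x + b * x ^ 2 :=
    (hc.tendsto 0).eventually_const_lt (by simpa using h)
  filter_upwards [h1.filter_mono nhdsWithin_le_nhds, self_mem_nhdsWithin] with x hx hx0
  have hx0 : 0 < x := hx0
  have : endCubic ℓ s k x = (s + k / 2 * x + b * x ^ 2) * x := by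
    unfold endCubic cubic; rw [← hb]; ring
  rw [this]
  exact mul_le_mul_of_nonneg_right hx.le hx0.le

open Classical in
/-- Test function with slopes `s` and second derivatives `k` at the vertex `v`. -/
theorem exists_vertex_test (v : Fin N.n) (s k : N.Inc v → ℝ) :
    ∃ φ, N.IsC2 φ ∧ φ (N.vertex v) = 0 ∧
      (∀ E : N.Inc v, ∀ x ∈ Icc 0 (N.len E.1), φ (N.ray v E x) = endCubic (N.len E.1) (s E) (k E) x) ∧
      (∀ E : N.Inc v, N.dx φ E.1 (N.coord v E) = N.orient v E * s E) ∧
      ∀ E : N.Inc v, N.dxx φ E.1 (N.coord v E) = k E := by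
  -- The cubics vanish at both ends, so they glue with 0 on the edges not incident to `v`.
  set f : N.Edge → ℝ → ℝ := fun E t =>
    if h : v = N.src E ∨ v = N.tgt E then
      endCubic (N.len E) (s ⟨E, h⟩) (k ⟨E, h⟩) (N.inw v E t) else 0 with hf
  have hcomp : Compatible (fun _ => 0) f := by
    intro E
    simp only [hf]
    split_ifs with h
    · unfold inw
      split_ifs
      · exact ⟨endCubic_zero _ _ _, endCubic_len (N.len_pos E) _ _⟩
      · rw [sub_zero, sub_self]
        exact ⟨endCubic_len (N.len_pos E) _ _, endCubic_zero _ _ _⟩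
    · exact ⟨rfl, rfl⟩
  have hsrc : ∀ E : N.Inc v, v = N.src E.1 → f E.1 = endCubic (N.len E.1) (s E) (k E) := by
    intro E h
    funext t
    simp only [hf, dif_pos E.2]
    rw [inw, if_pos h]
  have htgt : ∀ E : N.Inc v, v ≠ N.src E.1 → f E.1 = cubic 0 (N.len E.1) (-s E) (k E)
      ((s E * N.len E.1 + k E / 2 * N.len E.1 ^ 2) / N.len E.1 ^ 3) := by
    intro E h
    funext t
    simp only [hf, dif_pos E.2]
    rw [inw, if_neg h]
    unfold endCubic cubic
    ring
  have hC2 : ∀ E, ContDiff ℝ 2 (f E) := by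
    intro E
    by_cases h : v = N.src E ∨ v = N.tgt E
    · by_cases h1 : v = N.src E
      · rw [hsrc ⟨E, h⟩ h1]; exact contDiff_cubic _ _ _ _ _
      · rw [htgt ⟨E, h⟩ h1]; exact contDiff_cubic _ _ _ _ _
    · have : f E = fun _ => 0 := by funext t; simp only [hf, dif_neg h]
      rw [this]; exact contDiff_const
  have hcoord : ∀ E : N.Inc v, N.coord v E.1 ∈ Icc 0 (N.len E.1) := fun E => by
    rw [← inw_zero]; exact inw_mem_Icc ⟨le_rfl, (N.len_pos E.1).le⟩
  refine ⟨N.glue f, hcomp.isC2_glue hC2, hcomp.glue_vertex v, fun E x hx => ?_, fun E => ?_,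
    fun E => ?_⟩
  · unfold ray
    rw [hcomp.glue_param E.1 (inw_mem_Icc hx)]
    simp only [hf, dif_pos E.2, inw_inw]
  · rw [hcomp.dx_glue hC2 (hcoord E)]
    unfold coord orient
    split_ifs with h
    · rw [hsrc E h, endCubic, deriv_cubic, cubic_self, one_mul]
    · rw [htgt E h, deriv_cubic, cubic_self, neg_one_mul]
  · rw [hcomp.dxx_glue hC2 (hcoord E)]
    unfold coord
    split_ifs with h
    · rw [hsrc E h, endCubic, iteratedDeriv_two_cubic, cubic_self]
    · rw [htgt E h, iteratedDeriv_two_cubic, cubic_self]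

theorem inwardDeriv_eq (φ : N.carrier → ℝ) (v : Fin N.n) (E : N.Edge) :
    N.inwardDeriv φ v E = N.orient v E * N.dx φ E (N.coord v E) := by
  unfold inwardDeriv orient coord
  split_ifs <;> simp

theorem orient_mul_self (v : Fin N.n) (E : N.Edge) : N.orient v E * N.orient v E = 1 := by
  unfold orient
  split_ifs <;> simp

open Classical in
/-- Quadratic test function at an interior point of an edge. -/
theorem exists_edge_test (E : N.Edge) (t p X : ℝ) :
    ∃ φ, N.IsC2 φ ∧ (∀ s ∈ Icc 0 (N.len E), φ (N.param E s) = cubic 0 t p X 0 s) ∧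
      (t ∈ Icc 0 (N.len E) → N.dx φ E t = p ∧ N.dxx φ E t = X) := by
  -- Only the values on `E` matter. Every vertex other than `N.src E` receives the value at the
  -- second end point, and the remaining edges carry affine interpolations.
  set c : Fin N.n → ℝ := fun v =>
    if v = N.src E then cubic 0 t p X 0 0 else cubic 0 t p X 0 (N.len E) with hc
  set f : N.Edge → ℝ → ℝ := fun E' => if E' = E then cubic 0 t p X 0 else
    cubic (c (N.src E')) 0 ((c (N.tgt E') - c (N.src E')) / N.len E') 0 0 with hf
  have hfE : f E = cubic 0 t p X 0 := by simp [hf]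
  have hcomp : Compatible c f := by
    intro E'
    by_cases h : E' = E
    · subst h
      rw [hfE]
      simp [hc, (src_ne_tgt E').symm]
    · have := (N.len_pos E').ne'
      have e : f E' = cubic (c (N.src E')) 0 ((c (N.tgt E') - c (N.src E')) / N.len E') 0 0 := by
        simp [hf, h]
      rw [e]
      refine ⟨cubic_self _ _ _ _ _, ?_⟩
      unfold cubic
      field_simp
      ring
  have hC2 : ∀ E', ContDiff ℝ 2 (f E') := by
    intro E'
    simp only [hf]
    split_ifs <;> exact contDiff_cubic _ _ _ _ _
  refine ⟨N.glue f, hcomp.isC2_glue hC2, fun s hs => ?_, fun ht => ?_⟩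
  · rw [hcomp.glue_param E hs, hfE]
  · rw [hcomp.dx_glue hC2 ht, hcomp.dxx_glue hC2 ht, hfE, deriv_cubic, iteratedDeriv_two_cubic,
      cubic_self, cubic_self]
    exact ⟨rfl, rfl⟩

end Network

end

/-! ### Duality, and the equation read along rays from a vertex -/

noncomputable section

namespace NetworkProblem

open Network

variable {d : ℕ} {N : Network d} (P : NetworkProblem N)

/-- The problem solved by `-u`. -/
def dual : NetworkProblem N where
  lam := P.lam
  a := P.a
  H E x p := -P.H E x (-p)
  F v r p := -P.F v (-r) fun E => -p E
  h v := -P.h v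

theorem dx_neg (φ : N.carrier → ℝ) (E : N.Edge) (t : ℝ) :
    N.dx (fun x => -φ x) E t = -N.dx φ E t := by
  unfold dx
  exact derivWithin.fun_neg

theorem dxx_neg (φ : N.carrier → ℝ) (E : N.Edge) (t : ℝ) :
    N.dxx (fun x => -φ x) E t = -N.dxx φ E t := by
  unfold dxx
  exact iteratedDerivWithin_fun_neg _

theorem IsC2.neg {φ : N.carrier → ℝ} (h : N.IsC2 φ) : N.IsC2 fun x => -φ x :=
  ⟨h.1.neg, fun E => (h.2 E).neg⟩

theorem inwardDeriv_neg (φ : N.carrier → ℝ) (v : Fin N.n) (E : N.Edge) :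
    N.inwardDeriv (fun x => -φ x) v E = -N.inwardDeriv φ v E := by
  unfold inwardDeriv
  simp only [dx_neg]
  split_ifs <;> ring

theorem GAt_dual (E : N.Edge) (r : ℝ) (φ : N.carrier → ℝ) (t : ℝ) :
    P.dual.GAt E (-r) φ t = -P.GAt E r (fun x => -φ x) t := by
  unfold GAt G dual
  simp only [dx_neg, dxx_neg]
  ring

variable {P}

/-- Through this, statements on subsolutions serve for supersolutions, as far as their hypotheses
survive `dual`; coercivity of the Hamiltonian does not. -/
theorem IsSupersolution.neg {w : N.carrier → ℝ} (h : P.IsSupersolution w) :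
    P.dual.IsSubsolution fun x => -w x := by
  have hloc : ∀ {φ : N.carrier → ℝ} {x}, IsLocalMax (fun x => -w x - φ x) x →
      IsLocalMin (fun x => w x - -φ x) x := fun {φ x} hm => by
    have : (fun x => w x - -φ x) = fun x => -(-w x - φ x) := by funext y; ring
    rw [this]
    exact hm.neg
  refine ⟨h.lsc.neg, fun φ hφ E t ht hm => ?_, fun φ hφ v hv hm => ?_, fun φ hφ v hv hm => ?_⟩
  · have := h.edge _ (IsC2.neg hφ) E t ht (hloc hm)
    rw [GAt_dual]
    linarith
  · rcases h.interior _ (IsC2.neg hφ) v hv (hloc hm) with ⟨E, hE⟩ | hF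
    · refine Or.inl ⟨E, ?_⟩
      rw [GAt_dual]
      linarith
    · right
      simp only [inwardDeriv_neg] at hF
      simp only [dual, neg_neg]
      linarith
  · rcases h.boundary _ (IsC2.neg hφ) v hv (hloc hm) with ⟨E, hE⟩ | hF
    · refine Or.inl ⟨E, ?_⟩
      rw [GAt_dual]
      linarith
    · right
      simp only [dual]
      linarith

variable (P)

/-- The diffusion coefficient on `E`, as a function of the distance to the end point `v`. -/
def rayA (v : Fin N.n) (E : N.Edge) (x : ℝ) : ℝ := P.a E (N.ray v E x)

/-- The Hamiltonian on `E`, seen from the end point `v`. -/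
def rayH (v : Fin N.n) (E : N.Edge) (x p : ℝ) : ℝ := P.H E (N.ray v E x) (N.orient v E * p)

theorem rayH_dual (v : Fin N.n) (E : N.Edge) : P.dual.rayH v E = dualHam (P.rayH v E) := by
  funext x p
  unfold rayH dualHam
  simp [dual]

theorem rayA_dual (v : Fin N.n) (E : N.Edge) : P.dual.rayA v E = P.rayA v E := rfl

theorem abs_orient (v : Fin N.n) (E : N.Edge) : |N.orient v E| = 1 := by
  unfold orient
  split_ifs <;> simp

variable {P}

theorem exists_isRegularEdge {E : N.Edge} (hH : HamiltonianRegular (N.closedEdge E) (P.H E))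
    (ha : DiffusionRegular (N.closedEdge E) (P.a E)) (v : Fin N.n) :
    ∃ C σ, IsRegularEdge (N.len E) C (P.rayA v E) σ (P.rayH v E) := by
  obtain ⟨C₁, hC₁, h1, h2⟩ := hH
  obtain ⟨σ, C₂, hC₂, h3, h4⟩ := ha
  have hm : ∀ x, (N.ray v E x : EuclideanSpace ℝ (Fin d)) ∈ N.closedEdge E :=
    fun x => N.coe_param_mem E _
  have hd : ∀ x ∈ Icc 0 (N.len E), ∀ y ∈ Icc 0 (N.len E),
      dist (N.ray v E x : EuclideanSpace ℝ (Fin d)) (N.ray v E y) = |x - y| :=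
    fun x hx y hy => dist_ray v E hx hy
  refine ⟨C₁ + C₂, fun x => σ (N.ray v E x), by positivity, fun x _ => h3 _ (hm x),
    fun x hx y hy => ?_, fun x hx y hy p => ?_, fun x hx p q => ?_⟩
  · have := h4 _ (hm x) _ (hm y)
    rw [hd x hx y hy] at this
    exact this.trans (mul_le_mul_of_nonneg_right (by linarith) (abs_nonneg _))
  · have := h1 _ (hm x) _ (hm y) (N.orient v E * p)
    rw [hd x hx y hy, abs_mul, abs_orient, one_mul] at this
    refine this.trans (mul_le_mul_of_nonneg_right (mul_le_mul_of_nonneg_right (by linarith) ?_)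
      (abs_nonneg _))
    positivity
  · have := h2 _ (hm x) (N.orient v E * p) (N.orient v E * q)
    rw [← mul_sub, abs_mul, abs_orient, one_mul] at this
    exact this.trans (mul_le_mul_of_nonneg_right (by linarith) (abs_nonneg _))

theorem continuous_rayA {E : N.Edge} (ha : DiffusionRegular (N.closedEdge E) (P.a E))
    (v : Fin N.n) : Continuous (P.rayA v E) := by
  obtain ⟨σ, C, hC, h1, h2⟩ := ha
  have hm : ∀ x, (N.ray v E x : EuclideanSpace ℝ (Fin d)) ∈ N.closedEdge E :=
    fun x => N.coe_param_mem E _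
  have hσ : ContinuousOn σ (N.closedEdge E) := by
    refine (LipschitzOnWith.of_dist_le_mul (K := ⟨C, hC.le⟩) fun x hx y hy => ?_).continuousOn
    rw [Real.dist_eq]; exact h2 x hx y hy
  have : P.rayA v E = fun x => σ (N.ray v E x) ^ 2 := funext fun x => h1 _ (hm x)
  rw [this]
  have hc : Continuous fun x => σ (N.ray v E x) :=
    hσ.comp_continuous (continuous_subtype_val.comp (continuous_ray v E)) hm
  exact hc.pow 2

theorem continuous_rayH {E : N.Edge} (hH : HamiltonianRegular (N.closedEdge E) (P.H E))
    (v : Fin N.n) : Continuous fun z : ℝ × ℝ => P.rayH v E z.1 z.2 := by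
  obtain ⟨C, hC, h1, h2⟩ := hH
  have hm : ∀ x, (N.ray v E x : EuclideanSpace ℝ (Fin d)) ∈ N.closedEdge E :=
    fun x => N.coe_param_mem E _
  rw [continuous_iff_continuousAt]
  rintro ⟨x, p⟩
  have hray : Continuous fun z : ℝ × ℝ => (N.ray v E z.1 : EuclideanSpace ℝ (Fin d)) :=
    continuous_subtype_val.comp ((continuous_ray v E).comp continuous_fst)
  have hb : Tendsto (fun z : ℝ × ℝ => C * |N.orient v E * z.2 - N.orient v E * p| +
      C * (1 + |N.orient v E * p|) * dist (N.ray v E z.1 : EuclideanSpace ℝ (Fin d))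
        (N.ray v E x)) (𝓝 (x, p)) (𝓝 0) := by
    have hc : Continuous (fun z : ℝ × ℝ => C * |N.orient v E * z.2 - N.orient v E * p| +
      C * (1 + |N.orient v E * p|) * dist (N.ray v E z.1 : EuclideanSpace ℝ (Fin d))
        (N.ray v E x)) := by
      have := hray.dist (continuous_const (y := (N.ray v E x : EuclideanSpace ℝ (Fin d))))
      fun_prop
    simpa using hc.tendsto (x, p)
  rw [ContinuousAt, tendsto_iff_dist_tendsto_zero]
  refine squeeze_zero (fun _ => dist_nonneg) (fun z => ?_) hb
  have e1 := h2 _ (hm z.1) (N.orient v E * z.2) (N.orient v E * p)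
  have e2 := h1 _ (hm z.1) _ (hm x) (N.orient v E * p)
  rw [Real.dist_eq]
  unfold rayH
  exact (abs_sub_le _ (P.H E (N.ray v E z.1) (N.orient v E * p)) _).trans (add_le_add e1 e2)

theorem upperSemicontinuous_ray {u : N.carrier → ℝ} (hu : UpperSemicontinuous u) (v : Fin N.n)
    (E : N.Edge) : UpperSemicontinuous fun x => u (N.ray v E x) :=
  hu.comp (continuous_ray v E)

/-- Subsolutions on the network are subsolutions on each edge. -/
theorem IsSubsolution.isEdgeSub {u : N.carrier → ℝ} (h : P.IsSubsolution u) (v : Fin N.n)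
    (E : N.Edge) : IsEdgeSub P.lam (P.rayA v E) (P.rayH v E) (Ioo 0 (N.len E))
      fun x => u (N.ray v E x) := by
  intro x hx p X hj
  have ht := inw_mem_Ioo (v := v) hx
  set t := N.inw v E x with htdef
  obtain ⟨φ, hφ, hval, hder⟩ := exists_edge_test E t (N.orient v E * p) X
  have ht' : t ∈ Icc 0 (N.len E) := ⟨ht.1.le, ht.2.le⟩
  have hmax : IsLocalMax (fun y => u y - φ y) (N.param E t) := by
    refine N.eventually_nhds_param ht ?_
    have htend : Tendsto (N.inw v E) (𝓝 t) (𝓝 x) := by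
      have := (continuous_inw v E).tendsto t
      rwa [htdef, inw_inw] at this
    filter_upwards [htend.eventually hj, Icc_mem_nhds ht.1 ht.2] with s hs hs'
    rw [hval s hs', hval t ht', cubic_self]
    simp only [ray_inw] at hs
    have e1 : u (N.ray v E x) = u (N.param E t) := rfl
    rw [e1] at hs
    -- Reversing an edge changes the sign of slopes but not of second derivatives, the orientation
    -- having square 1.
    have e2 : N.inw v E s - x = N.orient v E * (s - t) := by
      rw [htdef]
      unfold inw orient
      split_ifs <;> ring
    rw [e2, mul_pow, sq (N.orient v E), orient_mul_self] at hs
    unfold cubic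
    linarith
  have := h.edge φ hφ E t ht hmax
  unfold GAt G at this
  rw [(hder ht').1, (hder ht').2] at this
  exact this

/-- Common part of the test function arguments at a vertex. -/
theorem exists_vertex_test_isLocalMax {u : N.carrier → ℝ} (v : Fin N.n)
    (s k p : N.Inc v → ℝ) (hp : ∀ E, p E < s E)
    (hu : ∀ E : N.Inc v, ∀ᶠ x in 𝓝[>] (0 : ℝ), u (N.ray v E x) ≤ u (N.vertex v) + p E * x) :
    ∃ φ, N.IsC2 φ ∧ IsLocalMax (fun y => u y - φ y) (N.vertex v) ∧
      (fun E : N.Inc v => N.inwardDeriv φ v E) = s ∧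
      ∀ (E : N.Inc v) (r : ℝ), P.GAt E r φ (N.coord v E) =
        P.lam * r - P.rayA v E 0 * k E + P.rayH v E 0 (s E) := by
  obtain ⟨φ, hφ, h0, hval, hdx, hdxx⟩ := exists_vertex_test v s k
  refine ⟨φ, hφ, ?_, ?_, fun E r => ?_⟩
  · refine eventually_nhds_vertex le_rfl fun E => ?_
    filter_upwards [hu E, eventually_le_endCubic (N.len E.1) (hp E) (k E),
      Ioo_mem_nhdsGT (N.len_pos E.1)] with x h1 h2 h3
    rw [h0, hval E x ⟨h3.1.le, h3.2.le⟩]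
    linarith
  · funext E
    rw [inwardDeriv_eq, hdx E, ← mul_assoc, orient_mul_self, one_mul]
  · unfold GAt G rayA rayH ray
    rw [hdx E, hdxx E, inw_zero]

/-- Slopes strictly above the growth rates `p` of `u` are admissible test slopes with arbitrary
second derivatives, so the vertex condition can be used through numbers alone. -/
theorem IsSubsolution.interior_jet {u : N.carrier → ℝ} (h : P.IsSubsolution u) {v : Fin N.n}
    (hv : N.IsInterior v) (s k p : N.Inc v → ℝ) (hp : ∀ E, p E < s E)
    (hu : ∀ E : N.Inc v, ∀ᶠ x in 𝓝[>] (0 : ℝ), u (N.ray v E x) ≤ u (N.vertex v) + p E * x) :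
    (∃ E : N.Inc v, P.lam * u (N.vertex v) - P.rayA v E 0 * k E + P.rayH v E 0 (s E) ≤ 0) ∨
      P.F v (u (N.vertex v)) s ≤ 0 := by
  obtain ⟨φ, hφ, hmax, hs, hG⟩ := exists_vertex_test_isLocalMax (P := P) v s k p hp hu
  have := h.interior φ hφ v hv hmax
  simpa only [hG, hs] using this

theorem IsSubsolution.boundary_jet {u : N.carrier → ℝ} (h : P.IsSubsolution u) {v : Fin N.n}
    (hv : N.IsBoundary v) (s k p : N.Inc v → ℝ) (hp : ∀ E, p E < s E)
    (hu : ∀ E : N.Inc v, ∀ᶠ x in 𝓝[>] (0 : ℝ), u (N.ray v E x) ≤ u (N.vertex v) + p E * x) :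
    (∃ E : N.Inc v, P.lam * u (N.vertex v) - P.rayA v E 0 * k E + P.rayH v E 0 (s E) ≤ 0) ∨
      u (N.vertex v) ≤ P.h v := by
  obtain ⟨φ, hφ, hmax, hs, hG⟩ := exists_vertex_test_isLocalMax (P := P) v s k p hp hu
  have := h.boundary φ hφ v hv hmax
  simpa only [hG, sub_nonpos] using this

end NetworkProblem

end

/-! ### Barriers and Lipschitz bounds at vertices -/

noncomputable section

theorem HasBarrierWith.mono_const {a : ℝ → ℝ} {H : ℝ → ℝ → ℝ} {s : Set ℝ} {m k C₁ C₂ : ℝ}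
    (h : HasBarrierWith a H s m k C₁) (hC : C₁ ≤ C₂) : HasBarrierWith a H s m k C₂ :=
  ⟨h.1, h.2.1.trans hC, fun C h1 => h.2.2 C (hC.trans h1)⟩

/-- Continuity keeps the diffusion above `a 0 / 2` near the end point. No coercivity is involved, so
the lemma also applies to the dual Hamiltonian. -/
theorem exists_hasBarrierWith_of_pos {ℓ C : ℝ} {a σ : ℝ → ℝ} {H : ℝ → ℝ → ℝ}
    (hreg : IsRegularEdge ℓ C a σ H) (hℓ : 0 < ℓ) (ha : Continuous a) (h0 : 0 < a 0) (m : ℝ) :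
    ∃ δ > 0, δ ≤ ℓ ∧ ∃ k C₁, HasBarrierWith a H (Icc 0 δ) m k C₁ := by
  have h1 : ∀ᶠ x in 𝓝 (0 : ℝ), a 0 / 2 < a x := (ha.tendsto 0).eventually_const_lt (by linarith)
  obtain ⟨r, hr, hball⟩ := Metric.eventually_nhds_iff.1 h1
  refine ⟨min (r / 2) ℓ, by positivity, min_le_right _ _, ?_⟩
  have hsub : ∀ t ∈ Icc 0 (min (r / 2) ℓ), t ∈ Icc 0 ℓ := fun t ht =>
    ⟨ht.1, ht.2.trans (min_le_right _ _)⟩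
  refine hasBarrierWith_of_elliptic m (half_pos h0) ?_ (fun t ht => (hball ?_).le)
    fun t ht => hreg.neg_le_ham (hsub t ht)
  · have := hreg.nonneg; positivity
  · rw [Real.dist_eq, sub_zero, abs_of_nonneg ht.1]
    have := ht.2.trans (min_le_left _ _)
    linarith

namespace NetworkProblem

open Network

variable {d : ℕ} {N : Network d}

/-- The standing assumptions on the data. -/
structure Standing (P : NetworkProblem N) : Prop where
  lam_pos : 0 < P.lam
  ham : ∀ E : N.Edge, HamiltonianRegular (N.closedEdge E) (P.H E)
  diffusion : ∀ E : N.Edge, DiffusionRegular (N.closedEdge E) (P.a E)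
  kirchhoff : ∀ v : Fin N.n, N.IsInterior v → KirchhoffFunction (P.F v)
  deg : ∀ (v : Fin N.n) (E : N.Inc v),
    (∃ δ > 0, HamiltonianCoercive (N.closedEdge E ∩ Metric.ball (N.vert v) δ) (P.H E)) ∨
      0 < P.a E (N.vert v)
  coercive : ∀ v : Fin N.n, N.IsInterior v → KirchhoffCoercive (P.F v)

variable {P : NetworkProblem N}

theorem rayA_zero (v : Fin N.n) (E : N.Inc v) : P.rayA v E.1 0 = P.a E.1 (N.vert v) := by
  unfold rayA
  rw [ray_zero]; rfl

/-- Coercivity near the end point, in terms of the distance to it. -/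
theorem ray_coercive {v : Fin N.n} {E : N.Inc v} {δ : ℝ} (hδ : 0 < δ)
    (h : HamiltonianCoercive (N.closedEdge E.1 ∩ Metric.ball (N.vert v) δ) (P.H E.1)) :
    ∃ r > 0, r ≤ N.len E.1 ∧ ∃ C > 0, ∀ t ∈ Icc 0 r, ∀ p, C⁻¹ * |p| - C ≤ P.rayH v E.1 t p := by
  obtain ⟨C, hC, h⟩ := h
  have hl := N.len_pos E.1
  refine ⟨min (δ / 2) (N.len E.1), by positivity, min_le_right _ _, C, hC, fun t ht p => ?_⟩
  have h1 : t ≤ δ / 2 := ht.2.trans (min_le_left _ _)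
  have h2 : t ≤ N.len E.1 := ht.2.trans (min_le_right _ _)
  have hd := dist_ray v E.1 (⟨ht.1, h2⟩ : t ∈ Icc 0 (N.len E.1)) ⟨le_rfl, hl.le⟩
  rw [ray_zero, sub_zero, abs_of_nonneg ht.1, Subtype.dist_eq] at hd
  have := h (N.ray v E.1 t) ⟨N.coe_param_mem E.1 _, by
    rw [Metric.mem_ball]
    change dist (N.ray v E.1 t : EuclideanSpace ℝ (Fin d)) (N.vertex v) < δ
    rw [hd]; linarith⟩ (N.orient v E.1 * p)
  rw [abs_mul, abs_orient, one_mul] at this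
  exact this

theorem Standing.exists_edge_barrier (hP : P.Standing) (v : Fin N.n) (E : N.Inc v) (m : ℝ) :
    ∃ δ > 0, δ ≤ N.len E.1 ∧
      ∃ k C₁, HasBarrierWith (P.rayA v E.1) (P.rayH v E.1) (Icc 0 δ) m k C₁ := by
  obtain ⟨C, σ, hreg⟩ := exists_isRegularEdge (hP.ham E.1) (hP.diffusion E.1) v
  rcases hP.deg v E with ⟨δ, hδ, h⟩ | h
  · obtain ⟨r, hr, hrl, C, hC, hco⟩ := ray_coercive hδ h
    refine ⟨r, hr, hrl, hasBarrierWith_of_coercive m hC (fun t ht => ?_) hco⟩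
    exact hreg.diffusion_nonneg ⟨ht.1, ht.2.trans hrl⟩
  · refine exists_hasBarrierWith_of_pos hreg (N.len_pos E.1)
      (continuous_rayA (hP.diffusion E.1) v) ?_ m
    rwa [rayA_zero]

/-- Barriers on all edges incident to `v`, in a common neighborhood. -/
theorem exists_vertex_barrier_of_edge {v : Fin N.n} {m : ℝ} (h : ∀ E : N.Inc v,
    ∃ δ > 0, δ ≤ N.len E.1 ∧
      ∃ k C₁, HasBarrierWith (P.rayA v E.1) (P.rayH v E.1) (Icc 0 δ) m k C₁) :
    ∃ δ > 0, ∃ k : N.Inc v → ℝ, ∃ C₁, 1 ≤ C₁ ∧ ∀ E : N.Inc v, δ ≤ N.len E.1 ∧ 4 * k E * δ ≤ 1 ∧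
      HasBarrierWith (P.rayA v E.1) (P.rayH v E.1) (Icc 0 δ) m (k E) C₁ := by
  choose δ hδ hδl k C₁ hb using h
  have h1 : ∀ᶠ r in 𝓝[>] (0 : ℝ), ∀ E, r < δ E ∧ r < 1 / (4 * k E) :=
    eventually_all.2 fun E => by
      have hk := (hb E).1
      filter_upwards [Ioo_mem_nhdsGT (hδ E), Ioo_mem_nhdsGT (by positivity : 0 < 1 / (4 * k E))]
        with r h1 h2 using ⟨h1.2, h2.2⟩
  obtain ⟨r, h1, hr⟩ := (h1.and self_mem_nhdsWithin).exists
  have hr : 0 < r := hr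
  have h2 : ∀ᶠ C in atTop, ∀ E, C₁ E ≤ C := eventually_all.2 fun E => eventually_ge_atTop _
  obtain ⟨C, h2, hC1⟩ := (h2.and (eventually_ge_atTop 1)).exists
  refine ⟨r, hr, k, C, hC1, fun E => ⟨(h1 E).1.le.trans (hδl E), ?_,
    ((hb E).mono (Icc_subset_Icc_right (h1 E).1.le)).mono_const (h2 E)⟩⟩
  have h3 := (h1 E).2
  have hk := (hb E).1
  rw [lt_div_iff₀ (by positivity)] at h3
  linarith

theorem Standing.exists_vertex_barrier (hP : P.Standing) (v : Fin N.n) (m : ℝ) :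
    ∃ δ > 0, ∃ k : N.Inc v → ℝ, ∃ C₁, 1 ≤ C₁ ∧ ∀ E : N.Inc v, δ ≤ N.len E.1 ∧ 4 * k E * δ ≤ 1 ∧
      HasBarrierWith (P.rayA v E.1) (P.rayH v E.1) (Icc 0 δ) m (k E) C₁ :=
  exists_vertex_barrier_of_edge fun E => hP.exists_edge_barrier v E m

section Sub

variable {u : N.carrier → ℝ} {M δ C₁ : ℝ} {v : Fin N.n} {k : N.Inc v → ℝ}

theorem IsSubsolution.vertex_upper (h : P.IsSubsolution u) (hlam : 0 ≤ P.lam)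
    (hM : ∀ x, |u x| ≤ M) (hδ : 0 < δ) {E : N.Inc v} (hδl : δ ≤ N.len E.1)
    (hk : 4 * k E * δ ≤ 1)
    (hb : HasBarrierWith (P.rayA v E.1) (P.rayH v E.1) (Icc 0 δ) (P.lam * M) (k E) C₁)
    {C : ℝ} (hC : C₁ ≤ C) (hCM : 2 * M ≤ 3 / 4 * C * δ) :
    ∀ x ∈ Icc 0 δ, u (N.ray v E.1 x) ≤ u (N.vertex v) + C * x := by
  intro x hx
  have := ((h.isEdgeSub v E.1).mono (Ioo_subset_Ioo_right hδl)).le_right_of_bounded hlam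
    (upperSemicontinuous_ray h.usc v E.1) (fun t => hM _) (hb.mono Ioo_subset_Icc_self) hδ hC
    (by simpa using hk) (by simpa using hCM) x hx
  simpa [ray_zero] using this

/-- A test function at the vertex with steep slope `s` and second derivative `-2 k |s|` violates the
edge equation, leaving only the Kirchhoff or Dirichlet alternative. -/
theorem barrier_pos {a : ℝ → ℝ} {H : ℝ → ℝ → ℝ} {L r k s : ℝ} (hL : 0 ≤ L) (hr : |r| ≤ M)
    (hδ : 0 ≤ δ) (hb : HasBarrierWith a H (Icc 0 δ) (L * M) k C₁) (hs : C₁ ≤ |s|) :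
    0 < L * r - a 0 * -(2 * k * |s|) + H 0 s := by
  have h1 := hb.2.2 |s| hs 0 ⟨le_rfl, hδ⟩ s (by linarith [abs_nonneg s]) le_rfl
  have h2 : L * (-M) ≤ L * r := mul_le_mul_of_nonneg_left (abs_le.1 hr).1 hL
  linarith

/-- Subsolutions satisfy the Dirichlet condition. -/
theorem IsSubsolution.le_boundary (h : P.IsSubsolution u) (hlam : 0 ≤ P.lam)
    (hM : ∀ x, |u x| ≤ M) (hv : N.IsBoundary v) (hδ : 0 < δ) (hC₁ : 1 ≤ C₁)
    (hb : ∀ E : N.Inc v, δ ≤ N.len E.1 ∧ 4 * k E * δ ≤ 1 ∧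
      HasBarrierWith (P.rayA v E.1) (P.rayH v E.1) (Icc 0 δ) (P.lam * M) (k E) C₁) :
    u (N.vertex v) ≤ P.h v := by
  have hM0 : 0 ≤ M := (abs_nonneg _).trans (hM (N.vertex v))
  -- Large enough that `3 / 4 * C * δ` exceeds `2 * M`, the largest possible oscillation of `u`.
  set C := C₁ + 8 / 3 * M / δ with hC
  have hCM : 2 * M ≤ 3 / 4 * C * δ := by
    have : 3 / 4 * C * δ = 3 / 4 * C₁ * δ + 2 * M := by rw [hC]; field_simp; ring
    rw [this]
    have : 0 ≤ 3 / 4 * C₁ * δ := by positivity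
    linarith
  have hCC : C₁ ≤ C := by
    have : 0 ≤ 8 / 3 * M / δ := by positivity
    linarith
  rcases h.boundary_jet hv (fun _ => C + 1) (fun E => -(2 * k E * |C + 1|)) (fun _ => C)
    (fun _ => by linarith) (fun E => by
      filter_upwards [Ioo_mem_nhdsGT hδ] with x hx
      exact h.vertex_upper hlam hM hδ (hb E).1 (hb E).2.1 (hb E).2.2 hCC hCM x
        ⟨hx.1.le, hx.2.le⟩) with ⟨E, hE⟩ | h1
  · have := barrier_pos (s := C + 1) hlam (hM (N.vertex v)) hδ.le (hb E).2.2
      (by rw [abs_of_nonneg (by linarith)]; linarith)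
    linarith
  · exact h1

/-- Subsolutions are Lipschitz at interior vertices. -/
theorem IsSubsolution.vertex_lipschitz (h : P.IsSubsolution u) (hlam : 0 ≤ P.lam)
    (hM : ∀ x, |u x| ≤ M) (hv : N.IsInterior v) (hF : KirchhoffFunction (P.F v)) (hδ : 0 < δ)
    (hC₁ : 1 ≤ C₁) (hb : ∀ E : N.Inc v, δ ≤ N.len E.1 ∧ 4 * k E * δ ≤ 1 ∧
      HasBarrierWith (P.rayA v E.1) (P.rayH v E.1) (Icc 0 δ) (P.lam * M) (k E) C₁) :
    ∃ C, 0 ≤ C ∧ ∀ E : N.Inc v, ∀ x ∈ Icc 0 δ,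
      |u (N.ray v E.1 x) - u (N.vertex v)| ≤ C * x := by
  have hM0 : 0 ≤ M := (abs_nonneg _).trans (hM (N.vertex v))
  set C := C₁ + 8 / 3 * M / δ with hC
  have hCM : 2 * M ≤ 3 / 4 * C * δ := by
    have : 3 / 4 * C * δ = 3 / 4 * C₁ * δ + 2 * M := by rw [hC]; field_simp; ring
    rw [this]
    have : 0 ≤ 3 / 4 * C₁ * δ := by positivity
    linarith
  have hCC : C₁ ≤ C := by
    have : 0 ≤ 8 / 3 * M / δ := by positivity
    linarith
  have hup : ∀ E : N.Inc v, ∀ x ∈ Icc 0 δ, u (N.ray v E.1 x) ≤ u (N.vertex v) + C * x := fun E =>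
    h.vertex_upper hlam hM hδ (hb E).1 (hb E).2.1 (hb E).2.2 hCC hCM
  -- Since `-M ≤ u v`, monotonicity in the value makes this `D` work for the actual value of `u` at
  -- the vertex.
  have hlarge : ∀ᶠ D in atTop, ∀ E : N.Inc v,
      0 < P.F v (-M) (Function.update (fun _ => C + 1) E (-D)) := eventually_all.2 fun E => by
    have := (hF.tendsto_atTop E (-M) (fun _ => C + 1)).comp tendsto_neg_atTop_atBot
    exact this.eventually_gt_atTop 0
  obtain ⟨D, hD, hDC⟩ := (hlarge.and (eventually_ge_atTop C)).exists
  refine ⟨3 * D, by linarith, fun E x hx => ?_⟩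
  have hxu := hup E x hx
  have hCx : C * x ≤ 3 * D * x := mul_le_mul_of_nonneg_right (by linarith) hx.1
  refine abs_le.2 ⟨?_, by linarith⟩
  by_contra! hlt
  have hx0 : 0 < x := by
    rcases hx.1.eq_or_lt with h0 | h0
    · rw [← h0, ray_zero] at hlt; linarith
    · exact h0
  have hray0 : N.ray v E.1 0 = N.vertex v := ray_zero v E
  -- A drop of more than `3 D x` at distance `x` makes `u` descend at rate at least `2 D` from the
  -- vertex along `E`. Slopes `-D` on `E` and `C + 1` on the other edges are then admissible, and
  -- the Kirchhoff function is positive there.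
  have hdown := ((h.isEdgeSub v E.1).mono (Ioo_subset_Ioo_right (hx.2.trans (hb E).1))).le_right_neg
    hlam (upperSemicontinuous_ray h.usc v E.1) (fun t => hM _)
    ((hb E).2.2.mono (Ioo_subset_Icc_self.trans (Icc_subset_Icc_right hx.2)))
    (C := 4 * D) (by linarith) hx.1
    (by
      have hk := (hb E).2.2.1
      have : 4 * k E * (x - 0) ≤ 4 * k E * δ :=
        mul_le_mul_of_nonneg_left (by linarith [hx.2]) (by positivity)
      linarith [(hb E).2.1])
    (by rw [hray0]; linarith)
  simp only [hray0, sub_zero] at hdown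
  rcases h.interior_jet hv (Function.update (fun _ => C + 1) E (-D))
    (fun E' => -(2 * k E' * |Function.update (fun _ => C + 1) E (-D) E'|))
    (Function.update (fun _ => C) E (-(2 * D)))
    (fun E' => by
      by_cases he : E' = E
      · subst he; simp only [Function.update_self]; linarith
      · simp only [Function.update_of_ne he]; linarith)
    (fun E' => by
      by_cases he : E' = E
      · subst he
        simp only [Function.update_self]
        filter_upwards [Ioo_mem_nhdsGT hx0] with y hy
        have := hdown y ⟨hy.1.le, hy.2.le⟩
        linarith
      · simp only [Function.update_of_ne he]
        filter_upwards [Ioo_mem_nhdsGT hδ] with y hy using hup E' y ⟨hy.1.le, hy.2.le⟩)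
    with ⟨E', hE'⟩ | h1
  · have := barrier_pos (s := Function.update (fun _ => C + 1) E (-D) E') hlam (hM (N.vertex v))
      hδ.le (hb E').2.2 (by
        by_cases he : E' = E
        · subst he
          rw [Function.update_self, abs_neg, abs_of_nonneg (by linarith)]; linarith
        · rw [Function.update_of_ne he, abs_of_nonneg (by linarith)]; linarith)
    linarith
  · have := hF.mono (u (N.vertex v)) (-M) _ _ (abs_le.1 (hM (N.vertex v))).1
      (fun i => le_refl (Function.update (fun _ => C + 1) E (-D) i))
    linarith [hD E]

end Sub

end NetworkProblem

end

/-! ### The comparison principle -/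

noncomputable section

namespace Network

variable {d : ℕ} (N : Network d)

/-- A function with inward slope `1` at all vertices, concave on each edge. -/
def bump : N.carrier → ℝ := N.glue fun E t => t * (N.len E - t) / N.len E

variable {N}

theorem compatible_bump :
    Compatible (N := N) (fun _ => 0) fun E t => t * (N.len E - t) / N.len E := fun E => by
  simp

theorem contDiff_bump (E : N.Edge) : ContDiff ℝ 2 fun t : ℝ => t * (N.len E - t) / N.len E := by
  fun_prop

theorem isC2_bump : N.IsC2 N.bump := compatible_bump.isC2_glue contDiff_bump

theorem bump_vertex (v : Fin N.n) : N.bump (N.vertex v) = 0 := compatible_bump.glue_vertex v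

theorem bump_param (E : N.Edge) {t : ℝ} (ht : t ∈ Icc 0 (N.len E)) :
    N.bump (N.param E t) = t * (N.len E - t) / N.len E := compatible_bump.glue_param E ht

theorem bump_ray (v : Fin N.n) (E : N.Edge) {x : ℝ} (hx : x ∈ Icc 0 (N.len E)) :
    N.bump (N.ray v E x) = x * (N.len E - x) / N.len E := by
  unfold ray
  rw [bump_param E (inw_mem_Icc hx)]
  unfold inw
  split_ifs
  · rfl
  · ring

theorem bump_nonneg (x : N.carrier) : 0 ≤ N.bump x := by
  obtain ⟨E, t, ht, rfl⟩ := N.exists_param x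
  rw [bump_param E ht]
  exact div_nonneg (mul_nonneg ht.1 (by linarith [ht.2])) (N.len_pos E).le

theorem exists_bump_le : ∃ K, ∀ x, N.bump x ≤ K := by
  obtain ⟨K, hK⟩ := (isCompact_range (isC2_bump (N := N)).1).bddAbove
  exact ⟨K, fun x => hK (mem_range_self x)⟩

theorem nonempty_inc (v : Fin N.n) : Nonempty (N.Inc v) := by
  obtain ⟨e, he, h⟩ := N.exists_incident v
  exact ⟨⟨⟨e, he⟩, h⟩⟩

theorem isBoundary_or_isInterior (v : Fin N.n) : N.IsBoundary v ∨ N.IsInterior v := by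
  have := nonempty_inc v
  have : 0 < Nat.card (N.Inc v) := Nat.card_pos
  unfold IsBoundary IsInterior
  omega

theorem IsBoundary.subsingleton {v : Fin N.n} (h : N.IsBoundary v) : Subsingleton (N.Inc v) :=
  (Nat.card_eq_one_iff_unique.1 h).1

theorem IsBoundary.not_isInterior {v : Fin N.n} (h : N.IsBoundary v) : ¬ N.IsInterior v := by
  unfold IsBoundary at h
  unfold IsInterior
  omega

/-- Every point of the network is a vertex or an interior point of an edge. -/
theorem vertex_or_param (x : N.carrier) :
    (∃ v, x = N.vertex v) ∨ ∃ E, ∃ t ∈ Ioo 0 (N.len E), x = N.param E t := by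
  obtain ⟨E, t, ht, rfl⟩ := N.exists_param x
  rcases ht.1.eq_or_lt with h0 | h0
  · exact Or.inl ⟨_, h0 ▸ N.param_zero E⟩
  rcases ht.2.eq_or_lt with h1 | h1
  · exact Or.inl ⟨_, h1 ▸ N.param_len E⟩
  exact Or.inr ⟨E, t, ⟨h0, h1⟩, rfl⟩

theorem ray_src (E : N.Edge) (x : ℝ) : N.ray (N.src E) E x = N.param E x := by
  unfold ray inw
  rw [if_pos rfl]

end Network

namespace NetworkProblem

open Network

variable {d : ℕ} {N : Network d} {P : NetworkProblem N} {u w : N.carrier → ℝ} {M η : ℝ}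
  {v : Fin N.n}

/-- The slopes of `exists_separating_slopes` at a vertex of the network. -/
theorem Standing.exists_vertex_slopes (hP : P.Standing) (hu : P.IsSubsolution u)
    (hw : P.IsSupersolution w) (hη : 0 < η) (hlt : w (N.vertex v) < u (N.vertex v))
    (hmax : ∀ y, u y + η * N.bump y - w y ≤ u (N.vertex v) - w (N.vertex v)) (E : N.Inc v)
    {C : ℝ} (hC : ∀ᶠ x in 𝓝[>] (0 : ℝ), |u (N.ray v E.1 x) - u (N.vertex v)| ≤ C * x) :
    ∃ p s₁ s₂ q k₁ k₂, p < s₁ ∧ s₁ < s₂ ∧ s₂ < q ∧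
      (∀ᶠ x in 𝓝[>] (0 : ℝ), u (N.ray v E.1 x) ≤ u (N.vertex v) + p * x) ∧
      (∀ᶠ x in 𝓝[>] (0 : ℝ), w (N.vertex v) + q * x ≤ w (N.ray v E.1 x)) ∧
      0 < P.lam * u (N.vertex v) - P.rayA v E.1 0 * k₁ + P.rayH v E.1 0 s₁ ∧
      P.lam * w (N.vertex v) - P.rayA v E.1 0 * k₂ + P.rayH v E.1 0 s₂ < 0 := by
  obtain ⟨D, σ, hreg⟩ := exists_isRegularEdge (hP.ham E.1) (hP.diffusion E.1) v
  have hl := N.len_pos E.1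
  have h0 : N.ray v E.1 0 = N.vertex v := ray_zero v E
  have hws := hw.neg.isEdgeSub v E.1
  rw [rayH_dual, rayA_dual] at hws
  -- On the first half of the edge `bump` is at least `x / 2`, so the gap in slopes is `η / 2`.
  have := exists_separating_slopes (L := P.lam) (η := η / 2) (C := C) hl hP.lam_pos
    (half_pos hη) (hu.isEdgeSub v E.1) (upperSemicontinuous_ray hu.usc v E.1)
    (w := fun x => w (N.ray v E.1 x)) hws (upperSemicontinuous_ray hw.neg.usc v E.1)
    (continuous_rayH (hP.ham E.1) v) (continuous_rayA (hP.diffusion E.1) v)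
    (by simpa only [h0] using hlt) ?_ (by simpa only [h0] using hC) ?_
  · simpa only [h0] using this
  · simp only [h0]
    filter_upwards [Ioo_mem_nhdsGT (half_pos hl)] with x hx
    have h1 := hmax (N.ray v E.1 x)
    rw [bump_ray v E.1 ⟨hx.1.le, by linarith [hx.2]⟩] at h1
    have h2 : x / 2 ≤ x * (N.len E.1 - x) / N.len E.1 := by
      rw [le_div_iff₀ hl]
      nlinarith [hx.1, hx.2]
    have := mul_le_mul_of_nonneg_left h2 hη.le
    linarith
  · rcases (hreg.diffusion_nonneg ⟨le_rfl, hl.le⟩).eq_or_lt with ha | ha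
    · left
      refine ⟨ha.symm, ⟨D ^ 2, fun t ht => ⟨hreg.diffusion_nonneg ⟨ht.1.le, ht.2.le⟩,
        hreg.diffusion_le_sq ha.symm ⟨ht.1.le, ht.2.le⟩⟩⟩, ?_⟩
      rcases hP.deg v E with ⟨δ, hδ, h⟩ | h
      · obtain ⟨r, hr, -, c, hc, hco⟩ := ray_coercive hδ h
        refine ⟨c * (c + |P.lam * u (N.vertex v)| + 1), fun q hq => ?_⟩
        have h1 := hco 0 ⟨le_rfl, hr.le⟩ q
        have h2 : c + |P.lam * u (N.vertex v)| + 1 ≤ c⁻¹ * |q| := by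
          rw [inv_mul_eq_div, le_div_iff₀ hc]
          linarith [le_abs_self q]
        have h3 := neg_abs_le (P.lam * u (N.vertex v))
        simp only [h0]
        linarith
      · rw [← rayA_zero] at h
        exact absurd ha h.ne
    · exact Or.inr ha

theorem dual_jet_neg {E : N.Inc v} {k s : ℝ} :
    P.dual.lam * -w (N.vertex v) - P.dual.rayA v E.1 0 * -k + P.dual.rayH v E.1 0 (-s) =
      -(P.lam * w (N.vertex v) - P.rayA v E.1 0 * k + P.rayH v E.1 0 s) := by
  rw [rayH_dual, rayA_dual]
  simp only [dualHam, neg_neg, dual]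
  ring

/-- Strict violation of every edge equation forces the Kirchhoff inequalities for `u` at `s₁` and
for `w` at `s₂`; they are incompatible as `s₁ < s₂` and `w v < u v`. -/
theorem Standing.not_max_at_interior_vertex (hP : P.Standing) (hu : P.IsSubsolution u)
    (hw : P.IsSupersolution w) (hM : ∀ x, |u x| ≤ M) (hv : N.IsInterior v) (hη : 0 < η)
    (hlt : w (N.vertex v) < u (N.vertex v))
    (hmax : ∀ y, u y + η * N.bump y - w y ≤ u (N.vertex v) - w (N.vertex v)) : False := by
  obtain ⟨δ, hδ, k, C₁, hC₁, hb⟩ := hP.exists_vertex_barrier v (P.lam * M)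
  have hF := hP.kirchhoff v hv
  obtain ⟨C, -, hC⟩ := hu.vertex_lipschitz hP.lam_pos.le hM hv hF hδ hC₁ hb
  choose p s₁ s₂ q k₁ k₂ h1 h2 h3 h4 h5 h6 h7 using fun E : N.Inc v =>
    hP.exists_vertex_slopes hu hw hη hlt hmax E (C := C) (by
      filter_upwards [Ioo_mem_nhdsGT hδ] with x hx using hC E x ⟨hx.1.le, hx.2.le⟩)
  have hFu : P.F v (u (N.vertex v)) s₁ ≤ 0 := by
    rcases hu.interior_jet hv s₁ k₁ p h1 h4 with ⟨E, hE⟩ | h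
    · linarith [h6 E]
    · exact h
  have hFw : 0 ≤ P.F v (w (N.vertex v)) s₂ := by
    rcases hw.neg.interior_jet hv (fun E => -s₂ E) (fun E => -k₂ E) (fun E => -q E)
      (fun E => neg_lt_neg (h3 E)) (fun E => by
        filter_upwards [h5 E] with x hx
        linarith) with ⟨E, hE⟩ | h
    · rw [dual_jet_neg] at hE
      linarith [h7 E]
    · simp only [dual, neg_neg] at h
      linarith
  have := hF.strictMono (u (N.vertex v)) (w (N.vertex v)) s₁ s₂ hlt.le (fun i => (h2 i).le)
    ⟨(nonempty_inc v).some, h2 _⟩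
  linarith

/-- The subsolution takes the Dirichlet condition pointwise. The supersolution need not in general,
since coercivity acts in one direction only. In the degenerate case its boundary inequality follows
at this maximum point from separating slopes, for which `hlim` supplies the Lipschitz bound on `u`.
-/
theorem Standing.not_max_at_boundary_vertex (hP : P.Standing) (hu : P.IsSubsolution u)
    (hw : P.IsSupersolution w) (hM : ∀ x, |u x| ≤ M) (hMw : ∀ x, |w x| ≤ M)
    (hv : N.IsBoundary v) (hη : 0 < η) (hlt : w (N.vertex v) < u (N.vertex v))
    (hlim : ∀ E : N.Inc v, ∀ ε > 0, ∃ᶠ x in 𝓝[>] (0 : ℝ), u (N.vertex v) - ε < u (N.ray v E.1 x))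
    (hmax : ∀ y, u y + η * N.bump y - w y ≤ u (N.vertex v) - w (N.vertex v)) : False := by
  obtain ⟨δ, hδ, k, C₁, hC₁, hb⟩ := hP.exists_vertex_barrier v (P.lam * M)
  have huh : u (N.vertex v) ≤ P.h v := hu.le_boundary hP.lam_pos.le hM hv hδ hC₁ hb
  have hsub := hv.subsingleton
  obtain ⟨E⟩ := nonempty_inc v
  have hl := N.len_pos E.1
  obtain ⟨D, σ, hreg⟩ := exists_isRegularEdge (hP.ham E.1) (hP.diffusion E.1) v
  rcases (hreg.diffusion_nonneg ⟨le_rfl, hl.le⟩).eq_or_lt with ha | ha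
  · obtain ⟨C, hC⟩ : ∃ C, ∀ᶠ x in 𝓝[>] (0 : ℝ),
        |u (N.ray v E.1 x) - u (N.vertex v)| ≤ C * x := by
      have hM0 : 0 ≤ M := (abs_nonneg _).trans (hM (N.vertex v))
      set C := C₁ + 8 / 3 * M / δ with hC
      have hCM : 2 * M ≤ 3 / 4 * C * δ := by
        have : 3 / 4 * C * δ = 3 / 4 * C₁ * δ + 2 * M := by rw [hC]; field_simp; ring
        rw [this]
        have : 0 ≤ 3 / 4 * C₁ * δ := by positivity
        linarith
      have hCC : C₁ ≤ C := by
        have : 0 ≤ 8 / 3 * M / δ := by positivity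
        linarith
      have hup := hu.vertex_upper hP.lam_pos.le hM hδ (hb E).1 (hb E).2.1 (hb E).2.2 hCC hCM
      rcases hP.deg v E with ⟨δ', hδ', h⟩ | h
      · obtain ⟨r, hr, hrl, c, hc, hco⟩ := ray_coercive hδ' h
        have h0 : N.ray v E.1 0 = N.vertex v := ray_zero v E
        obtain ⟨C', hlow⟩ := ((hu.isEdgeSub v E.1).mono
          (Ioo_subset_Ioo_right hrl)).exists_lower_bound_of_degenerate hP.lam_pos.le hr
          (upperSemicontinuous_ray hu.usc v E.1) (fun t => hM _) (A := D ^ 2)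
          (fun t ht => hreg.diffusion_le_sq ha.symm ⟨ht.1.le, ht.2.le.trans hrl⟩) (sq_nonneg D) hc
          (fun t ht p => hco t ⟨ht.1.le, ht.2.le⟩ p)
          (by simpa only [h0] using hlim E)
        simp only [h0] at hlow
        refine ⟨max C C', ?_⟩
        filter_upwards [hlow, Ioo_mem_nhdsGT hδ] with x h1 h2
        have h3 := hup x ⟨h2.1.le, h2.2.le⟩
        have h4 : C * x ≤ max C C' * x := mul_le_mul_of_nonneg_right (le_max_left _ _) h2.1.le
        have h5 : C' * x ≤ max C C' * x := mul_le_mul_of_nonneg_right (le_max_right _ _) h2.1.le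
        exact abs_le.2 ⟨by linarith, by linarith⟩
      · rw [← rayA_zero] at h
        exact absurd ha h.ne
    obtain ⟨p, s₁, s₂, q, k₁, k₂, h1, h2, h3, h4, h5, h6, h7⟩ :=
      hP.exists_vertex_slopes hu hw hη hlt hmax E hC
    rcases hw.neg.boundary_jet hv (fun _ => -s₂) (fun _ => -k₂) (fun _ => -q)
      (fun _ => neg_lt_neg h3) (fun E' => by
        rw [Subsingleton.elim E' E]
        filter_upwards [h5] with x hx
        linarith) with ⟨E', hE⟩ | h
    · rw [dual_jet_neg, Subsingleton.elim E' E] at hE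
      linarith
    · simp only [dual] at h
      linarith
  -- With positive diffusion the barrier exists for the dual problem too, so `-w` satisfies its
  -- Dirichlet condition.
  · obtain ⟨δ, hδ, k, C₁, hC₁, hb⟩ := exists_vertex_barrier_of_edge (P := P.dual) (v := v)
      (m := P.dual.lam * M) fun E' => by
        rw [Subsingleton.elim E' E, rayH_dual, rayA_dual]
        exact exists_hasBarrierWith_of_pos hreg.dual hl (continuous_rayA (hP.diffusion E.1) v)
          ha _
    have := hw.neg.le_boundary hP.lam_pos.le (fun x => by rw [abs_neg]; exact hMw x) hv hδ hC₁ hb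
    simp only [dual] at this
    linarith

/-- Comparison principle. -/
theorem Standing.comparison (hP : P.Standing) (hu : P.IsSubsolution u)
    (hw : P.IsSupersolution w) (hM : ∀ x, |u x| ≤ M) (hMw : ∀ x, |w x| ≤ M)
    (hlim : ∀ v, N.IsBoundary v → ∀ E : N.Inc v, ∀ ε > 0, ∃ᶠ x in 𝓝[>] (0 : ℝ),
      u (N.vertex v) - ε < u (N.ray v E.1 x)) (x : N.carrier) : u x ≤ w x := by
  by_contra! hx
  set m := u x - w x with hm
  have hm0 : 0 < m := by linarith
  obtain ⟨K, hK⟩ := exists_bump_le (N := N)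
  choose C σ hreg using fun E => exists_isRegularEdge (hP.ham E) (hP.diffusion E) (N.src E)
  have hlam := hP.lam_pos
  -- Small enough that `u - w ≥ m / 2` at the perturbed maximum, and that the bound of
  -- `edge_comparison` is below `P.lam * (m / 2)` on each edge.
  obtain ⟨η, hη, hηK, hηE⟩ : ∃ η > 0, η * K ≤ m / 2 ∧ ∀ E, η * (P.lam * N.len E +
      2 * (|σ E 0| + C E * N.len E) ^ 2 / N.len E + C E) < P.lam * (m / 2) := by
    have lin : ∀ b c : ℝ, 0 < c → ∀ᶠ r in 𝓝[>] (0 : ℝ), r * b < c := fun b c hc => by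
      have : Tendsto (fun r : ℝ => r * b) (𝓝[>] 0) (𝓝 (0 * b)) :=
        ((continuous_id.mul continuous_const).tendsto 0).mono_left nhdsWithin_le_nhds
      rw [zero_mul] at this
      exact this.eventually_lt_const hc
    obtain ⟨η, h1, h2, h3⟩ := ((lin K (m / 2) (by linarith)).and
      ((eventually_all.2 fun E => lin (P.lam * N.len E +
        2 * (|σ E 0| + C E * N.len E) ^ 2 / N.len E + C E) (P.lam * (m / 2)) (by positivity)).and
        self_mem_nhdsWithin)).exists
    exact ⟨η, h3, h1.le, h2⟩
  have husc : UpperSemicontinuous fun y => u y + η * N.bump y - w y := by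
    have : UpperSemicontinuous fun y => (u y + η * N.bump y) + -w y :=
      (hu.usc.add (Continuous.upperSemicontinuous (continuous_const.mul isC2_bump.1))).add hw.neg.usc
    simpa only [sub_eq_add_neg] using this
  obtain ⟨z, -, hz⟩ := (husc.upperSemicontinuousOn univ).exists_forall_le isCompact_univ
    ⟨x, mem_univ x⟩
  have hz' := fun y => hz y (mem_univ y)
  have hzx := hz' x
  have hbx : 0 ≤ η * N.bump x := mul_nonneg hη.le (bump_nonneg x)
  have hbz : η * N.bump z ≤ η * K := mul_le_mul_of_nonneg_left (hK z) hη.le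
  have hzpos : m / 2 ≤ u z - w z := by linarith
  rcases vertex_or_param z with ⟨v, rfl⟩ | ⟨E, t, ht, rfl⟩
  · have hmax : ∀ y, u y + η * N.bump y - w y ≤ u (N.vertex v) - w (N.vertex v) := fun y => by
      have := hz' y
      rw [bump_vertex] at this
      linarith
    rcases isBoundary_or_isInterior v with hv | hv
    · exact hP.not_max_at_boundary_vertex hu hw hM hMw hv hη (by linarith) (hlim v hv) hmax
    · exact hP.not_max_at_interior_vertex hu hw hM hv hη (by linarith) hmax
  · have hws := hw.neg.isEdgeSub (N.src E) E
    rw [rayH_dual, rayA_dual] at hws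
    have := edge_comparison hlam.le hη.le (hreg E) ht
      (upperSemicontinuous_ray hu.usc (N.src E) E) (w := fun x => w (N.ray (N.src E) E x))
      (upperSemicontinuous_ray hw.neg.usc (N.src E) E) (hu.isEdgeSub (N.src E) E) hws
      (fun s hs => by
        simp only [ray_src]
        have := hz' (N.param E s)
        rwa [bump_param E hs, bump_param E ⟨ht.1.le, ht.2.le⟩] at this)
    simp only [ray_src] at this
    have h1 := hηE E
    have h2 : P.lam * (m / 2) ≤ P.lam * (u (N.param E t) - w (N.param E t)) :=
      mul_le_mul_of_nonneg_left hzpos hlam.le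
    linarith

end NetworkProblem

end

/-! ### Strict inequalities at a point, as needed for Perron's method -/

noncomputable section

namespace Network

variable {d : ℕ} {N : Network d} {φ ψ : N.carrier → ℝ} {E : N.Edge} {t : ℝ}

theorem IsC2.add (hφ : N.IsC2 φ) (hψ : N.IsC2 ψ) : N.IsC2 fun x => φ x + ψ x :=
  ⟨hφ.1.add hψ.1, fun E => (hφ.2 E).add (hψ.2 E)⟩

theorem IsC2.const_mul (c : ℝ) (hφ : N.IsC2 φ) : N.IsC2 fun x => c * φ x :=
  ⟨continuous_const.mul hφ.1, fun E => contDiffOn_const.mul (hφ.2 E)⟩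

theorem IsC2.differentiableOn (hφ : N.IsC2 φ) (E : N.Edge) :
    DifferentiableOn ℝ (N.onEdge φ E) (Icc 0 (N.len E)) :=
  (hφ.2 E).differentiableOn (by norm_num)

theorem dx_add (hφ : N.IsC2 φ) (hψ : N.IsC2 ψ) (ht : t ∈ Icc 0 (N.len E)) :
    N.dx (fun x => φ x + ψ x) E t = N.dx φ E t + N.dx ψ E t :=
  derivWithin_fun_add (hφ.differentiableOn E t ht) (hψ.differentiableOn E t ht)

theorem dxx_add (hφ : N.IsC2 φ) (hψ : N.IsC2 ψ) (ht : t ∈ Icc 0 (N.len E)) :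
    N.dxx (fun x => φ x + ψ x) E t = N.dxx φ E t + N.dxx ψ E t :=
  iteratedDerivWithin_fun_add ht (N.uniqueDiffOn_edge E) (hφ.2 E t ht) (hψ.2 E t ht)

theorem continuousOn_dx (hφ : N.IsC2 φ) (E : N.Edge) :
    ContinuousOn (N.dx φ E) (Icc 0 (N.len E)) :=
  (hφ.2 E).continuousOn_derivWithin (N.uniqueDiffOn_edge E) (by norm_num)

theorem continuousOn_dxx (hφ : N.IsC2 φ) (E : N.Edge) :
    ContinuousOn (N.dxx φ E) (Icc 0 (N.len E)) :=
  (hφ.2 E).continuousOn_iteratedDerivWithin le_rfl (N.uniqueDiffOn_edge E)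

theorem coord_mem (v : Fin N.n) (E : N.Edge) : N.coord v E ∈ Icc 0 (N.len E) := by
  rw [← inw_zero]
  exact inw_mem_Icc ⟨le_rfl, (N.len_pos E).le⟩

theorem param_coord (v : Fin N.n) (E : N.Inc v) : N.param E.1 (N.coord v E.1) = N.vertex v := by
  rw [← inw_zero]
  exact ray_zero v E

/-- Incidence and parameter of an edge point which is a vertex. -/
theorem exists_inc_of_param_eq_vertex {v : Fin N.n} (ht : t ∈ Icc 0 (N.len E))
    (h : N.param E t = N.vertex v) : ∃ E' : N.Inc v, E'.1 = E ∧ N.coord v E'.1 = t := by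
  have hE : v = N.src E ∨ v = N.tgt E := (N.param_eq_vertex ht h).imp And.right And.right
  refine ⟨⟨E, hE⟩, rfl, N.param_injOn E (coord_mem v E) ht ?_⟩
  rw [h]
  exact param_coord v ⟨E, hE⟩

/-- Second order conditions at an interior maximum. -/
theorem derivatives_of_isLocalMax (hφ : N.IsC2 φ) (ht : t ∈ Ioo 0 (N.len E))
    (hm : IsLocalMax φ (N.param E t)) : N.dx φ E t = 0 ∧ N.dxx φ E t ≤ 0 := by
  have ht' : t ∈ Icc 0 (N.len E) := ⟨ht.1.le, ht.2.le⟩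
  have hnhds : Icc 0 (N.len E) ∈ 𝓝 t := Icc_mem_nhds ht.1 ht.2
  have hg : IsLocalMax (N.onEdge φ E) t :=
    ((N.continuous_param E).tendsto t).eventually hm
  have hc : ContDiffAt ℝ 2 (N.onEdge φ E) t := (hφ.2 E).contDiffAt hnhds
  have h1 : N.dx φ E t = deriv (N.onEdge φ E) t := derivWithin_of_mem_nhds hnhds
  have h2 : N.dxx φ E t = deriv (deriv (N.onEdge φ E)) t := by
    unfold dxx
    rw [iteratedDerivWithin_eq_iteratedDeriv (N.uniqueDiffOn_edge E) hc ht', iteratedDeriv_succ,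
      iteratedDeriv_one]
  have hd : deriv (N.onEdge φ E) t = 0 := hg.deriv_eq_zero
  refine ⟨h1.trans hd, ?_⟩
  -- A positive second derivative would give a local minimum as well, hence a locally constant
  -- function.
  by_contra! hpos
  rw [h2] at hpos
  have hmin : IsLocalMin (N.onEdge φ E) t :=
    isLocalMin_of_deriv_deriv_pos hpos hd hc.continuousAt
  have hconst : N.onEdge φ E =ᶠ[𝓝 t] fun _ => N.onEdge φ E t := by
    filter_upwards [hg, hmin] with s h3 h4 using le_antisymm h3 h4
  have h3 := (hconst.deriv).deriv_eq
  rw [h3] at hpos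
  simp at hpos

theorem inwardDeriv_nonpos_of_isLocalMax (hφ : N.IsC2 φ) {v : Fin N.n} (E : N.Inc v)
    (hm : IsLocalMax φ (N.vertex v)) : N.inwardDeriv φ v E.1 ≤ 0 := by
  have hl := N.len_pos E.1
  have hg : IsLocalMaxOn (N.onEdge φ E.1) (Icc 0 (N.len E.1)) (N.coord v E.1) := by
    have h := (N.continuous_param E.1).tendsto (N.coord v E.1)
    rw [param_coord] at h
    have h1 := h.eventually hm
    rw [← param_coord v E] at h1
    exact h1.filter_mono nhdsWithin_le_nhds
  have hy : N.orient v E.1 * N.len E.1 ∈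
      posTangentConeAt (Icc 0 (N.len E.1)) (N.coord v E.1) := by
    refine mem_posTangentConeAt_of_segment_subset
      ((convex_Icc _ _).segment_subset (coord_mem v E.1) ?_)
    unfold coord orient
    split_ifs
    · exact ⟨by linarith, by linarith⟩
    · exact ⟨by linarith, by linarith⟩
  have hd := (hφ.differentiableOn E.1 _ (coord_mem v E.1)).hasDerivWithinAt
  have := hg.hasFDerivWithinAt_nonpos hd.hasFDerivWithinAt hy
  rw [inwardDeriv_eq]
  have h2 : N.orient v E.1 * N.len E.1 * N.dx φ E.1 (N.coord v E.1) ≤ 0 := by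
    simpa [dx] using this
  have h3 : N.len E.1 * (N.orient v E.1 * N.dx φ E.1 (N.coord v E.1)) ≤ 0 := by linarith
  exact nonpos_of_mul_nonpos_right h3 hl

/-- The fourth power of the distance to a point. -/
def quartic (x₀ x : N.carrier) : ℝ := dist x x₀ ^ 4

/-- On edges not containing `x₀` the distance is Euclidean; an even power makes it a polynomial in
the squared norm, hence smooth. -/
theorem isC2_quartic (x₀ : N.carrier) : N.IsC2 (quartic x₀) := by
  refine ⟨by unfold quartic; fun_prop, fun E => ?_⟩
  have h : ContDiff ℝ 2 fun t => (‖N.edgePoint E t - x₀‖ ^ 2) ^ 2 := by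
    refine ContDiff.pow (ContDiff.norm_sq ℝ ?_) 2
    unfold edgePoint
    fun_prop
  refine h.contDiffOn.congr fun t ht => ?_
  unfold onEdge quartic
  rw [Subtype.dist_eq, N.coe_param E ht, dist_eq_norm, ← pow_mul]

theorem quartic_jet {x₀ : N.carrier} (ht : t ∈ Icc 0 (N.len E)) (h : N.param E t = x₀) :
    N.dx (quartic x₀) E t = 0 ∧ N.dxx (quartic x₀) E t = 0 := by
  have he : EqOn (N.onEdge (quartic x₀) E) (fun s => (s - t) ^ 4) (Icc 0 (N.len E)) :=
    fun s hs => by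
      unfold onEdge quartic
      rw [← h, N.dist_param E hs ht, pow_abs, abs_of_nonneg (by positivity)]
  have hg : ContDiff ℝ 2 fun s : ℝ => (s - t) ^ 4 := by fun_prop
  have hd : deriv (fun s : ℝ => (s - t) ^ 4) = fun s => 4 * (s - t) ^ 3 := by
    funext s
    have := ((hasDerivAt_id s).sub_const t).pow 4
    exact (this.congr_deriv (by simp)).deriv
  have hd2 : deriv (fun s : ℝ => 4 * (s - t) ^ 3) t = 0 := by
    have := (((hasDerivAt_id t).sub_const t).pow 3).const_mul 4
    exact (this.congr_deriv (by simp)).deriv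
  rw [dx_eq_deriv he hg ht, dxx_eq_deriv he hg ht, iteratedDeriv_succ, iteratedDeriv_one, hd]
  exact ⟨by simp, hd2⟩

end Network

namespace NetworkProblem

open Network

variable {d : ℕ} {N : Network d} {P : NetworkProblem N} {u : N.carrier → ℝ}
  {φ ψ : N.carrier → ℝ} {r s : ℝ} {x : N.carrier}

variable (P) in
/-- `φ` satisfies the strict supersolution inequalities at `x`, for the value `r`. -/
structure Above (r : ℝ) (φ : N.carrier → ℝ) (x : N.carrier) : Prop where
  edge : ∀ E, ∀ t ∈ Icc 0 (N.len E), x = N.param E t → 0 < P.GAt E r φ t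
  interior : ∀ v, N.IsInterior v → x = N.vertex v → 0 < P.F v r fun E => N.inwardDeriv φ v E
  boundary : ∀ v, N.IsBoundary v → x = N.vertex v → P.h v < r

theorem Above.gAt_coord {v : Fin N.n} (h : P.Above r φ (N.vertex v)) (E : N.Inc v) :
    0 < P.GAt E r φ (N.coord v E) :=
  h.edge E _ (coord_mem v E) (param_coord v E).symm

theorem above_param {E : N.Edge} {t : ℝ} (ht : t ∈ Ioo 0 (N.len E)) (h : 0 < P.GAt E r φ t) :
    P.Above r φ (N.param E t) := by
  refine ⟨fun E' t' ht' he => ?_, fun v _ he => absurd he (N.param_ne_vertex ht v),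
    fun v _ he => absurd he (N.param_ne_vertex ht v)⟩
  obtain ⟨rfl, rfl⟩ := N.param_eq_param_of_mem_Ioo ht ht' he
  exact h

theorem above_vertex {v : Fin N.n} (hG : ∀ E : N.Inc v, 0 < P.GAt E r φ (N.coord v E))
    (hF : N.IsInterior v → 0 < P.F v r fun E => N.inwardDeriv φ v E)
    (hh : N.IsBoundary v → P.h v < r) : P.Above r φ (N.vertex v) := by
  refine ⟨fun E t ht he => ?_, fun v' hv' he => ?_, fun v' hv' he => ?_⟩
  · obtain ⟨E', rfl, rfl⟩ := exists_inc_of_param_eq_vertex ht he.symm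
    exact hG E'
  · obtain rfl := N.vertex_injective he
    exact hF hv'
  · obtain rfl := N.vertex_injective he
    exact hh hv'

/-- `Above` is the negation of the disjunctive subsolution conditions, uniformly over edge points
and both kinds of vertices. Perron's method can then argue without distinguishing these cases. -/
theorem IsSubsolution.not_above (h : P.IsSubsolution u) (hφ : N.IsC2 φ)
    (hm : IsLocalMax (fun y => u y - φ y) x) : ¬ P.Above (u x) φ x := by
  intro ha
  rcases vertex_or_param x with ⟨v, rfl⟩ | ⟨E, t, ht, rfl⟩
  · rcases isBoundary_or_isInterior v with hv | hv
    · rcases h.boundary φ hφ v hv hm with ⟨E, hE⟩ | hh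
      · exact (ha.gAt_coord E).not_ge hE
      · linarith [ha.boundary v hv rfl]
    · rcases h.interior φ hφ v hv hm with ⟨E, hE⟩ | hF
      · exact (ha.gAt_coord E).not_ge hE
      · exact (ha.interior v hv rfl).not_ge hF
  · exact (ha.edge E t ⟨ht.1.le, ht.2.le⟩ rfl).not_ge (h.edge φ hφ E t ht hm)

theorem isSubsolution_of_not_above (husc : UpperSemicontinuous u)
    (h : ∀ φ, N.IsC2 φ → ∀ x, IsLocalMax (fun y => u y - φ y) x → ¬ P.Above (u x) φ x) :
    P.IsSubsolution u := by
  refine ⟨husc, fun φ hφ E t ht hm => ?_, fun φ hφ v hv hm => ?_, fun φ hφ v hv hm => ?_⟩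
  · by_contra! hlt
    exact h φ hφ _ hm (above_param ht hlt)
  · by_contra! hlt
    exact h φ hφ _ hm (above_vertex hlt.1 (fun _ => hlt.2) fun hb => absurd hv hb.not_isInterior)
  · by_contra! hlt
    refine h φ hφ _ hm (above_vertex hlt.1 (fun hi => absurd hi hv.not_isInterior) fun _ => ?_)
    linarith [hlt.2]

theorem isSupersolution_of_dual (h : P.dual.IsSubsolution fun x => -u x) :
    P.IsSupersolution u := by
  have hloc : ∀ {φ : N.carrier → ℝ} {x}, IsLocalMin (fun x => u x - φ x) x →
      IsLocalMax (fun x => -u x - -φ x) x := fun {φ x} hm => by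
    have : (fun x => -u x - -φ x) = fun x => -(u x - φ x) := by funext y; ring
    rw [this]
    exact hm.neg
  have hG : ∀ E φ t r, P.dual.GAt E (-r) (fun x => -φ x) t = -P.GAt E r φ t := fun E φ t r => by
    rw [GAt_dual]
    simp only [neg_neg]
  refine ⟨by simpa only [Pi.neg_def, neg_neg] using h.usc.neg, fun φ hφ E t ht hm => ?_,
    fun φ hφ v hv hm => ?_, fun φ hφ v hv hm => ?_⟩
  · have := h.edge _ (IsC2.neg hφ) E t ht (hloc hm)
    rw [hG] at this
    linarith
  · rcases h.interior _ (IsC2.neg hφ) v hv (hloc hm) with ⟨E, hE⟩ | hF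
    · rw [hG] at hE
      exact Or.inl ⟨E, by linarith⟩
    · right
      simp only [inwardDeriv_neg, dual, neg_neg] at hF
      linarith
  · rcases h.boundary _ (IsC2.neg hφ) v hv (hloc hm) with ⟨E, hE⟩ | hh
    · rw [hG] at hE
      exact Or.inl ⟨E, by linarith⟩
    · right
      simp only [dual] at hh
      linarith

variable (P) in
/-- The properties of the data needed for the construction of subsolutions. They are
invariant under `dual`. -/
structure Regular : Prop where
  lam_pos : 0 < P.lam
  ham : ∀ E : N.Edge, HamiltonianRegular (N.closedEdge E) (P.H E)
  diffusion : ∀ E : N.Edge, DiffusionRegular (N.closedEdge E) (P.a E)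
  continuous : ∀ v, N.IsInterior v → ∀ p, Continuous fun r => P.F v r p
  mono : ∀ v, N.IsInterior v → ∀ r s p q, s ≤ r → (∀ i, p i ≤ q i) → P.F v s q ≤ P.F v r p
  large : ∀ v, N.IsInterior v → ∀ᶠ c in atTop, 0 < P.F v 0 fun _ => -c

theorem gAt_eq (E : N.Edge) (r : ℝ) (φ : N.carrier → ℝ) (t : ℝ) :
    P.GAt E r φ t = P.lam * r + P.GAt E 0 φ t := by
  unfold GAt G
  ring

theorem gAt_eq_ray (E : N.Edge) (r : ℝ) (φ : N.carrier → ℝ) (t : ℝ) :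
    P.GAt E r φ t = P.lam * r - P.rayA (N.src E) E t * N.dxx φ E t +
      P.rayH (N.src E) E t (N.dx φ E t) := by
  unfold GAt G rayA rayH
  rw [ray_src, orient, if_pos rfl, one_mul]

theorem Regular.continuousOn_gAt (hP : P.Regular) (hφ : N.IsC2 φ) (E : N.Edge) (r : ℝ) :
    ContinuousOn (P.GAt E r φ) (Icc 0 (N.len E)) := by
  have hA := continuous_rayA (hP.diffusion E) (N.src E)
  have hH := continuous_rayH (hP.ham E) (N.src E)
  rw [funext (gAt_eq_ray E r φ)]
  have hx := continuousOn_dx hφ E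
  have hxx := continuousOn_dxx hφ E
  generalize P.rayA (N.src E) E = A at *
  generalize P.rayH (N.src E) E = K at *
  generalize N.dx φ E = p at *
  generalize N.dxx φ E = X at *
  have h1 : ContinuousOn (fun t => A t * X t) (Icc 0 (N.len E)) := hA.continuousOn.mul hxx
  have h2 : ContinuousOn (fun t => K t (p t)) (Icc 0 (N.len E)) :=
    hH.comp_continuousOn (continuousOn_id.prodMk hx)
  exact (continuousOn_const.sub h1).add h2

theorem Above.mono (hP : P.Regular) (h : P.Above r φ x) (hrs : r ≤ s) : P.Above s φ x := by
  refine ⟨fun E t ht he => ?_, fun v hv he => ?_, fun v hv he => ?_⟩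
  · have h1 := h.edge E t ht he
    have h2 := mul_le_mul_of_nonneg_left hrs hP.lam_pos.le
    rw [gAt_eq] at h1 ⊢
    linarith
  · exact (h.interior v hv he).trans_le (hP.mono v hv s r _ _ hrs fun _ => le_rfl)
  · exact (h.boundary v hv he).trans_le hrs

theorem Above.exists_lt (hP : P.Regular) (h : P.Above r φ x) : ∃ δ > 0, P.Above (r - δ) φ x := by
  have hlim : Tendsto (fun δ : ℝ => r - δ) (𝓝[>] 0) (𝓝 r) := by
    have : Tendsto (fun δ : ℝ => r - δ) (𝓝 0) (𝓝 (r - 0)) := by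
      exact (continuous_const.sub continuous_id).tendsto 0
    rw [sub_zero] at this
    exact this.mono_left nhdsWithin_le_nhds
  have h1 : ∀ E, ∀ᶠ δ in 𝓝[>] (0 : ℝ),
      ∀ t ∈ Icc 0 (N.len E), x = N.param E t → 0 < P.GAt E (r - δ) φ t := fun E => by
    by_cases hE : ∃ t ∈ Icc 0 (N.len E), x = N.param E t
    · obtain ⟨t, ht, he⟩ := hE
      have hc : Continuous fun r => P.GAt E r φ t := by unfold GAt G; fun_prop
      filter_upwards [((hc.tendsto r).comp hlim).eventually_const_lt (h.edge E t ht he)]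
        with δ hδ t' ht' he'
      rwa [N.param_injOn E ht' ht (he'.symm.trans he)]
    · exact Eventually.of_forall fun δ t ht he => absurd ⟨t, ht, he⟩ hE
  have h2 : ∀ v, ∀ᶠ δ in 𝓝[>] (0 : ℝ), N.IsInterior v → x = N.vertex v →
      0 < P.F v (r - δ) fun E => N.inwardDeriv φ v E := fun v => by
    by_cases hv : N.IsInterior v ∧ x = N.vertex v
    · filter_upwards [(((hP.continuous v hv.1 _).tendsto r).comp hlim).eventually_const_lt
        (h.interior v hv.1 hv.2)] with δ hδ _ _ using hδ
    · exact Eventually.of_forall fun δ a b => absurd ⟨a, b⟩ hv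
  have h3 : ∀ v, ∀ᶠ δ in 𝓝[>] (0 : ℝ), N.IsBoundary v → x = N.vertex v → P.h v < r - δ :=
    fun v => by
      by_cases hv : N.IsBoundary v ∧ x = N.vertex v
      · filter_upwards [hlim.eventually_const_lt (h.boundary v hv.1 hv.2)] with δ hδ _ _ using hδ
      · exact Eventually.of_forall fun δ a b => absurd ⟨a, b⟩ hv
  obtain ⟨δ, ⟨⟨h1, h2⟩, h3⟩, hδ⟩ := (((eventually_all.2 h1).and (eventually_all.2 h2)).and
    (eventually_all.2 h3)).and (eventually_mem_nhdsWithin) |>.exists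
  exact ⟨δ, hδ, h1, h2, h3⟩

/-- Points near a vertex, other than itself, are interior to edges, where only the edge inequality
is required and continuity suffices. The vertex conditions need not be propagated. -/
theorem Above.eventually (hP : P.Regular) (hφ : N.IsC2 φ) (h : P.Above r φ x) :
    ∀ᶠ y in 𝓝 x, P.Above r φ y := by
  refine N.eventually_nhds_of_param fun E t ht he => ?_
  have hIoo : ∀ᶠ s in 𝓝[Icc 0 (N.len E)] t, s = t ∨ s ∈ Ioo 0 (N.len E) := by
    have h0 : ∀ᶠ s in 𝓝[Icc 0 (N.len E)] t, t < N.len E → s < N.len E := by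
      by_cases hc : t < N.len E
      · filter_upwards [(eventually_lt_nhds hc).filter_mono nhdsWithin_le_nhds] with s hs _ using hs
      · exact Eventually.of_forall fun s hc' => absurd hc' hc
    have h1 : ∀ᶠ s in 𝓝[Icc 0 (N.len E)] t, 0 < t → 0 < s := by
      by_cases hc : 0 < t
      · filter_upwards [(eventually_gt_nhds hc).filter_mono nhdsWithin_le_nhds] with s hs _ using hs
      · exact Eventually.of_forall fun s hc' => absurd hc' hc
    filter_upwards [h0, h1, eventually_mem_nhdsWithin] with s h0 h1 hs
    by_cases hst : s = t
    · exact Or.inl hst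
    right
    have hl := N.len_pos E
    rcases ht.1.eq_or_lt with ht0 | ht0
    · exact ⟨lt_of_le_of_ne hs.1 fun h => hst (h.symm.trans ht0), h0 (ht0 ▸ hl)⟩
    rcases ht.2.eq_or_lt with ht1 | ht1
    · exact ⟨h1 ht0, lt_of_le_of_ne hs.2 fun h => hst (h.trans ht1.symm)⟩
    exact ⟨h1 ht0, h0 ht1⟩
  have hpos := (hP.continuousOn_gAt hφ E r t ht).eventually_const_lt (h.edge E t ht he.symm)
  filter_upwards [hIoo, hpos] with s hs hG
  rcases hs with rfl | hs
  · rwa [he]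
  · exact above_param hs hG

/-- The strict inequalities persist at nearby points, for slightly smaller values. -/
theorem Above.exists_ball (hP : P.Regular) (hφ : N.IsC2 φ) (h : P.Above r φ x) :
    ∃ δ > 0, ∀ᶠ y in 𝓝 x, ∀ s, r - δ ≤ s → P.Above s φ y := by
  obtain ⟨δ, hδ, h1⟩ := h.exists_lt hP
  refine ⟨δ, hδ, ?_⟩
  filter_upwards [h1.eventually hP hφ] with y hy s hs using hy.mono hP hs

/-- The fourth power has vanishing first and second derivatives at `x`, so it makes the contact
strict without disturbing the inequalities. -/
theorem Above.add_quartic (hφ : N.IsC2 φ) (h : P.Above r φ x) :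
    P.Above r (fun y => φ y + quartic x y) x := by
  refine ⟨fun E t ht he => ?_, fun v hv he => ?_, h.boundary⟩
  · have := h.edge E t ht he
    obtain ⟨h1, h2⟩ := quartic_jet ht he.symm
    unfold GAt at this ⊢
    rwa [dx_add hφ (isC2_quartic x) ht, dxx_add hφ (isC2_quartic x) ht, h1, h2, add_zero, add_zero]
  · convert h.interior v hv he using 2
    funext E
    have := (quartic_jet (coord_mem v E.1) ((param_coord v E).trans he.symm)).1
    rw [inwardDeriv_eq, inwardDeriv_eq, dx_add hφ (isC2_quartic x) (coord_mem v E.1), this,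
      add_zero]

/-- A function satisfying the strict inequalities for subsolutions cannot be touched from above by
one which satisfies those for supersolutions. -/
theorem Above.not_touching (hP : P.Regular) (hφ : N.IsC2 φ) (hψ : N.IsC2 ψ)
    (hm : IsLocalMax (fun y => φ y - ψ y) x) (h : P.dual.Above (-r) (fun y => -φ y) x) :
    ¬ P.Above r ψ x := by
  intro ha
  have hG : ∀ E t, P.dual.GAt E (-r) (fun y => -φ y) t = -P.GAt E r φ t := fun E t => by
    rw [GAt_dual]
    simp only [neg_neg]
  have hC2 : N.IsC2 fun y => φ y + -ψ y := hφ.add (IsC2.neg hψ)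
  have hm' : IsLocalMax (fun y => φ y + -ψ y) x := by simpa only [sub_eq_add_neg] using hm
  rcases vertex_or_param x with ⟨v, rfl⟩ | ⟨E, t, ht, rfl⟩
  · rcases isBoundary_or_isInterior v with hv | hv
    · have h1 := h.boundary v hv rfl
      have h2 := ha.boundary v hv rfl
      simp only [dual] at h1
      linarith
    · have h1 := h.interior v hv rfl
      have h2 := ha.interior v hv rfl
      simp only [dual, inwardDeriv_neg, neg_neg] at h1
      have h3 := hP.mono v hv r r (fun E => N.inwardDeriv φ v E)
        (fun E => N.inwardDeriv ψ v E) le_rfl fun E => by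
          have h4 := inwardDeriv_nonpos_of_isLocalMax hC2 E hm'
          rw [inwardDeriv_eq, dx_add hφ (IsC2.neg hψ) (coord_mem v E.1), dx_neg] at h4
          rw [inwardDeriv_eq, inwardDeriv_eq]
          linarith
      linarith
  · have ht' : t ∈ Icc 0 (N.len E) := ⟨ht.1.le, ht.2.le⟩
    have h1 := h.edge E t ht' rfl
    have h2 := ha.edge E t ht' rfl
    rw [hG] at h1
    obtain ⟨h3, h4⟩ := derivatives_of_isLocalMax hC2 ht hm'
    rw [dx_add hφ (IsC2.neg hψ) ht', dx_neg] at h3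
    rw [dxx_add hφ (IsC2.neg hψ) ht', dxx_neg] at h4
    have ha : 0 ≤ P.a E (N.param E t) := by
      obtain ⟨σ, C, -, hσ, -⟩ := hP.diffusion E
      rw [hσ _ (N.coe_param_mem E t)]
      positivity
    have h5 := mul_le_mul_of_nonneg_left (by linarith : N.dxx φ E t ≤ N.dxx ψ E t) ha
    unfold GAt G at h1 h2
    rw [show N.dx φ E t = N.dx ψ E t by linarith] at h1
    linarith

end NetworkProblem

end

/-! ### Perron's method -/

noncomputable section

section Envelope

variable {X : Type*} {u : X → ℝ} {M : ℝ} {f : Filter X}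

theorem isBoundedUnder_le_of_abs_le (hM : ∀ x, |u x| ≤ M) : IsBoundedUnder (· ≤ ·) f u :=
  isBoundedUnder_of ⟨M, fun x => (abs_le.1 (hM x)).2⟩

theorem isBoundedUnder_ge_of_abs_le (hM : ∀ x, |u x| ≤ M) : IsBoundedUnder (· ≥ ·) f u :=
  isBoundedUnder_of ⟨-M, fun x => (abs_le.1 (hM x)).1⟩

theorem isCoboundedUnder_le_of_abs_le [f.NeBot] (hM : ∀ x, |u x| ≤ M) :
    IsCoboundedUnder (· ≤ ·) f u :=
  (isBoundedUnder_ge_of_abs_le hM).isCoboundedUnder_le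

theorem isCoboundedUnder_ge_of_abs_le [f.NeBot] (hM : ∀ x, |u x| ≤ M) :
    IsCoboundedUnder (· ≥ ·) f u :=
  (isBoundedUnder_le_of_abs_le hM).isCoboundedUnder_ge

theorem abs_limsup_le [f.NeBot] (hM : ∀ x, |u x| ≤ M) : |limsup u f| ≤ M := by
  refine abs_le.2 ⟨le_limsup_of_frequently_le
    (Eventually.of_forall fun x => (abs_le.1 (hM x)).1).frequently
    (isBoundedUnder_le_of_abs_le hM), limsup_le_of_le (isCoboundedUnder_le_of_abs_le hM)
    (Eventually.of_forall fun x => (abs_le.1 (hM x)).2)⟩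

theorem abs_liminf_le [f.NeBot] (hM : ∀ x, |u x| ≤ M) : |liminf u f| ≤ M := by
  refine abs_le.2 ⟨le_liminf_of_le (isCoboundedUnder_ge_of_abs_le hM)
    (Eventually.of_forall fun x => (abs_le.1 (hM x)).1), liminf_le_of_frequently_le
    (Eventually.of_forall fun x => (abs_le.1 (hM x)).2).frequently
    (isBoundedUnder_ge_of_abs_le hM)⟩

variable [TopologicalSpace X]

theorem le_limsup_nhds (hM : ∀ x, |u x| ≤ M) (x : X) : u x ≤ limsup u (𝓝 x) := by
  refine le_limsup_of_frequently_le (fun h => ?_) (isBoundedUnder_le_of_abs_le hM)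
  exact h.self_of_nhds le_rfl

theorem liminf_nhds_le (hM : ∀ x, |u x| ≤ M) (x : X) : liminf u (𝓝 x) ≤ u x := by
  refine liminf_le_of_frequently_le (fun h => ?_) (isBoundedUnder_ge_of_abs_le hM)
  exact h.self_of_nhds le_rfl

theorem upperSemicontinuous_limsup_nhds (hM : ∀ x, |u x| ≤ M) :
    UpperSemicontinuous fun x => limsup u (𝓝 x) := by
  intro x c hc
  obtain ⟨c', h1, h2⟩ := exists_between hc
  have h3 := eventually_lt_of_limsup_lt h1 (isBoundedUnder_le_of_abs_le hM)
  filter_upwards [eventually_eventually_nhds.2 h3] with y hy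
  exact (limsup_le_of_le (isCoboundedUnder_le_of_abs_le hM) (hy.mono fun _ h => h.le)).trans_lt h2

theorem lowerSemicontinuous_liminf_nhds (hM : ∀ x, |u x| ≤ M) :
    LowerSemicontinuous fun x => liminf u (𝓝 x) := by
  intro x c hc
  obtain ⟨c', h1, h2⟩ := exists_between hc
  have h3 := eventually_lt_of_lt_liminf h2 (isBoundedUnder_ge_of_abs_le hM)
  filter_upwards [eventually_eventually_nhds.2 h3] with y hy
  exact h1.trans_le (le_liminf_of_le (isCoboundedUnder_ge_of_abs_le hM) (hy.mono fun _ h => h.le))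

end Envelope

namespace NetworkProblem

open Network

variable {d : ℕ} {N : Network d} {P : NetworkProblem N} {U : N.carrier → ℝ} {M : ℝ}

theorem quartic_self (x : N.carrier) : quartic x x = 0 := by simp [quartic]

/-- The upper envelope of a supremum of subsolutions is a subsolution. -/
theorem Regular.isSubsolution_limsup (hP : P.Regular) {ι : Type*} {u : ι → N.carrier → ℝ}
    (hu : ∀ i, P.IsSubsolution (u i)) (hM : ∀ x, |U x| ≤ M) (hle : ∀ i x, u i x ≤ U x)
    (hsup : ∀ x, ∀ c < U x, ∃ i, c < u i x) : P.IsSubsolution fun x => limsup U (𝓝 x) := by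
  refine isSubsolution_of_not_above (upperSemicontinuous_limsup_nhds hM)
    fun φ hφ x hm ha => ?_
  set r := limsup U (𝓝 x) with hr
  set ψ : N.carrier → ℝ := fun y => φ y + quartic x y with hψdef
  have hψ : N.IsC2 ψ := hφ.add (isC2_quartic x)
  have hψx : ψ x = φ x := by simp [hψdef, quartic_self]
  obtain ⟨δ, hδ, h1⟩ := (ha.add_quartic hφ).exists_ball hP hψ
  have h2 : ∀ᶠ y in 𝓝 x, ψ x - δ / 2 < ψ y :=
    (hψ.1.tendsto x).eventually_const_lt (by linarith)
  obtain ⟨ρ, hρ, hball⟩ := Metric.eventually_nhds_iff.1 ((hm.and h1).and h2)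
  obtain ⟨R, hR, hRρ⟩ := exists_between hρ
  obtain ⟨ε, hε, hεδ, hεR⟩ : ∃ ε > 0, ε ≤ δ / 2 ∧ ε ≤ R ^ 4 :=
    ⟨min (δ / 2) (R ^ 4), by positivity, min_le_left _ _, min_le_right _ _⟩
  have h3 : ∃ᶠ y in 𝓝 x, r - ε / 2 < U y :=
    frequently_lt_of_lt_limsup (isCoboundedUnder_le_of_abs_le hM) (by linarith)
  have h4 : ∀ᶠ y in 𝓝 x, ψ y < ψ x + ε / 2 :=
    (hψ.1.tendsto x).eventually_lt_const (by linarith)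
  obtain ⟨y₁, h5, h6, h7⟩ := (h3.and_eventually
    (h4.and (Metric.closedBall_mem_nhds x hR))).exists
  obtain ⟨i, hi⟩ := hsup y₁ _ h5
  have husc : UpperSemicontinuous fun y => u i y + -ψ y :=
    (hu i).usc.add (Continuous.upperSemicontinuous hψ.1.neg)
  obtain ⟨y, hy, hmax⟩ := (husc.upperSemicontinuousOn (Metric.closedBall x R)).exists_forall_le
    (isCompact_closedBall x R) ⟨y₁, h7⟩
  have h8 := hmax y₁ h7
  have hyR : dist y x ≤ R := hy
  obtain ⟨⟨h9, h10⟩, h11⟩ := hball (hyR.trans_lt hRρ)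
  have h12 : u i y ≤ limsup U (𝓝 y) := (hle i y).trans (le_limsup_nhds hM y)
  have h13 : ψ y = φ y + dist y x ^ 4 := rfl
  have h9 : limsup U (𝓝 y) - φ y ≤ r - φ x := h9
  -- The quartic term excludes the boundary sphere: `y` almost attains the strict maximum, so the
  -- fourth power of its distance to `x` is less than `ε ≤ R ^ 4`.
  have hlt : dist y x < R := by
    refine lt_of_pow_lt_pow_left₀ 4 hR.le ?_
    linarith
  refine (hu i).not_above hψ (x := y) ?_ (h10 _ (by linarith))
  filter_upwards [Metric.isOpen_ball.mem_nhds (show y ∈ Metric.ball x R from hlt)] with z hz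
  have hz : dist z x < R := hz
  have := hmax z hz.le
  linarith

/-- The lower envelope of the largest subsolution is a supersolution. -/
theorem Regular.isSupersolution_liminf (hP : P.Regular) (hPd : P.dual.Regular)
    (hU : P.IsSubsolution U) (hM : ∀ x, |U x| ≤ M)
    (hmaxU : ∀ V, P.IsSubsolution V → ∀ x, V x ≤ U x) :
    P.IsSupersolution fun x => liminf U (𝓝 x) := by
  refine isSupersolution_of_dual (isSubsolution_of_not_above
    (lowerSemicontinuous_liminf_nhds hM).neg fun φ hφ x hm ha => ?_)
  set r := liminf U (𝓝 x) with hr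
  set ψ : N.carrier → ℝ := fun y => φ y + quartic x y with hψdef
  have hψ : N.IsC2 ψ := hφ.add (isC2_quartic x)
  have hψx : ψ x = φ x := by simp [hψdef, quartic_self]
  obtain ⟨δ, hδ, h1⟩ := (ha.add_quartic hφ).exists_ball hPd hψ
  have h2 : ∀ᶠ y in 𝓝 x, ψ x - δ / 2 < ψ y :=
    (hψ.1.tendsto x).eventually_const_lt (by linarith)
  obtain ⟨ρ, hρ, hball⟩ := Metric.eventually_nhds_iff.1 ((hm.and h1).and h2)
  obtain ⟨R, hR, hRρ⟩ := exists_between hρ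
  obtain ⟨κ, hκ, hκδ, hκR⟩ : ∃ κ > 0, κ ≤ δ / 2 ∧ κ < R ^ 4 := by
    have : 0 < R ^ 4 / 2 := by positivity
    exact ⟨min (δ / 2) (R ^ 4 / 2), by positivity, min_le_left _ _,
      (min_le_right _ _).trans_lt (by linarith)⟩
  -- If the lower envelope failed to be a supersolution at `x`, this strict subsolution would lie
  -- above `U` at some points near `x`, yet below `U` at distance at least `R`. Taking the maximum
  -- inside the ball then gives a subsolution exceeding `U`.
  obtain ⟨g, hg⟩ : ∃ g : N.carrier → ℝ, ∀ y, g y = r + ψ x + κ - ψ y := ⟨_, fun _ => rfl⟩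
  have hgc : Continuous g := by
    rw [funext hg]
    exact continuous_const.sub hψ.1
  have hgU : ∀ y, dist y x < ρ → R ≤ dist y x → g y ≤ U y := fun y h3 h4 => by
    have h5 : -liminf U (𝓝 y) - φ y ≤ -r - φ x := (hball h3).1.1
    have h6 := liminf_nhds_le hM y
    have h7 : ψ y = φ y + dist y x ^ 4 := rfl
    have h8 : R ^ 4 ≤ dist y x ^ 4 := pow_le_pow_left₀ hR.le h4 4
    rw [hg]
    linarith
  classical
  obtain ⟨V, hV⟩ : ∃ V : N.carrier → ℝ,
      ∀ y, V y = if dist y x < ρ then max (U y) (g y) else U y := ⟨_, fun _ => rfl⟩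
  have hVin : ∀ y, dist y x < ρ → V y = max (U y) (g y) := fun y hy => by rw [hV, if_pos hy]
  have hVout : ∀ y, R ≤ dist y x → V y = U y := fun y hy => by
    rw [hV]
    split_ifs with h
    · exact max_eq_left (hgU y h hy)
    · rfl
  have hUV : ∀ y, U y ≤ V y := fun y => by
    rw [hV]
    split_ifs
    · exact le_max_left _ _
    · exact le_rfl
  have hVsub : P.IsSubsolution V := by
    refine isSubsolution_of_not_above (fun y c hc => ?_) fun χ hχ y hmy hay => ?_
    · have hc : V y < c := hc
      change ∀ᶠ z in 𝓝 y, V z < c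
      by_cases hy : dist y x < ρ
      · rw [hVin y hy] at hc
        filter_upwards [(hU.usc.sup hgc.upperSemicontinuous) y c hc,
          Metric.isOpen_ball.mem_nhds (show y ∈ Metric.ball x ρ from hy)] with z h3 h4
        rw [hVin z h4]
        exact h3
      · have hyR : R < dist y x := hRρ.trans_le (not_lt.1 hy)
        rw [hVout y hyR.le] at hc
        have hd : Continuous fun z => dist z x := by fun_prop
        filter_upwards [hU.usc y c hc, (hd.tendsto y).eventually_const_lt hyR] with z h3 h4
        rwa [hVout z h4.le]
    · by_cases hy : V y = U y
      · rw [hy] at hay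
        refine hU.not_above hχ ?_ hay
        filter_upwards [hmy] with z hz
        have := hUV z
        linarith
      · have hyR : dist y x < R := not_le.1 fun h => hy (hVout y h)
        have hVg : V y = g y := by
          rw [hVin y (hyR.trans hRρ)] at hy ⊢
          exact (max_choice _ _).resolve_left hy
        -- Where the maximum is attained by `g`, the test function touches a smooth strict
        -- subsolution from above.
        refine Above.not_touching hP (IsC2.neg hψ) hχ ?_ ?_ hay
        · filter_upwards [hmy, Metric.isOpen_ball.mem_nhds
            (show y ∈ Metric.ball x ρ from hyR.trans hRρ)] with z h3 h4
          have h5 : g z ≤ V z := by rw [hVin z h4]; exact le_max_right _ _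
          rw [hg] at h5 hVg
          linarith
        · simp only [neg_neg]
          obtain ⟨⟨-, h3⟩, h4⟩ := hball (hyR.trans hRρ)
          refine h3 _ ?_
          rw [hVg, hg]
          linarith
  have h3 : ∃ᶠ y in 𝓝 x, U y < r + κ / 2 :=
    frequently_lt_of_liminf_lt (isCoboundedUnder_ge_of_abs_le hM) (by linarith)
  have h4 : ∀ᶠ y in 𝓝 x, ψ y < ψ x + κ / 2 :=
    (hψ.1.tendsto x).eventually_lt_const (by linarith)
  obtain ⟨y, h5, h6, h7⟩ := (h3.and_eventually (h4.and (Metric.ball_mem_nhds x hρ))).exists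
  have h8 := hmaxU V hVsub y
  have h9 : g y ≤ V y := by rw [hVin y h7]; exact le_max_right _ _
  rw [hg] at h9
  linarith

theorem inwardDeriv_bump (v : Fin N.n) (E : N.Edge) : N.inwardDeriv N.bump v E = 1 := by
  have hl := N.len_pos E
  have hd : ∀ t ∈ Icc 0 (N.len E), N.dx N.bump E t = (N.len E - 2 * t) / N.len E := fun t ht => by
    unfold bump
    rw [compatible_bump.dx_glue contDiff_bump ht]
    have := (((hasDerivAt_id t).mul ((hasDerivAt_id t).const_sub (N.len E))).div_const
      (N.len E)).deriv
    refine Eq.trans ?_ (this.trans ?_)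
    · rfl
    · simp; ring
  unfold inwardDeriv
  split_ifs
  · rw [hd 0 ⟨le_rfl, hl.le⟩]
    field_simp
    ring
  · rw [hd _ ⟨hl.le, le_rfl⟩]
    field_simp
    ring

theorem dx_const_mul {φ : N.carrier → ℝ} (c : ℝ) (E : N.Edge) (t : ℝ) :
    N.dx (fun x => c * φ x) E t = c * N.dx φ E t :=
  derivWithin_const_mul_field c

/-- Existence of strict supersolutions. -/
theorem Regular.exists_above (hP : P.Regular) : ∃ s K : ℝ, 0 ≤ s ∧
    ∀ x, ∀ r, K ≤ r → P.Above r (fun y => -(s * N.bump y)) x := by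
  have h1 : ∀ᶠ s in atTop, ∀ v, N.IsInterior v → 0 < P.F v 0 fun _ => -s :=
    eventually_all.2 fun v => by
      by_cases hv : N.IsInterior v
      · exact (hP.large v hv).mono fun s hs _ => hs
      · exact Eventually.of_forall fun s h => absurd h hv
  obtain ⟨s, hs, hs0⟩ := (h1.and (eventually_ge_atTop 0)).exists
  have hφ : N.IsC2 fun y => -(s * N.bump y) := IsC2.neg (isC2_bump.const_mul s)
  choose B hB using fun E => isCompact_Icc.exists_bound_of_continuousOn
    (hP.continuousOn_gAt hφ E 0)
  have h2 : ∀ᶠ K in atTop, ∀ E, B E < P.lam * K := eventually_all.2 fun E =>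
    (tendsto_id.const_mul_atTop hP.lam_pos).eventually_gt_atTop (B E)
  have h3 : ∀ᶠ K in atTop, ∀ v, P.h v < K := eventually_all.2 fun v => eventually_gt_atTop _
  obtain ⟨K, h2, h3, h4⟩ := (h2.and (h3.and (eventually_ge_atTop 0))).exists
  refine ⟨s, K, hs0, fun x r hr => ⟨fun E t ht _ => ?_, fun v hv _ => ?_, fun v _ _ => ?_⟩⟩
  · have h5 := hB E t ht
    have h6 := neg_abs_le (P.GAt E 0 (fun y => -(s * N.bump y)) t)
    have h7 := mul_le_mul_of_nonneg_left hr hP.lam_pos.le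
    rw [Real.norm_eq_abs] at h5
    rw [gAt_eq]
    linarith [h2 E]
  · have : (fun E : N.Inc v => N.inwardDeriv (fun y => -(s * N.bump y)) v E) = fun _ => -s := by
      funext E
      have h5 := inwardDeriv_bump v E.1
      rw [inwardDeriv_eq] at h5
      rw [inwardDeriv_neg, inwardDeriv_eq, dx_const_mul]
      linear_combination (-s) * h5
    rw [this]
    exact (hs v hv).trans_le (hP.mono v hv r 0 _ _ (h4.trans hr) fun _ => le_rfl)
  · exact (h3 v).trans_le hr

/-- Subsolutions are bounded above by a common constant. -/
theorem Regular.exists_upper_bound (hP : P.Regular) :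
    ∃ K, ∀ u, P.IsSubsolution u → ∀ x, u x ≤ K := by
  obtain ⟨s, K, hs, hK⟩ := hP.exists_above
  obtain ⟨B, hB⟩ := exists_bump_le (N := N)
  refine ⟨K + s * B, fun u hu x => ?_⟩
  have hc : N.IsC2 fun y => -(s * N.bump y) := IsC2.neg (isC2_bump.const_mul s)
  have husc : UpperSemicontinuous fun y => u y + s * N.bump y :=
    hu.usc.add (Continuous.upperSemicontinuous (continuous_const.mul isC2_bump.1))
  obtain ⟨z, -, hz⟩ := (husc.upperSemicontinuousOn univ).exists_forall_le isCompact_univ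
    ⟨x, mem_univ x⟩
  have h1 : u z < K := by
    by_contra! h
    refine hu.not_above hc (x := z) ?_ (hK z _ h)
    exact Eventually.of_forall fun y => by
      have := hz y (mem_univ y)
      linarith
  have h2 := hz x (mem_univ x)
  have h3 := mul_nonneg hs (bump_nonneg x)
  have h4 := mul_le_mul_of_nonneg_left (hB z) hs
  linarith

/-- A strict supersolution of the dual problem changes sign into a strict subsolution; subtracting
`s * B` keeps the values below `-K` everywhere. -/
theorem Regular.exists_subsolution (hP : P.Regular) (hPd : P.dual.Regular) :
    ∃ u, P.IsSubsolution u ∧ Continuous u := by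
  obtain ⟨s, K, hs, hK⟩ := hPd.exists_above
  obtain ⟨B, hB⟩ := exists_bump_le (N := N)
  have hc : N.IsC2 fun y => s * N.bump y := isC2_bump.const_mul s
  have hcont : Continuous fun y => s * N.bump y - (K + s * B) := hc.1.sub continuous_const
  refine ⟨_, isSubsolution_of_not_above hcont.upperSemicontinuous fun φ hφ x hm ha => ?_, hcont⟩
  refine Above.not_touching hP hc hφ ?_ (hK x _ ?_) ha
  · filter_upwards [hm] with y hy
    linarith
  · have := mul_le_mul_of_nonneg_left (hB x) hs
    linarith

end NetworkProblem

end

/-! ### Existence and uniqueness -/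

noncomputable section

namespace NetworkProblem

open Network

variable {d : ℕ} {N : Network d} {P : NetworkProblem N} {U : N.carrier → ℝ} {M : ℝ}

theorem Standing.regular (hP : P.Standing) : P.Regular where
  lam_pos := hP.lam_pos
  ham := hP.ham
  diffusion := hP.diffusion
  continuous v hv p := (hP.kirchhoff v hv).continuous.comp (continuous_id.prodMk continuous_const)
  mono v hv := (hP.kirchhoff v hv).mono
  large v hv := by
    obtain ⟨E⟩ := nonempty_inc v
    have h := ((hP.kirchhoff v hv).tendsto_atTop E 0 fun _ => 0).comp tendsto_neg_atTop_atBot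
    filter_upwards [h.eventually_gt_atTop 0, eventually_ge_atTop 0] with c h1 h2
    refine h1.trans_le ((hP.kirchhoff v hv).mono 0 0 _ _ le_rfl fun i => ?_)
    by_cases hi : i = E
    · subst hi; simp
    · rw [Function.update_of_ne hi]; linarith

/-- The limit of the Kirchhoff functions at `+∞` enters here only; it produces the subsolution that
starts Perron's method. -/
theorem Standing.regular_dual (hP : P.Standing) : P.dual.Regular where
  lam_pos := hP.lam_pos
  ham E := by
    obtain ⟨C, hC, h1, h2⟩ := hP.ham E
    refine ⟨C, hC, fun x hx y hy p => ?_, fun x hx p q => ?_⟩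
    · have := h1 x hx y hy (-p)
      rw [abs_neg] at this
      change |-P.H E x (-p) - -P.H E y (-p)| ≤ _
      rwa [neg_sub_neg, abs_sub_comm]
    · have := h2 x hx (-p) (-q)
      change |-P.H E x (-p) - -P.H E x (-q)| ≤ _
      rw [neg_sub_neg, abs_sub_comm]
      rwa [neg_sub_neg, abs_sub_comm q] at this
  diffusion := hP.diffusion
  continuous v hv p := ((hP.kirchhoff v hv).continuous.comp
    (continuous_neg.prodMk continuous_const)).neg
  mono v hv r s p q hrs hpq := neg_le_neg ((hP.kirchhoff v hv).mono _ _ _ _ (neg_le_neg hrs)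
    fun i => neg_le_neg (hpq i))
  large v hv := by
    obtain ⟨E⟩ := nonempty_inc v
    have h := hP.coercive v hv E 0 fun _ => 0
    filter_upwards [h.eventually_lt_atBot 0, eventually_ge_atTop 0] with c h1 h2
    have h3 := (hP.kirchhoff v hv).mono 0 0 (Function.update (fun _ => 0) E c) (fun _ => c) le_rfl
      fun i => by
        by_cases hi : i = E
        · subst hi; simp
        · rw [Function.update_of_ne hi]; exact h2
    simp only [dual, neg_neg, neg_zero]
    linarith

/-- There is a largest subsolution, and its lower envelope is a supersolution. -/
theorem Standing.exists_maximal (hP : P.Standing) : ∃ U : N.carrier → ℝ, ∃ M, (∀ x, |U x| ≤ M) ∧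
    P.IsSubsolution U ∧ P.IsSupersolution fun x => liminf U (𝓝 x) := by
  obtain ⟨K, hK⟩ := hP.regular.exists_upper_bound
  obtain ⟨u₀, hu₀, hc₀⟩ := hP.regular.exists_subsolution hP.regular_dual
  obtain ⟨L, hL⟩ := (isCompact_range hc₀).bddBelow
  have hL := fun x => hL (mem_range_self x)
  obtain ⟨U, hU⟩ : ∃ U : N.carrier → ℝ,
      ∀ x, U x = ⨆ i : {u : N.carrier → ℝ // P.IsSubsolution u}, i.1 x := ⟨_, fun _ => rfl⟩
  have hbdd : ∀ x, BddAbove (range fun i : {u : N.carrier → ℝ // P.IsSubsolution u} => i.1 x) :=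
    fun x => ⟨K, by rintro _ ⟨i, rfl⟩; exact hK i.1 i.2 x⟩
  have hne : Nonempty {u : N.carrier → ℝ // P.IsSubsolution u} := ⟨⟨u₀, hu₀⟩⟩
  have hle : ∀ (i : {u : N.carrier → ℝ // P.IsSubsolution u}) x, i.1 x ≤ U x := fun i x => by
    rw [hU]
    exact le_ciSup (hbdd x) i
  have hM : ∀ x, |U x| ≤ max |K| |L| := fun x => by
    have h1 : U x ≤ K := by
      rw [hU]
      exact ciSup_le fun i => hK i.1 i.2 x
    have h2 : L ≤ U x := (hL x).trans (hle ⟨u₀, hu₀⟩ x)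
    exact abs_le.2 ⟨(neg_le_neg (le_max_right _ _)).trans ((neg_abs_le L).trans h2),
      h1.trans ((le_abs_self K).trans (le_max_left _ _))⟩
  have hsub := hP.regular.isSubsolution_limsup (fun i => i.2) hM hle fun x c hc => by
    rw [hU] at hc
    exact exists_lt_of_lt_ciSup hc
  -- The upper envelope is itself one of the competing subsolutions.
  have heq : (fun x => limsup U (𝓝 x)) = U := funext fun x =>
    le_antisymm (hle ⟨_, hsub⟩ x) (le_limsup_nhds hM x)
  rw [heq] at hsub
  exact ⟨U, _, hM, hsub, hP.regular.isSupersolution_liminf hP.regular_dual hsub hM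
    fun V hV => hle ⟨V, hV⟩⟩

theorem tendsto_ray_nhdsNE (v : Fin N.n) (E : N.Inc v) :
    Tendsto (N.ray v E.1) (𝓝[>] 0) (𝓝[≠] N.vertex v) := by
  refine tendsto_nhdsWithin_iff.2 ⟨?_, ?_⟩
  · have := (continuous_ray v E.1).tendsto 0
    rw [ray_zero] at this
    exact this.mono_left nhdsWithin_le_nhds
  · filter_upwards [Ioo_mem_nhdsGT (N.len_pos E.1)] with x hx
    exact N.param_ne_vertex (inw_mem_Ioo hx) v

instance (v : Fin N.n) : (𝓝[≠] N.vertex v).NeBot :=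
  let ⟨E⟩ := nonempty_inc v
  (tendsto_ray_nhdsNE v E).neBot

theorem IsSubsolution.le_boundary_value (hP : P.Standing) (hU : P.IsSubsolution U)
    (hM : ∀ x, |U x| ≤ M) {v : Fin N.n} (hv : N.IsBoundary v) : U (N.vertex v) ≤ P.h v := by
  obtain ⟨δ, hδ, k, C₁, hC₁, hb⟩ := hP.exists_vertex_barrier v (P.lam * M)
  exact hU.le_boundary hP.lam_pos.le hM hv hδ hC₁ hb

/-- Subsolutions may be lowered at the boundary vertices to the limit of their interior values. -/
theorem IsSubsolution.exists_interior_limit (hP : P.Standing) (hU : P.IsSubsolution U)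
    (hM : ∀ x, |U x| ≤ M) : ∃ V : N.carrier → ℝ, P.IsSubsolution V ∧
      (∀ x, (∀ v, N.IsBoundary v → x ≠ N.vertex v) → V x = U x) ∧
      ∀ v, N.IsBoundary v → V (N.vertex v) = limsup U (𝓝[≠] N.vertex v) := by
  classical
  obtain ⟨V, hV⟩ : ∃ V : N.carrier → ℝ, ∀ x, V x =
      if ∃ v, N.IsBoundary v ∧ x = N.vertex v then limsup U (𝓝[≠] x) else U x :=
    ⟨_, fun _ => rfl⟩
  have hVi : ∀ x, (∀ v, N.IsBoundary v → x ≠ N.vertex v) → V x = U x := fun x hx => by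
    rw [hV, if_neg]
    rintro ⟨v, hv, h⟩
    exact hx v hv h
  have hVb : ∀ v, N.IsBoundary v → V (N.vertex v) = limsup U (𝓝[≠] N.vertex v) := fun v hv => by
    rw [hV, if_pos ⟨v, hv, rfl⟩]
  have hle : ∀ x, V x ≤ U x := fun x => by
    rw [hV]
    split_ifs with h
    · obtain ⟨v, hv, rfl⟩ := h
      refine le_of_forall_gt_imp_ge_of_dense fun c hc => ?_
      exact limsup_le_of_le (isCoboundedUnder_le_of_abs_le hM)
        (((hU.usc _ c hc).filter_mono nhdsWithin_le_nhds).mono fun _ h => h.le)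
    · exact le_rfl
  have hnear : ∀ x, ∀ᶠ y in 𝓝[≠] x, V y = U y := fun x => by
    have hfin : ((range N.vertex) \ {x}).Finite := (finite_range _).subset sdiff_subset
    have h1 : ∀ᶠ y in 𝓝 x, y ∉ (range N.vertex) \ {x} :=
      hfin.isClosed.isOpen_compl.mem_nhds fun h => h.2 rfl
    filter_upwards [h1.filter_mono nhdsWithin_le_nhds, eventually_mem_nhdsWithin] with y h2 h3
    exact hVi y fun v _ h => h2 ⟨⟨v, h.symm⟩, h3⟩
  have heq : ∀ x, (∀ v, N.IsBoundary v → x ≠ N.vertex v) → ∀ᶠ y in 𝓝 x, V y = U y := fun x hx => by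
    filter_upwards [eventually_nhdsWithin_iff.1 (hnear x)] with y hy
    by_cases h : y = x
    · rw [h, hVi x hx]
    · exact hy h
  have hmax : ∀ {φ : N.carrier → ℝ} {x}, (∀ v, N.IsBoundary v → x ≠ N.vertex v) →
      IsLocalMax (fun y => V y - φ y) x → IsLocalMax (fun y => U y - φ y) x :=
    fun {φ x} hx hm => by
      filter_upwards [hm, heq x hx] with y h1 h2
      rw [h2, hVi x hx] at h1
      exact h1
  refine ⟨V, ⟨fun x c hc => ?_, fun φ hφ E t ht hm => ?_, fun φ hφ v hv hm => ?_,
    fun φ hφ v hv hm => ?_⟩, hVi, hVb⟩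
  · have hc : V x < c := hc
    change ∀ᶠ y in 𝓝 x, V y < c
    by_cases h : ∃ v, N.IsBoundary v ∧ x = N.vertex v
    · obtain ⟨v, hv, rfl⟩ := h
      have hc' := hc
      rw [hVb v hv] at hc'
      have h1 := eventually_lt_of_limsup_lt hc' (isBoundedUnder_le_of_abs_le hM)
      filter_upwards [eventually_nhdsWithin_iff.1 h1] with y hy
      by_cases h : y = N.vertex v
      · rwa [h]
      · exact (hle y).trans_lt (hy h)
    · push Not at h
      rw [hVi x h] at hc
      have h1 : ∀ᶠ y in 𝓝 x, U y < c := hU.usc x c hc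
      filter_upwards [h1] with y hy using (hle y).trans_lt hy
  · have hx : ∀ v, N.IsBoundary v → N.param E t ≠ N.vertex v := fun v _ => N.param_ne_vertex ht v
    rw [hVi _ hx]
    exact hU.edge φ hφ E t ht (hmax hx hm)
  · have hx : ∀ v', N.IsBoundary v' → N.vertex v ≠ N.vertex v' := fun v' hv' h => by
      obtain rfl := N.vertex_injective h
      exact hv'.not_isInterior hv
    rw [hVi _ hx]
    exact hU.interior φ hφ v hv (hmax hx hm)
  -- The lowered function inherits the pointwise Dirichlet inequality of `U`, so no test function
  -- needs to be examined.
  · right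
    have := hle (N.vertex v)
    have := hU.le_boundary_value hP hM hv
    linarith

theorem isSolution_of_continuous {u : N.carrier → ℝ} (hu : Continuous u) :
    P.IsSolution u ↔ P.IsSubsolution u ∧ P.IsSupersolution u := by
  have h1 : (fun x => limsup u (𝓝 x)) = u := funext fun x => (hu.tendsto x).limsup_eq
  have h2 : (fun x => liminf u (𝓝 x)) = u := funext fun x => (hu.tendsto x).liminf_eq
  constructor
  · intro h
    have h3 := h.sub
    have h4 := h.super
    rw [h1] at h3
    rw [h2] at h4
    exact ⟨h3, h4⟩
  · intro h
    refine ⟨fun x => ⟨|u x| + 1, ?_⟩, by rw [h1]; exact h.1, by rw [h2]; exact h.2⟩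
    filter_upwards [(hu.abs.tendsto x).eventually_lt_const (lt_add_one _)] with y hy using hy.le

theorem exists_abs_le {u : N.carrier → ℝ} (hu : Continuous u) : ∃ M, ∀ x, |u x| ≤ M := by
  obtain ⟨M, hM⟩ := (isCompact_range hu.abs).bddAbove
  exact ⟨M, fun x => hM (mem_range_self x)⟩

/-- Comparison of `V` with the lower envelope of `U` gives `V ≤ liminf U`. The reverse inequality
holds by construction, so `V` is both upper and lower semicontinuous. -/
theorem Standing.exists_solution (hP : P.Standing) :
    ∃ u : N.carrier → ℝ, Continuous u ∧ P.IsSolution u := by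
  obtain ⟨U, M, hM, hsub, hsuper⟩ := hP.exists_maximal
  obtain ⟨V, hV, hVi, hVb⟩ := hsub.exists_interior_limit hP hM
  have hVM : ∀ x, |V x| ≤ M := fun x => by
    by_cases h : ∃ v, N.IsBoundary v ∧ x = N.vertex v
    · obtain ⟨v, hv, rfl⟩ := h
      rw [hVb v hv]
      exact abs_limsup_le hM
    · push Not at h
      rw [hVi x h]
      exact hM x
  have hle : ∀ x, V x ≤ liminf U (𝓝 x) := hP.comparison hV hsuper hVM (fun x => abs_liminf_le hM)
    fun v hv E ε hε => by
      rw [hVb v hv]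
      -- A boundary vertex has a single edge, so a bound along that edge is a bound in a punctured
      -- neighborhood and would lower the limsup by `ε`.
      intro hcon
      have h1 : ∀ᶠ y in 𝓝 (N.vertex v), y ≠ N.vertex v →
          U y ≤ limsup U (𝓝[≠] N.vertex v) - ε := by
        have := hv.subsingleton
        refine eventually_nhds_vertex (fun h => absurd rfl h) fun E' => ?_
        rw [Subsingleton.elim E' E]
        filter_upwards [hcon, Ioo_mem_nhdsGT (N.len_pos E.1)] with x h2 h3 _
        rw [hVi (N.ray v E.1 x) fun v' _ => N.param_ne_vertex (inw_mem_Ioo h3) v'] at h2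
        exact not_lt.1 h2
      have h2 : ∀ᶠ y in 𝓝[≠] N.vertex v, U y ≤ limsup U (𝓝[≠] N.vertex v) - ε :=
        eventually_nhdsWithin_iff.2 h1
      have h3 := limsup_le_of_le (isCoboundedUnder_le_of_abs_le hM) h2
      linarith
  have hge : ∀ x, liminf U (𝓝 x) ≤ V x := fun x => by
    by_cases h : ∃ v, N.IsBoundary v ∧ x = N.vertex v
    · obtain ⟨v, hv, rfl⟩ := h
      rw [hVb v hv]
      exact (liminf_le_liminf_of_le nhdsWithin_le_nhds (isBoundedUnder_ge_of_abs_le hM)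
        (isCoboundedUnder_ge_of_abs_le hM)).trans (liminf_le_limsup
          (isBoundedUnder_le_of_abs_le hM) (isBoundedUnder_ge_of_abs_le hM))
    · push Not at h
      rw [hVi x h]
      exact liminf_nhds_le hM x
  have heq : (fun x => liminf U (𝓝 x)) = V := funext fun x => le_antisymm (hge x) (hle x)
  rw [heq] at hsuper
  have hc : Continuous V := continuous_iff_lower_upperSemicontinuous.2 ⟨hsuper.lsc, hV.usc⟩
  exact ⟨V, hc, (isSolution_of_continuous hc).2 ⟨hV, hsuper⟩⟩

/-- For continuous functions the approach condition at the boundary vertices in `comparison` is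
automatic. -/
theorem Standing.solution_le (hP : P.Standing) {u w : N.carrier → ℝ} (hu : Continuous u)
    (hw : Continuous w) (hsu : P.IsSolution u) (hsw : P.IsSolution w) (x : N.carrier) :
    u x ≤ w x := by
  obtain ⟨M, hM⟩ := exists_abs_le hu
  obtain ⟨M', hM'⟩ := exists_abs_le hw
  refine hP.comparison ((isSolution_of_continuous hu).1 hsu).1
    ((isSolution_of_continuous hw).1 hsw).2 (M := max M M')
    (fun x => (hM x).trans (le_max_left _ _)) (fun x => (hM' x).trans (le_max_right _ _))
    (fun v _ E ε hε => ?_) x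
  have h : ∀ᶠ y in 𝓝 (N.vertex v), u (N.vertex v) - ε < u y :=
    (hu.tendsto _).eventually_const_lt (by linarith)
  exact (eventually_ray h E).frequently

theorem Standing.existsUnique_solution (hP : P.Standing) :
    ∃! u : N.carrier → ℝ, Continuous u ∧ P.IsSolution u := by
  obtain ⟨u, hu, hsu⟩ := hP.exists_solution
  exact ⟨u, ⟨hu, hsu⟩, fun w hw => funext fun x => le_antisymm
    (hP.solution_le hw.1 hu hw.2 hsu x) (hP.solution_le hu hw.1 hsu hw.2 x)⟩

end NetworkProblem

end

/-! ### Local Lipschitz continuity -/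

noncomputable section

theorem abs_sub_le_of_forall_le {u : ℝ → ℝ} {s : Set ℝ} {C : ℝ}
    (h : ∀ x ∈ s, ∀ y ∈ s, x ≤ y → u y ≤ u x + C * (y - x) ∧ u x ≤ u y + C * (y - x)) :
    ∀ x ∈ s, ∀ y ∈ s, |u x - u y| ≤ C * |x - y| := by
  intro x hx y hy
  rcases le_total x y with hxy | hxy
  · obtain ⟨h1, h2⟩ := h x hx y hy hxy
    rw [abs_sub_comm x, abs_of_nonneg (sub_nonneg.2 hxy)]
    exact abs_le.2 ⟨by linarith, by linarith⟩
  · obtain ⟨h1, h2⟩ := h y hy x hx hxy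
    rw [abs_of_nonneg (sub_nonneg.2 hxy)]
    exact abs_le.2 ⟨by linarith, by linarith⟩

section EdgeLipschitz

variable {L M ℓ k C₁ : ℝ} {a : ℝ → ℝ} {H : ℝ → ℝ → ℝ} {u : ℝ → ℝ}

/-- Each point near `t` has room `2 r` on both sides, so barriers issued from it with a constant
depending only on `r` and `M` give both inequalities. -/
theorem IsEdgeSub.exists_lipschitz_interior (hL : 0 ≤ L) (h : IsEdgeSub L a H (Ioo 0 ℓ) u)
    (hu : UpperSemicontinuous u) (hM : ∀ t, |u t| ≤ M)
    (hb : HasBarrierWith a H (Icc 0 ℓ) (L * M) k C₁) {t : ℝ} (ht : t ∈ Ioo 0 ℓ) :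
    ∃ C, ∃ r > 0, Icc (t - r) (t + r) ⊆ Icc 0 ℓ ∧
      ∀ x ∈ Icc (t - r) (t + r), ∀ y ∈ Icc (t - r) (t + r), |u x - u y| ≤ C * |x - y| := by
  have hk := hb.1
  obtain ⟨r, hr, hr1, hr2, hr3⟩ : ∃ r > 0, 3 * r ≤ t ∧ 3 * r ≤ ℓ - t ∧ 4 * k * (2 * r) ≤ 1 := by
    have h1 : 0 < ℓ - t := sub_pos.2 ht.2
    have h0 := ht.1
    refine ⟨min (min (t / 3) ((ℓ - t) / 3)) (1 / (8 * k)), by positivity, ?_, ?_, ?_⟩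
    · have := (min_le_left (min (t / 3) ((ℓ - t) / 3)) (1 / (8 * k))).trans (min_le_left _ _)
      linarith
    · have := (min_le_left (min (t / 3) ((ℓ - t) / 3)) (1 / (8 * k))).trans (min_le_right _ _)
      linarith
    · have := min_le_right (min (t / 3) ((ℓ - t) / 3)) (1 / (8 * k))
      rw [le_div_iff₀ (by positivity)] at this
      linarith
  obtain ⟨C, hC, hCM⟩ : ∃ C, C₁ ≤ C ∧ 2 * M ≤ 3 / 4 * C * (2 * r) := by
    refine ⟨max C₁ (2 * M / (3 / 2 * r)), le_max_left _ _, ?_⟩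
    have := le_max_right C₁ (2 * M / (3 / 2 * r))
    rw [div_le_iff₀ (by positivity)] at this
    linarith
  have hsub : ∀ α β, 0 ≤ α → β ≤ ℓ → Ioo α β ⊆ Ioo 0 ℓ := fun α β => Ioo_subset_Ioo
  refine ⟨C, r, hr, Icc_subset_Icc (by linarith) (by linarith),
    abs_sub_le_of_forall_le fun x hx y hy hxy => ⟨?_, ?_⟩⟩
  · have hs := hsub x (x + 2 * r) (by linarith [hx.1]) (by linarith [hx.2])
    exact (h.mono hs).le_right_of_bounded hL hu hM (hb.mono (hs.trans Ioo_subset_Icc_self))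
      (by linarith) hC (by simpa using hr3) (by simpa using hCM) y
      ⟨hxy, by linarith [hx.1, hy.2]⟩
  · have hs := hsub (y - 2 * r) y (by linarith [hy.1]) (by linarith [hy.2])
    exact (h.mono hs).le_left_of_bounded hL hu hM (hb.mono (hs.trans Ioo_subset_Icc_self))
      (by linarith) hC (by simpa using hr3) (by simpa using hCM) x
      ⟨by linarith [hx.1, hy.2], hxy⟩

/-- Towards the end point there is no fixed room, so the bound `2 * M` on the oscillation is useless
there. It is replaced by the Lipschitz bound `h0` at the end point, which feeds the barrier on `[0,
y]`. -/
theorem IsEdgeSub.exists_lipschitz_end (hL : 0 ≤ L) (hℓ : 0 < ℓ)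
    (h : IsEdgeSub L a H (Ioo 0 ℓ) u) (hu : UpperSemicontinuous u) (hM : ∀ t, |u t| ≤ M)
    (hb : HasBarrierWith a H (Icc 0 ℓ) (L * M) k C₁) (hk : 4 * k * ℓ ≤ 1) {C₀ : ℝ}
    (h0 : ∀ x ∈ Icc 0 ℓ, |u x - u 0| ≤ C₀ * x) :
    ∃ C, ∀ x ∈ Icc 0 (ℓ / 2), ∀ y ∈ Icc 0 (ℓ / 2), |u x - u y| ≤ C * |x - y| := by
  have hk0 := hb.1
  obtain ⟨C, hC, hCM, hC0⟩ : ∃ C, C₁ ≤ C ∧ 2 * M ≤ 3 / 4 * C * (ℓ / 2) ∧ C₀ ≤ 3 / 4 * C := by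
    refine ⟨max (max C₁ (2 * M / (3 / 8 * ℓ))) (4 / 3 * C₀),
      (le_max_left _ _).trans (le_max_left _ _), ?_, ?_⟩
    · have := (le_max_right C₁ (2 * M / (3 / 8 * ℓ))).trans (le_max_left _ (4 / 3 * C₀))
      rw [div_le_iff₀ (by positivity)] at this
      linarith
    · linarith [le_max_right (max C₁ (2 * M / (3 / 8 * ℓ))) (4 / 3 * C₀)]
  have hkle : ∀ c, c ≤ ℓ → 4 * k * c ≤ 1 := fun c hc =>
    (mul_le_mul_of_nonneg_left hc (by positivity)).trans hk
  have hsub : ∀ α β, 0 ≤ α → β ≤ ℓ → Ioo α β ⊆ Ioo 0 ℓ := fun α β => Ioo_subset_Ioo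
  refine ⟨C, abs_sub_le_of_forall_le fun x hx y hy hxy => ⟨?_, ?_⟩⟩
  · have hs := hsub x (x + ℓ / 2) hx.1 (by linarith [hx.2])
    exact (h.mono hs).le_right_of_bounded hL hu hM (hb.mono (hs.trans Ioo_subset_Icc_self))
      (by linarith) hC (hkle _ (by linarith)) (by simpa using hCM) y ⟨hxy, by linarith [hx.1, hy.2]⟩
  · have hs := hsub 0 y le_rfl (by linarith [hy.2])
    refine (h.mono hs).le_left hL hu hM (hb.mono (hs.trans Ioo_subset_Icc_self)) hC hy.1
      (hkle _ (by linarith [hy.2])) ?_ x ⟨hx.1, hxy⟩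
    have h1 := (abs_le.1 (h0 y ⟨hy.1, by linarith [hy.2]⟩)).1
    have h2 := mul_le_mul_of_nonneg_right hC0 hy.1
    rw [sub_zero]
    linarith

end EdgeLipschitz

namespace Network

variable {d : ℕ} {N : Network d}

theorem exists_direction (v : Fin N.n) (E : N.Inc v) : ∃ e : EuclideanSpace ℝ (Fin d),
    ∀ x ∈ Icc 0 (N.len E.1), (N.ray v E.1 x : EuclideanSpace ℝ (Fin d)) = N.vert v + x • e := by
  obtain ⟨E, hE⟩ := E
  have hl := (N.len_pos E).ne'
  by_cases h : v = N.src E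
  · refine ⟨(1 / N.len E) • (N.vert (N.tgt E) - N.vert (N.src E)), fun x hx => ?_⟩
    unfold ray
    rw [N.coe_param E (inw_mem_Icc hx), inw, if_pos h, h, edgePoint, smul_smul, mul_one_div]
  · have h' := hE.resolve_left h
    refine ⟨(1 / N.len E) • (N.vert (N.src E) - N.vert (N.tgt E)), fun x hx => ?_⟩
    unfold ray
    rw [N.coe_param E (inw_mem_Icc hx), inw, if_neg h, h', edgePoint, smul_smul, mul_one_div,
      sub_div, div_self hl, sub_smul, one_smul, smul_sub, smul_sub]
    abel

/-- The distance of points on different edges is comparable to the geodesic distance. -/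
theorem exists_add_le_dist {v : Fin N.n} {E E' : N.Inc v} (hE : E ≠ E') : ∃ D, 0 ≤ D ∧
    ∀ x ∈ Icc 0 (N.len E.1), ∀ y ∈ Icc 0 (N.len E'.1), x ≤ N.len E'.1 →
      x + y ≤ D * dist (N.ray v E.1 x) (N.ray v E'.1 y) := by
  obtain ⟨e, he⟩ := exists_direction v E
  obtain ⟨e', he'⟩ := exists_direction v E'
  have hl := N.len_pos E.1
  have hl' := N.len_pos E'.1
  have hd : ∀ x ∈ Icc 0 (N.len E.1), x ≤ N.len E'.1 →
      dist (N.ray v E.1 x) (N.ray v E'.1 x) = x * ‖e - e'‖ := fun x hx hx' => by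
    rw [Subtype.dist_eq, he x hx, he' x ⟨hx.1, hx'⟩, dist_add_left, dist_eq_norm, ← smul_sub,
      norm_smul, Real.norm_of_nonneg hx.1]
  -- Two edges leaving `v` in the same direction would overlap in interior points.
  have hm : 0 < ‖e - e'‖ := by
    rw [norm_pos_iff, sub_ne_zero]
    intro heq
    obtain ⟨x, hx0, hx⟩ := exists_between (lt_min hl hl')
    have h1 := hx.trans_le (min_le_left _ _)
    have h2 := hx.trans_le (min_le_right _ _)
    have h3 := hd x ⟨hx0.le, h1.le⟩ h2.le
    rw [heq, sub_self, norm_zero, mul_zero, dist_eq_zero] at h3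
    exact hE (Subtype.ext (N.param_eq_param_of_mem_Ioo (inw_mem_Ioo ⟨hx0, h1⟩)
      (inw_mem_Icc ⟨hx0.le, h2.le⟩) h3).1)
  have h0 : ∀ (E : N.Inc v) (x : ℝ), x ∈ Icc 0 (N.len E.1) →
      dist (N.ray v E.1 x) (N.vertex v) = x := fun E x hx => by
    have := dist_ray v E.1 hx ⟨le_rfl, (N.len_pos E.1).le⟩
    rwa [ray_zero, sub_zero, abs_of_nonneg hx.1] at this
  refine ⟨4 / ‖e - e'‖ + 1, by positivity, fun x hx y hy hxl => ?_⟩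
  have h1 := hd x hx hxl
  have h2 := h0 E x hx
  have h3 := h0 E' y hy
  have h4 := dist_triangle (N.ray v E.1 x) (N.ray v E'.1 y) (N.ray v E'.1 x)
  rw [dist_ray v E'.1 hy ⟨hx.1, hxl⟩, h1] at h4
  have h5 := dist_triangle (N.ray v E.1 x) (N.ray v E'.1 y) (N.vertex v)
  have h6 := dist_triangle (N.ray v E'.1 y) (N.ray v E.1 x) (N.vertex v)
  rw [dist_comm (N.ray v E'.1 y) (N.ray v E.1 x)] at h6
  rw [h2, h3] at h5 h6
  have h7 : |y - x| ≤ dist (N.ray v E.1 x) (N.ray v E'.1 y) := abs_le.2 ⟨by linarith, by linarith⟩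
  have h8 : x ≤ 2 / ‖e - e'‖ * dist (N.ray v E.1 x) (N.ray v E'.1 y) := by
    rw [div_mul_eq_mul_div, le_div_iff₀ hm]
    linarith
  have h9 : 4 / ‖e - e'‖ = 2 * (2 / ‖e - e'‖) := by ring
  rw [h9]
  linarith

end Network

namespace NetworkProblem

open Network

variable {d : ℕ} {N : Network d} {P : NetworkProblem N} {u : N.carrier → ℝ} {M : ℝ}

theorem Standing.exists_full_barrier (hP : P.Standing) {E : N.Edge}
    (h : HamiltonianCoercive (N.closedEdge E) (P.H E) ∨
      ∃ α > 0, ∀ x ∈ N.closedEdge E, α ≤ P.a E x) (v : Fin N.n) (m : ℝ) :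
    ∃ k C₁, HasBarrierWith (P.rayA v E) (P.rayH v E) (Icc 0 (N.len E)) m k C₁ := by
  obtain ⟨D, σ, hreg⟩ := exists_isRegularEdge (hP.ham E) (hP.diffusion E) v
  rcases h with ⟨C, hC, h⟩ | ⟨α, hα, h⟩
  · refine hasBarrierWith_of_coercive m hC (fun t ht => hreg.diffusion_nonneg ht) fun t ht p => ?_
    have := h _ (N.coe_param_mem E (N.inw v E t)) (N.orient v E * p)
    rw [abs_mul, abs_orient, one_mul] at this
    exact this
  · refine hasBarrierWith_of_elliptic m hα ?_ (fun t ht => h _ (N.coe_param_mem E _))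
      fun t ht => hreg.neg_le_ham ht
    have := hreg.nonneg
    have := N.len_pos E
    positivity

theorem IsSubsolution.lipschitz_interior (hP : P.Standing) (hu : P.IsSubsolution u)
    (hM : ∀ x, |u x| ≤ M) {E : N.Edge} (h : HamiltonianCoercive (N.closedEdge E) (P.H E) ∨
      ∃ α > 0, ∀ x ∈ N.closedEdge E, α ≤ P.a E x) {t : ℝ} (ht : t ∈ Ioo 0 (N.len E)) :
    ∃ K, ∃ s ∈ 𝓝 (N.param E t), LipschitzOnWith K u s := by
  obtain ⟨k, C₁, hb⟩ := hP.exists_full_barrier h (N.src E) (P.lam * M)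
  obtain ⟨C, r, hr, hsub, hC⟩ := (hu.isEdgeSub (N.src E) E).exists_lipschitz_interior
    hP.lam_pos.le (upperSemicontinuous_ray hu.usc (N.src E) E) (fun t => hM _) hb ht
  simp only [ray_src] at hC
  refine ⟨C.toNNReal, N.param E '' Icc (t - r) (t + r), N.eventually_nhds_param ht ?_,
    LipschitzOnWith.of_dist_le_mul ?_⟩
  · filter_upwards [Icc_mem_nhds (by linarith : t - r < t) (by linarith : t < t + r)] with s hs
      using mem_image_of_mem _ hs
  · rintro _ ⟨x, hx, rfl⟩ _ ⟨y, hy, rfl⟩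
    rw [N.dist_param E (hsub hx) (hsub hy), Real.dist_eq]
    exact (hC x hx y hy).trans (mul_le_mul_of_nonneg_right (Real.le_coe_toNNReal C) (abs_nonneg _))

/-- Along one edge the one-dimensional bound applies. For points on different edges the path through
the vertex is used, its length being comparable to the Euclidean distance because the edges meet at
a positive angle. -/
theorem IsSubsolution.lipschitz_vertex (hP : P.Standing) (hu : P.IsSubsolution u)
    (hM : ∀ x, |u x| ≤ M) {v : Fin N.n} (hv : N.IsInterior v) :
    ∃ K, ∃ s ∈ 𝓝 (N.vertex v), LipschitzOnWith K u s := by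
  obtain ⟨δ, hδ, k, C₁, hC₁, hb⟩ := hP.exists_vertex_barrier v (P.lam * M)
  obtain ⟨C₀, hC₀, h0⟩ := hu.vertex_lipschitz hP.lam_pos.le hM hv (hP.kirchhoff v hv) hδ hC₁ hb
  choose C hC using fun E : N.Inc v => ((hu.isEdgeSub v E.1).mono
    (Ioo_subset_Ioo_right (hb E).1)).exists_lipschitz_end hP.lam_pos.le hδ
    (upperSemicontinuous_ray hu.usc v E.1) (fun t => hM _) (hb E).2.2 (hb E).2.1 (C₀ := C₀)
    (by simpa only [ray_zero] using h0 E)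
  have hD : ∀ E E' : N.Inc v, ∃ D, 0 ≤ D ∧ (E ≠ E' → ∀ x ∈ Icc 0 (N.len E.1),
      ∀ y ∈ Icc 0 (N.len E'.1), x ≤ N.len E'.1 →
      x + y ≤ D * dist (N.ray v E.1 x) (N.ray v E'.1 y)) := fun E E' => by
    by_cases h : E = E'
    · exact ⟨0, le_rfl, fun h' => absurd h h'⟩
    · obtain ⟨D, hD0, hD⟩ := exists_add_le_dist h
      exact ⟨D, hD0, fun _ => hD⟩
  choose D hD0 hD using hD
  have h1 : ∀ᶠ K in atTop, ∀ E, C E ≤ K := eventually_all.2 fun E => eventually_ge_atTop _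
  have h2 : ∀ᶠ K in atTop, ∀ E E', C₀ * D E E' ≤ K :=
    eventually_all.2 fun E => eventually_all.2 fun E' => eventually_ge_atTop _
  obtain ⟨K, ⟨h1, h2⟩, hK⟩ := ((h1.and h2).and (eventually_ge_atTop 0)).exists
  have hle : ∀ (E : N.Inc v) (x : ℝ), x ∈ Icc 0 (δ / 2) → x ∈ Icc 0 (N.len E.1) :=
    fun E x hx => ⟨hx.1, by linarith [hx.2, (hb E).1]⟩
  refine ⟨⟨K, hK⟩, {y | ∃ E : N.Inc v, ∃ x ∈ Icc 0 (δ / 2), N.ray v E.1 x = y}, ?_,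
    LipschitzOnWith.of_dist_le_mul ?_⟩
  · refine eventually_nhds_vertex ?_ fun E => ?_
    · obtain ⟨E⟩ := nonempty_inc v
      exact ⟨E, 0, ⟨le_rfl, by positivity⟩, ray_zero v E⟩
    · filter_upwards [Ioo_mem_nhdsGT (half_pos hδ)] with x hx using ⟨E, x, ⟨hx.1.le, hx.2.le⟩, rfl⟩
  · rintro _ ⟨E, x, hx, rfl⟩ _ ⟨E', y, hy, rfl⟩
    rw [Real.dist_eq]
    change _ ≤ K * _
    by_cases h : E = E'
    · subst h
      rw [dist_ray v E.1 (hle E x hx) (hle E y hy)]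
      exact (hC E x hx y hy).trans (mul_le_mul_of_nonneg_right (h1 E) (abs_nonneg _))
    · have h3 := h0 E x ⟨hx.1, by linarith [hx.2]⟩
      have h4 := h0 E' y ⟨hy.1, by linarith [hy.2]⟩
      have h5 := abs_sub_le (u (N.ray v E.1 x)) (u (N.vertex v)) (u (N.ray v E'.1 y))
      rw [abs_sub_comm (u (N.vertex v))] at h5
      have h6 := mul_le_mul_of_nonneg_left
        (hD E E' h x (hle E x hx) y (hle E' y hy) (hle E' x hx).2) hC₀
      have h7 := mul_le_mul_of_nonneg_right (h2 E E')
        (dist_nonneg (x := N.ray v E.1 x) (y := N.ray v E'.1 y))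
      linarith

theorem Standing.locallyLipschitzOn (hP : P.Standing)
    (h : ∀ E : N.Edge, HamiltonianCoercive (N.closedEdge E) (P.H E) ∨
      ∃ α > 0, ∀ x ∈ N.closedEdge E, α ≤ P.a E x) (hu : Continuous u) (hsol : P.IsSolution u) :
    LocallyLipschitzOn {x | ∀ v : Fin N.n, N.IsBoundary v → x ≠ N.vertex v} u := by
  intro x hx
  obtain ⟨M, hM⟩ := exists_abs_le hu
  have hsub := ((isSolution_of_continuous hu).1 hsol).1
  have hx : ∀ v : Fin N.n, N.IsBoundary v → x ≠ N.vertex v := hx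
  suffices ∃ K, ∃ s ∈ 𝓝 x, LipschitzOnWith K u s by
    obtain ⟨K, s, hs, hK⟩ := this
    exact ⟨K, s, mem_nhdsWithin_of_mem_nhds hs, hK⟩
  rcases vertex_or_param x with ⟨v, rfl⟩ | ⟨E, t, ht, rfl⟩
  · exact hsub.lipschitz_vertex hP hM
      ((isBoundary_or_isInterior v).resolve_left fun hb => hx v hb rfl)
  · exact hsub.lipschitz_interior hP hM (h E) ht

end NetworkProblem

end

theorem theorem5p5 {d : ℕ} (N : Network d) (P : NetworkProblem N)
    (hlam : 0 < P.lam)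
    (hH : ∀ E : N.Edge, HamiltonianRegular (N.closedEdge E) (P.H E))
    (ha : ∀ E : N.Edge, DiffusionRegular (N.closedEdge E) (P.a E))
    (hF : ∀ v : Fin N.n, N.IsInterior v → KirchhoffFunction (P.F v))
    (hdeg : ∀ (v : Fin N.n) (E : N.Inc v),
      (∃ δ > 0, HamiltonianCoercive (N.closedEdge E ∩ Metric.ball (N.vert v) δ) (P.H E)) ∨
        0 < P.a E (N.vert v))
    (hFcoer : ∀ v : Fin N.n, N.IsInterior v → KirchhoffCoercive (P.F v)) :
    (∃! u : N.carrier → ℝ, Continuous u ∧ P.IsSolution u) ∧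
    ((∀ E : N.Edge, HamiltonianCoercive (N.closedEdge E) (P.H E) ∨
        ∃ α > 0, ∀ x ∈ N.closedEdge E, α ≤ P.a E x) →
      ∀ u : N.carrier → ℝ, Continuous u → P.IsSolution u →
        LocallyLipschitzOn {x | ∀ v : Fin N.n, N.IsBoundary v → x ≠ N.vertex v} u) := by
  have hP : P.Standing := ⟨hlam, hH, ha, hF, hdeg, hFcoer⟩
  exact ⟨hP.existsUnique_solution, fun h u hu hsol => hP.locallyLipschitzOn h hu hsol⟩
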